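/- Let $D=(-1,1)$, $\psi_k(x)=\sin\big(\tfrac{k\pi}{2}(x+1)\big)$ and $\bar\mu_k=(k\pi/2)^2$ for $k\ge 1$ (the Dirichlet eigenfunctions and eigenvalues of $-\Delta$ on $D$), and let $\langle\cdot,\cdot\rangle$ be the inner product of $L^2(D)$. For $\alpha,\gamma\in(0,2)$ put $\mu_k=\bar\mu_k^{\alpha/2}+\bar\mu_k^{\gamma/2}$ and $$\dot H^{\alpha,\gamma}=\Big\{v\in L^2(D):\ \sum_{k\ge1}\mu_k^2\langle v,\psi_k\rangle^2<\infty\Big\},\qquad \mathtt L^{\alpha,\gamma}v=-(-\Delta)^{\alpha/2}v-(-\Delta)^{\gamma/2}v:=-\sum_{k\ge1}\mu_k\langle v,\psi_k\rangle\psi_k ,$$ with $\|v\|_{\dot H^{\alpha,\gamma}}=\|\mathtt L^{\alpha,\gamma}v\|_{L^2(D)}$. For $\beta\in(0,1)$ let $\partial_t^\beta u(t)=\frac1{\Gamma(1-\beta)}\int_0^t (t-s)^{-\beta}u'(s)\,ds$ be the Caputo derivative of an $L^2(D)$-valued function, which is required to be differentiable on $(0,T)$ with $s\mapsto(t-s)^{-\beta}u'(s)$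 integrable on $(0,t)$ for each $t\in(0,T]$. Let $T>0$ and $f\in L^2(D)$. A weak solution of $$\partial_t^\beta u=-(-\Delta)^{\alpha/2}u-(-\Delta)^{\gamma/2}u,\qquad u(t,\pm1)=0,\qquad u(0,\cdot)=f$$ is a function $u(t,x)$, $0<t\le T$, $-1\le x\le 1$, such that for each $t$ the function $u(t,\cdot)$ is continuous on $[-1,1]$, vanishes at $\pm1$ and lies in $\dot H^{\alpha,\gamma}$; $u(t,x)\to f(x)$ as $t\downarrow0$ for a.e. $x\in D$; the curve $t\mapsto u(t,\cdot)$, with value $f$ at $t=0$, belongs to $C([0,T];L^2(D))\cap C((0,T];\dot H^{\alpha,\gamma})$ and has a Caputo derivative of order $\beta$ on $(0,T]$ in the above sense; and $\partial_t^\beta u(t,\cdot)=\mathtt L^{\alpha,\gamma}u(t,\cdot)$ in $L^2(D)$ for every $t\in(0,T]$. **Theorem (Lipschitz continuity of the input-output map).** Let $\beta_0,\alpha_0,\gamma_0>0$, $\beta_1<1$, $\alpha_1,\gamma_1<2$ and $B=[\beta_0,\beta_1]\times[\alpha_0,\alpha_1]\times[\gamma_0,\gamma_1]$. Let $f\in L^2(D)$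 be such that $f\in\dot H^{\alpha,\gamma}$ for all $(\beta,\alpha,\gamma)\in B$ and $\sum_{k\ge1}|\langle f,\psi_k\rangle|<\infty$ (the latter follows from the former if $B\neq\emptyset$ and $\max(\alpha_1,\gamma_1)>1/2$). Then for every $(\beta,\alpha,\gamma)\in B$ there is exactly one weak solution $u(\beta,\alpha,\gamma)$, its trace $t\mapsto u(\beta,\alpha,\gamma)(t,0)$ belongs to $L^2(0,T]$, and the map $$F:B\to L^2(0,T],\qquad F(\beta,\alpha,\gamma)=u(\beta,\alpha,\gamma)(\cdot,0),$$ is Lipschitz continuous: there is $K\ge 0$ with $$\|F(a)-F(\hat a)\|_{L^2(0,T]}\le K\max\big(|\beta-\hat\beta|,|\alpha-\hat\alpha|,|\gamma-\hat\gamma|\big)\qquad\text{for all } a=(\beta,\alpha,\gamma),\ \hat a=(\hat\beta,\hat\alpha,\hat\gamma)\in B.$$ -/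

import Mathlib

open Real Set Filter Topology MeasureTheory

noncomputable section

namespace DoubleFrac

/-- Lebesgue measure on the interval `D = (-1, 1)`. -/
abbrev volD : Measure ℝ := volume.restrict (Ioo (-1 : ℝ) 1)

/-- The Hilbert space `L²(D)`. -/
abbrev L2D : Type := Lp ℝ 2 volD

/-- The Dirichlet eigenfunctions `x ↦ sin (k π (x + 1) / 2)` of `-Δ` on `D`, with `k = n + 1`
(so `n = 0` is the first one). -/
def eigenFun (n : ℕ) (x : ℝ) : ℝ := Real.sin (((n : ℝ) + 1) * π / 2 * (x + 1))

theorem memLp_eigenFun (n : ℕ) : MemLp (eigenFun n) 2 volD := by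
  refine MemLp.of_bound (C := 1) ?_ ?_
  · have h : Continuous (eigenFun n) := by
      unfold eigenFun
      fun_prop
    exact h.aestronglyMeasurable
  · refine Eventually.of_forall fun x => ?_
    rw [Real.norm_eq_abs]
    exact Real.abs_sin_le_one _

/-- The eigenfunctions as elements of `L²(D)`. -/
def eigenVec (n : ℕ) : L2D := (memLp_eigenFun n).toLp (eigenFun n)

/-- The coefficients `⟨v, ψ⟩` of `v` in the system of eigenfunctions. -/
def coeff (v : L2D) (n : ℕ) : ℝ := inner ℝ (eigenVec n) v

/-- The Dirichlet eigenvalues `(k π / 2) ^ 2` of `-Δ` on `D`, with `k = n + 1`. -/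
def lapEigenvalue (n : ℕ) : ℝ := (((n : ℝ) + 1) * π / 2) ^ 2

/-- The eigenvalues of `(-Δ)^{α/2} + (-Δ)^{γ/2}`. -/
def fracEigenvalue (α γ : ℝ) (n : ℕ) : ℝ :=
  lapEigenvalue n ^ (α / 2) + lapEigenvalue n ^ (γ / 2)

/-- `v` lies in the domain of `(-Δ)^{α/2} + (-Δ)^{γ/2}` (spectral definition). -/
def MemHdot (α γ : ℝ) (v : L2D) : Prop :=
  Summable fun n => fracEigenvalue α γ n ^ 2 * coeff v n ^ 2

/-- The operator `-(-Δ)^{α/2} - (-Δ)^{γ/2}` on its domain `{v | MemHdot α γ v}`; the series converges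
in `L²(D)` there. -/
def fracOp (α γ : ℝ) (v : L2D) : L2D :=
  -∑' n, (fracEigenvalue α γ n * coeff v n) • eigenVec n

/-- The Caputo derivative of order `β ∈ (0, 1)` of an `L²(D)`-valued function:
`Γ(1 - β)⁻¹ ∫₀ᵗ (t - s)^{-β} U'(s) ds`. -/
def caputo (β : ℝ) (U : ℝ → L2D) (t : ℝ) : L2D :=
  (Real.Gamma (1 - β))⁻¹ • ∫ s in (0 : ℝ)..t, (t - s) ^ (-β) • deriv U s

/-- The `L²(D)`-valued function `U` has a Caputo derivative of order `β` on `(0, T]`, i.e. the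
expression `caputo β U t` is meaningful for every `t` in `(0, T]`. -/
structure HasCaputoOn (T β : ℝ) (U : ℝ → L2D) : Prop where
  differentiableAt : ∀ s ∈ Ioo 0 T, DifferentiableAt ℝ U s
  intervalIntegrable : ∀ t ∈ Ioc 0 T,
    IntervalIntegrable (fun s => (t - s) ^ (-β) • deriv U s) volume 0 t

/-- `U` is the curve `t ↦ u(t, ·)` in `C([0,T]; L²(D)) ∩ C((0,T]; Ḣ)`, where `Ḣ` is the domain of
the operator with norm `‖fracOp α γ v‖`, it starts at `f`, and it solves
`∂_t^β U = -(-Δ)^{α/2} U - (-Δ)^{γ/2} U` in `L²(D)` on `(0, T]`. -/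
structure IsSolutionCurve (T β α γ : ℝ) (f : L2D) (U : ℝ → L2D) : Prop where
  initial : U 0 = f
  continuousOn : ContinuousOn U (Icc 0 T)
  memHdot : ∀ t ∈ Ioc 0 T, MemHdot α γ (U t)
  continuousOn_fracOp : ContinuousOn (fun t => fracOp α γ (U t)) (Ioc 0 T)
  hasCaputo : HasCaputoOn T β U
  equation : ∀ t ∈ Ioc 0 T, caputo β U t = fracOp α γ (U t)

/-- `u(t, x)`, `0 < t ≤ T`, `-1 ≤ x ≤ 1`, is a weak solution of
`∂_t^β u = -(-Δ)^{α/2} u - (-Δ)^{γ/2} u`, `u(t, ±1) = 0`, `u(0, ·) = f`. Continuity in `x` gives the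
boundary values and the value at an interior point their meaning. -/
structure IsWeakSolution (T β α γ : ℝ) (f : L2D) (u : ℝ → ℝ → ℝ) : Prop where
  continuousOn : ∀ t ∈ Ioc 0 T, ContinuousOn (u t) (Icc (-1) 1)
  boundary : ∀ t ∈ Ioc 0 T, u t (-1) = 0 ∧ u t 1 = 0
  initial : ∀ᵐ x ∂volD, Tendsto (fun t => u t x) (𝓝[>] 0) (𝓝 (f x))
  curve : ∃ U : ℝ → L2D, (∀ t ∈ Ioc 0 T, ⇑(U t) =ᵐ[volD] u t) ∧ IsSolutionCurve T β α γ f U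

/-- The box `[β₀, β₁] × [α₀, α₁] × [γ₀, γ₁]` of parameters `(β, α, γ)`. -/
def paramBox (β₀ β₁ α₀ α₁ γ₀ γ₁ : ℝ) : Set (ℝ × ℝ × ℝ) :=
  Icc β₀ β₁ ×ˢ Icc α₀ α₁ ×ˢ Icc γ₀ γ₁

end DoubleFrac

end

noncomputable section

namespace DoubleFrac

/-! ### The spectral density of the Mittag-Leffler function -/

/-! In the sine basis `eigenBasis` the equation decouples into scalar relaxation equations with
rates μ_n = `fracEigenvalue α γ n`, solved by `coeff f n` times `mode`, that is, E_β(-μ_n t^β). All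
facts about this Mittag-Leffler function come from one representation: it is a mixture of the
exponentials exp(-e^x t) with an explicit positive density `mlKernel`, of total mass one and
decaying like e^{-β|x|}. Since `mlFun` is defined by the mixture, what must be proved is that it
solves the relaxation equation. Cauchy's theorem gives the Stieltjes transform of the density
(`integral_mlKernel_div`), hence the Laplace transforms of `mlFun` and of its derivative;
injectivity of the Laplace transform (`ae_eq_of_laplace_eq`) and continuity then give
`integral_caputo_mlRate`.

Existence: absolute summability of the coefficients of f makes the series converge uniformly up to t
= 0. The bounds t⁻¹ for the time derivative of a mode and C t^{-β} for μ_n times a mode do not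
depend on n, so for t > 0 the derivative, the operator and the Caputo integral act term by term
(`isWeakSolution_solFun`). Uniqueness: a coefficient of a solution minus its expected value
satisfies the relaxation equation with zero initial value, and vanishes by a maximum principle
(`caputo_lower_bound_of_isMax`). Completeness of the sines then identifies the curve in L², and
continuity in x identifies the values.

Lipschitz bound: with L = log μ_n a mode is the integral of exp(-e^{x + L/β} t) against the density,
so the parameters enter only through a translation and the density. Changing β at fixed L costs a
factor 1 + |log t|, uniformly in L (`abs_kernel_sub_le`). Changing L at fixed β costs |L - L'|,
which grows like the logarithm of the Laplace eigenvalue, but the decay of the mode in its rate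
absorbs this (`exists_abs_mlFun_sub_rate_le`). Every mode is thus Lipschitz with constant C
t^{-β₀/4}, independent of n. This is summed against the coefficients of f, and the weight is square
integrable on (0, T]. -/

/-- The density in the representation
`E_β(-t ^ β) = ∫ exp (-(t * exp x)) * mlKernel β x` of the Mittag-Leffler function. -/
def mlKernel (β x : ℝ) : ℝ := Real.sin (π * β) / π / (2 * (Real.cosh (β * x) + Real.cos (π * β)))

theorem neg_one_lt_cos_pi_mul {β : ℝ} (h0 : 0 < β) (h1 : β < 1) : -1 < Real.cos (π * β) := by
  rw [← Real.cos_pi]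
  exact Real.strictAntiOn_cos ⟨by positivity, by nlinarith [pi_pos]⟩ ⟨pi_pos.le, le_rfl⟩
    (by nlinarith [pi_pos])

theorem cosh_add_lower {C c : ℝ} (hC : 1 ≤ C) (hc' : -1 ≤ c) (hc : c ≤ 1) :
    (1 + c) / 2 * C ≤ C + c := by
  nlinarith

theorem exp_abs_le_two_cosh (y : ℝ) : Real.exp |y| ≤ 2 * Real.cosh y := by
  rw [← Real.cosh_abs, Real.cosh_eq]
  have := Real.exp_pos (-|y|)
  linarith

/-- The cosine decreases on [0, π], so its value at πb is the worst case for all orders up to b. The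
constant degenerates as b tends to 1, which is why the orders must stay away from 1. -/
theorem mlKernel_denom_lower {β b : ℝ} (h0 : 0 < β) (hb : β ≤ b) (h1 : b < 1) (x : ℝ) :
    (1 + Real.cos (π * b)) / 2 * Real.exp (β * |x|)
      ≤ 2 * (Real.cosh (β * x) + Real.cos (π * β)) := by
  have hcb := neg_one_lt_cos_pi_mul (h0.trans_le hb) h1
  have hmono : Real.cos (π * b) ≤ Real.cos (π * β) :=
    Real.strictAntiOn_cos.antitoneOn ⟨by positivity, by nlinarith [pi_pos]⟩
      ⟨by nlinarith [pi_pos], by nlinarith [pi_pos]⟩ (by nlinarith [pi_pos])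
  have h := cosh_add_lower (Real.one_le_cosh (β * x)) hcb.le (Real.cos_le_one (π * b))
  have h2 := exp_abs_le_two_cosh (β * x)
  rw [abs_mul, abs_of_pos h0] at h2
  nlinarith

theorem mlKernel_denom_pos {β : ℝ} (h0 : 0 < β) (h1 : β < 1) (x : ℝ) :
    0 < 2 * (Real.cosh (β * x) + Real.cos (π * β)) := by
  have := neg_one_lt_cos_pi_mul h0 h1
  have := Real.one_le_cosh (β * x)
  linarith

theorem sin_pi_mul_pos {β : ℝ} (h0 : 0 < β) (h1 : β < 1) : 0 < Real.sin (π * β) :=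
  Real.sin_pos_of_pos_of_lt_pi (by positivity) (by nlinarith [pi_pos])

theorem mlKernel_pos {β : ℝ} (h0 : 0 < β) (h1 : β < 1) (x : ℝ) : 0 < mlKernel β x :=
  div_pos (div_pos (sin_pi_mul_pos h0 h1) pi_pos) (mlKernel_denom_pos h0 h1 x)

theorem mlKernel_le {β b : ℝ} (h0 : 0 < β) (hb : β ≤ b) (h1 : b < 1) (x : ℝ) :
    mlKernel β x ≤ 2 / (1 + Real.cos (π * b)) * Real.exp (-(β * |x|)) := by
  have hcb := neg_one_lt_cos_pi_mul (h0.trans_le hb) h1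
  have hd := mlKernel_denom_lower h0 hb h1 x
  have hp : 0 < (1 + Real.cos (π * b)) / 2 * Real.exp (β * |x|) :=
    mul_pos (by linarith) (exp_pos _)
  have hs : Real.sin (π * β) / π ≤ 1 := by
    rw [div_le_one pi_pos]
    exact (Real.sin_le_one _).trans (by linarith [pi_gt_three])
  calc mlKernel β x ≤ 1 / ((1 + Real.cos (π * b)) / 2 * Real.exp (β * |x|)) := by
        unfold mlKernel
        exact div_le_div₀ zero_le_one hs hp hd
    _ = _ := by
        rw [Real.exp_neg]
        have : (1 + Real.cos (π * b)) ≠ 0 := by linarith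
        field_simp

theorem continuous_mlKernel {β : ℝ} (h0 : 0 < β) (h1 : β < 1) : Continuous (mlKernel β) := by
  unfold mlKernel
  exact continuous_const.div (by fun_prop) fun x => (mlKernel_denom_pos h0 h1 x).ne'

theorem integrable_exp_neg_mul_abs {a : ℝ} (ha : 0 < a) :
    Integrable fun x : ℝ => Real.exp (-(a * |x|)) := by
  have h : IntegrableOn (fun x : ℝ => Real.exp (-(a * |x|))) (Ioi 0) := by
    refine (exp_neg_integrableOn_Ioi 0 ha).congr_fun (fun x hx => ?_) measurableSet_Ioi
    simp only [abs_of_pos (mem_Ioi.1 hx), neg_mul]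
  have h' : IntegrableOn (fun x : ℝ => Real.exp (-(a * |x|))) (Iic 0) := by
    rw [← integrableOn_Ici_iff_integrableOn_Ioi] at h
    have := h.comp_neg
    simpa using this
  rw [← integrableOn_univ, ← Iic_union_Ioi (a := (0 : ℝ))]
  exact h'.union h

theorem integrable_mlKernel {β : ℝ} (h0 : 0 < β) (h1 : β < 1) : Integrable (mlKernel β) := by
  refine ((integrable_exp_neg_mul_abs h0).const_mul (2 / (1 + Real.cos (π * β)))).mono'
    (continuous_mlKernel h0 h1).aestronglyMeasurable (ae_of_all _ fun x => ?_)
  rw [Real.norm_of_nonneg (mlKernel_pos h0 h1 x).le]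
  exact mlKernel_le h0 le_rfl h1 x

/-! ### The Stieltjes transform of the density, by a contour integral -/

/-- `ζ ^ β / (1 + ζ ^ β)` in the variable `w = log ζ`. -/
def stieltjesAux (β : ℝ) (w : ℂ) : ℂ := Complex.exp (β * w) / (Complex.exp (β * w) + 1)

/-- In this strip z is the principal logarithm of its exponential, and the principal logarithm of -1
lies on the excluded edge. -/
theorem exp_add_one_ne_zero {z : ℂ} (h1 : -π < z.im) (h2 : z.im < π) : Complex.exp z + 1 ≠ 0 := by
  intro h
  have h' : Complex.exp z = -1 := eq_neg_of_add_eq_zero_left h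
  have := Complex.log_exp h1 h2.le
  rw [h', Complex.log_neg_one] at this
  rw [← this] at h2
  simp at h2

/-- Because β < 1, scaling moves the closed strip into the open one; the poles of `stieltjesAux` are
avoided even on the edges of the contour. -/
theorem mul_im_mem {β : ℝ} (h0 : 0 < β) (h1 : β < 1) {w : ℂ} (hw : |w.im| ≤ π) :
    -π < ((β : ℂ) * w).im ∧ ((β : ℂ) * w).im < π := by
  have := abs_le.1 hw
  rw [Complex.im_ofReal_mul]
  constructor <;> nlinarith [pi_pos]

theorem differentiableAt_stieltjesAux {β : ℝ} (h0 : 0 < β) (h1 : β < 1) {w : ℂ} (hw : |w.im| ≤ π) :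
    DifferentiableAt ℂ (stieltjesAux β) w := by
  unfold stieltjesAux
  have := mul_im_mem h0 h1 hw
  exact DifferentiableAt.div (by fun_prop) (by fun_prop) (exp_add_one_ne_zero this.1 this.2)

/-- The function integrated along the boundary of a rectangle; `p = exp v`. -/
def stieltjesContour (β v : ℝ) (w : ℂ) : ℂ :=
  dslope (stieltjesAux β) v w / dslope Complex.exp v w

/-- Two points with equal exponentials differ by 2πin; as v is real, the height bound forces n = 0.
Thus the only zero of e^w - e^v in the strip is the simple one at v, which the divided difference
removes. -/
theorem dslope_exp_ne_zero {v : ℝ} {w : ℂ} (hw : |w.im| ≤ π) :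
    dslope Complex.exp (v : ℂ) w ≠ 0 := by
  rcases eq_or_ne w v with rfl | h
  · rw [dslope_same, Complex.deriv_exp]
    exact Complex.exp_ne_zero _
  · rw [dslope_of_ne _ h, slope_def_field]
    refine div_ne_zero (sub_ne_zero.2 fun he => h ?_) (sub_ne_zero.2 h)
    obtain ⟨n, hn⟩ := Complex.exp_eq_exp_iff_exists_int.1 he
    have him := congrArg Complex.im hn
    simp at him
    rw [him, abs_mul, abs_of_pos (show (0 : ℝ) < 2 * π by positivity)] at hw
    have hlt : |(n : ℝ)| < 1 := by nlinarith [pi_pos]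
    have hn0 : n = 0 := by
      rw [← Int.abs_lt_one_iff]
      exact_mod_cast hlt
    simpa [hn0] using hn

theorem stieltjesContour_of_ne {β v : ℝ} {w : ℂ} (h : w ≠ v) :
    stieltjesContour β v w =
      (stieltjesAux β w - stieltjesAux β v) / (Complex.exp w - Complex.exp v) := by
  have h' : w - v ≠ 0 := sub_ne_zero.2 h
  unfold stieltjesContour
  rw [dslope_of_ne _ h, dslope_of_ne _ h, slope_def_field, slope_def_field,
    div_div_div_cancel_right₀ h']

theorem continuousAt_stieltjesContour {β : ℝ} (h0 : 0 < β) (h1 : β < 1) (v : ℝ) {w : ℂ}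
    (hw : |w.im| ≤ π) : ContinuousAt (stieltjesContour β v) w := by
  unfold stieltjesContour
  refine ContinuousAt.div₀ ?_ ?_ (dslope_exp_ne_zero hw)
  · rcases eq_or_ne w v with rfl | h
    · exact continuousAt_dslope_same.2 (differentiableAt_stieltjesAux h0 h1 hw)
    · exact (continuousAt_dslope_of_ne h).2 (differentiableAt_stieltjesAux h0 h1 hw).continuousAt
  · rcases eq_or_ne w v with rfl | h
    · exact continuousAt_dslope_same.2 Complex.differentiableAt_exp
    · exact (continuousAt_dslope_of_ne h).2 Complex.continuous_exp.continuousAt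

theorem differentiableAt_stieltjesContour {β : ℝ} (h0 : 0 < β) (h1 : β < 1) {v : ℝ} {w : ℂ}
    (hw : |w.im| ≤ π) (h : w ≠ v) : DifferentiableAt ℂ (stieltjesContour β v) w := by
  unfold stieltjesContour
  exact DifferentiableAt.div (𝕜 := ℂ) ((differentiableAt_dslope_of_ne h).2
    (differentiableAt_stieltjesAux h0 h1 hw))
    ((differentiableAt_dslope_of_ne h).2 Complex.differentiableAt_exp) (dslope_exp_ne_zero hw)

theorem stieltjesAux_edge (β x : ℝ) :
    stieltjesAux β (x + π * Complex.I) =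
      Real.exp (β * x) * (Real.cos (π * β) + Real.sin (π * β) * Complex.I) /
      (Real.exp (β * x) * (Real.cos (π * β) + Real.sin (π * β) * Complex.I) + 1) := by
  have h : Complex.exp (β * (x + π * Complex.I)) =
      Real.exp (β * x) * (Real.cos (π * β) + Real.sin (π * β) * Complex.I) := by
    rw [mul_add, Complex.exp_add, ← mul_assoc, Complex.exp_mul_I]
    push_cast
    rw [mul_comm (β : ℂ) (π : ℂ)]
  rw [stieltjesAux, h]

theorem stieltjesAux_edge' (β x : ℝ) :
    stieltjesAux β (x + (-π : ℝ) * Complex.I) =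
      Real.exp (β * x) * (Real.cos (π * β) - Real.sin (π * β) * Complex.I) /
      (Real.exp (β * x) * (Real.cos (π * β) - Real.sin (π * β) * Complex.I) + 1) := by
  have h : Complex.exp (β * (x + (-π : ℝ) * Complex.I)) =
      Real.exp (β * x) * (Real.cos (π * β) - Real.sin (π * β) * Complex.I) := by
    rw [mul_add, Complex.exp_add, ← mul_assoc, Complex.exp_mul_I]
    push_cast
    rw [mul_comm (β : ℂ) (-π : ℂ), neg_mul, Complex.cos_neg, Complex.sin_neg, neg_mul,
      ← sub_eq_add_neg]
  rw [stieltjesAux, h]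

/-- The two edges carry conjugate values z and z̄ of ζ^β, and z/(1+z) - z̄/(1+z̄) = (z - z̄)/|1+z|².
This is where the formula for the density comes from. -/
theorem stieltjesAux_jump {β : ℝ} (h0 : 0 < β) (h1 : β < 1) (x : ℝ) :
    stieltjesAux β (x + π * Complex.I) - stieltjesAux β (x + (-π : ℝ) * Complex.I)
      = 2 * π * Complex.I * (mlKernel β x : ℂ) := by
  have e1 := stieltjesAux_edge β x
  have e2 := stieltjesAux_edge' β x
  have n1 : (Real.exp (β * x) * (Real.cos (π * β) + Real.sin (π * β) * Complex.I) + 1 : ℂ) ≠ 0 := by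
    have h := Complex.exp_ne_zero ((β * x : ℝ) : ℂ)
    intro hz
    have him := congrArg Complex.im hz
    simp [-Complex.ofReal_mul, -Complex.ofReal_exp, -Complex.ofReal_cos,
      -Complex.ofReal_sin] at him
    exact (sin_pi_mul_pos h0 h1).ne' him
  have n2 : (Real.exp (β * x) * (Real.cos (π * β) - Real.sin (π * β) * Complex.I) + 1 : ℂ) ≠ 0 := by
    have h := Complex.exp_ne_zero ((β * x : ℝ) : ℂ)
    intro hz
    have him := congrArg Complex.im hz
    simp [-Complex.ofReal_mul, -Complex.ofReal_exp, -Complex.ofReal_cos,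
      -Complex.ofReal_sin] at him
    exact (sin_pi_mul_pos h0 h1).ne' him
  have hd := (mlKernel_denom_pos h0 h1 x).ne'
  have hk : mlKernel β x * π * (Real.exp (β * x) * Real.exp (β * x)
      + 2 * Real.exp (β * x) * Real.cos (π * β) + 1)
      = Real.sin (π * β) * Real.exp (β * x) := by
    have hE := (Real.exp_pos (β * x)).ne'
    have hc : 2 * Real.cosh (β * x) * Real.exp (β * x)
        = Real.exp (β * x) * Real.exp (β * x) + 1 := by
      rw [Real.cosh_eq, Real.exp_neg]
      field_simp
    have : Real.exp (β * x) * Real.exp (β * x) + 2 * Real.exp (β * x) * Real.cos (π * β) + 1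
        = (2 * (Real.cosh (β * x) + Real.cos (π * β))) * Real.exp (β * x) := by
      linear_combination -hc
    rw [this, mlKernel]
    generalize 2 * (Real.cosh (β * x) + Real.cos (π * β)) = d at *
    field_simp
  have hk' := congrArg (fun r : ℝ => (r : ℂ)) hk
  have hcs := congrArg (fun r : ℝ => (r : ℂ)) (Real.sin_sq_add_cos_sq (π * β))
  simp only [Complex.ofReal_mul, Complex.ofReal_add, Complex.ofReal_pow, Complex.ofReal_one,
    Complex.ofReal_ofNat] at hk' hcs
  rw [e1, e2, div_sub_div _ _ n1 n2, div_eq_iff (mul_ne_zero n1 n2)]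
  generalize ((Real.exp (β * x) : ℝ) : ℂ) = E at *
  generalize ((Real.cos (π * β) : ℝ) : ℂ) = c at *
  generalize ((Real.sin (π * β) : ℝ) : ℂ) = s at *
  generalize ((mlKernel β x : ℝ) : ℂ) = k at *
  have hI := Complex.I_sq
  linear_combination (-2 * Complex.I) * hk' - 2 * π * Complex.I * k * E ^ 2 * hcs
    + 2 * π * Complex.I * k * E ^ 2 * s ^ 2 * hI

/-- On both edges e^w equals -e^x, so the denominators agree, the constant at v cancels and only the
jump is left. -/
theorem stieltjesContour_edges {β v : ℝ} (h0 : 0 < β) (h1 : β < 1) (x : ℝ) :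
    stieltjesContour β v (x + (-π : ℝ) * Complex.I) - stieltjesContour β v (x + π * Complex.I)
      = 2 * π * Complex.I * ((mlKernel β x / (Real.exp x + Real.exp v) : ℝ) : ℂ) := by
  have hne : ∀ y : ℝ, y ≠ 0 → (x + y * Complex.I : ℂ) ≠ v := fun y hy h => hy (by
    simpa using congrArg Complex.im h)
  have hexp : Complex.exp (x + π * Complex.I) = -Real.exp x := by
    rw [Complex.exp_add, Complex.exp_pi_mul_I]
    push_cast
    ring
  have hexp' : Complex.exp (x + (-π : ℝ) * Complex.I) = -Real.exp x := by
    rw [Complex.exp_add]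
    push_cast
    rw [neg_mul, Complex.exp_neg_pi_mul_I]
    ring
  have hnz : ((Real.exp x + Real.exp v : ℝ) : ℂ) ≠ 0 := by
    exact_mod_cast (add_pos (exp_pos x) (exp_pos v)).ne'
  rw [stieltjesContour_of_ne (hne _ (neg_ne_zero.2 pi_ne_zero)),
    stieltjesContour_of_ne (hne _ pi_ne_zero), hexp, hexp', ← Complex.ofReal_exp v]
  have hj := stieltjesAux_jump h0 h1 x
  have hneg : (-(Real.exp x : ℂ) - (Real.exp v : ℂ)) = -((Real.exp x + Real.exp v : ℝ) : ℂ) := by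
    push_cast
    ring
  rw [hneg, Complex.ofReal_div, ← sub_div, sub_sub_sub_cancel_right, div_neg, ← neg_div, neg_sub,
    hj, mul_div_assoc]

/-- Cauchy's theorem on [-R, R] × [-π, π]: the horizontal edges combine to the wanted integral. At
the removable singularity v only continuity is required. -/
theorem stieltjes_rectangle {β : ℝ} (h0 : 0 < β) (h1 : β < 1) (v R : ℝ) :
    2 * π * Complex.I * ((∫ x in (-R)..R, mlKernel β x / (Real.exp x + Real.exp v) : ℝ) : ℂ)
      + Complex.I * (∫ y in (-π)..π, stieltjesContour β v (R + y * Complex.I))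
      - Complex.I * (∫ y in (-π)..π, stieltjesContour β v ((-R : ℝ) + y * Complex.I)) = 0 := by
  have him : ∀ w ∈ (uIcc (-R) R ×ℂ uIcc (-π) π), |w.im| ≤ π := by
    intro w hw
    have := hw.2
    rw [mem_preimage, uIcc_of_le (by linarith [pi_pos])] at this
    exact abs_le.2 this
  have key := Complex.integral_boundary_rect_eq_zero_of_differentiable_on_off_countable
    (stieltjesContour β v) ((-R : ℝ) + (-π : ℝ) * Complex.I) (R + π * Complex.I) {(v : ℂ)}
    (countable_singleton _) (fun w hw => ?_) (fun w hw => ?_)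
  · simp only [Complex.add_re, Complex.add_im, Complex.ofReal_re, Complex.ofReal_im,
      Complex.re_ofReal_mul, Complex.im_ofReal_mul, Complex.I_re, Complex.I_im, mul_zero, mul_one,
      add_zero, zero_add, smul_eq_mul] at key
    rw [← intervalIntegral.integral_sub] at key
    · simp_rw [stieltjesContour_edges h0 h1] at key
      rw [intervalIntegral.integral_const_mul, intervalIntegral.integral_ofReal] at key
      exact key
    all_goals
      refine Continuous.intervalIntegrable (continuous_iff_continuousAt.2 fun x => ?_) _ _
      refine (continuousAt_stieltjesContour h0 h1 v ?_).comp (f := fun x : ℝ => _) (by fun_prop)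
      simp [abs_of_pos pi_pos]
  · simp only [Complex.add_re, Complex.add_im, Complex.ofReal_re, Complex.ofReal_im,
      Complex.re_ofReal_mul, Complex.im_ofReal_mul, Complex.I_re, Complex.I_im, mul_zero, mul_one,
      add_zero, zero_add] at hw
    exact (continuousAt_stieltjesContour h0 h1 v (him w hw)).continuousWithinAt
  · simp only [Complex.add_re, Complex.add_im, Complex.ofReal_re, Complex.ofReal_im,
      Complex.re_ofReal_mul, Complex.im_ofReal_mul, Complex.I_re, Complex.I_im, mul_zero, mul_one,
      add_zero, zero_add] at hw
    refine differentiableAt_stieltjesContour h0 h1 ?_ hw.2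
    have := hw.1.2
    rw [min_eq_left (by linarith [pi_pos]), max_eq_right (by linarith [pi_pos])] at this
    exact abs_le.2 ⟨this.1.le, this.2.le⟩

theorem norm_exp_mul_ofReal_add (β R y : ℝ) :
    ‖Complex.exp (β * (R + y * Complex.I))‖ = Real.exp (β * R) := by
  rw [Complex.norm_exp]
  simp

theorem norm_stieltjesAux_le {β : ℝ} {R y : ℝ} (h : 2 ≤ Real.exp (β * R)) :
    ‖stieltjesAux β (R + y * Complex.I)‖ ≤ 2 := by
  have hn := norm_exp_mul_ofReal_add β R y
  have h1 : Real.exp (β * R) - 1 ≤ ‖Complex.exp (β * (R + y * Complex.I)) + 1‖ := by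
    have := norm_sub_norm_le (Complex.exp (β * (R + y * Complex.I))) (-1)
    simpa [hn] using this
  rw [stieltjesAux, norm_div, hn, div_le_iff₀ (by linarith)]
  linarith

theorem norm_stieltjesAux_le' {β : ℝ} {R y : ℝ} (h : Real.exp (β * R) ≤ 1 / 2) :
    ‖stieltjesAux β (R + y * Complex.I)‖ ≤ 2 * Real.exp (β * R) := by
  have hn := norm_exp_mul_ofReal_add β R y
  have h1 : 1 - Real.exp (β * R) ≤ ‖Complex.exp (β * (R + y * Complex.I)) + 1‖ := by
    have := norm_sub_norm_le (1 : ℂ) (-Complex.exp (β * (R + y * Complex.I)))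
    rw [norm_neg, norm_one, hn, sub_neg_eq_add, add_comm] at this
    linarith
  have := Real.exp_pos (β * R)
  rw [stieltjesAux, norm_div, hn, div_le_iff₀ (by linarith)]
  nlinarith

theorem ofReal_add_mul_I_ne {R v : ℝ} (h : R ≠ v) (y : ℝ) : (R + y * Complex.I : ℂ) ≠ v :=
  fun he => h (by simpa using congrArg Complex.re he)

/-- The numerator stays bounded while the denominator grows like e^R. -/
theorem tendsto_right_edge {β : ℝ} (h0 : 0 < β) (v : ℝ) :
    Tendsto (fun R : ℝ => ∫ y in (-π)..π, stieltjesContour β v (R + y * Complex.I)) atTop (𝓝 0) := by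
  have hlim : Tendsto (fun R : ℝ => (2 + ‖stieltjesAux β v‖) / (Real.exp R - Real.exp v)
      * |π - -π|) atTop (𝓝 0) := by
    rw [← zero_mul |π - -π|]
    refine Tendsto.mul_const _ (Tendsto.div_atTop tendsto_const_nhds ?_)
    exact tendsto_atTop_add_const_right _ _ Real.tendsto_exp_atTop
  refine squeeze_zero_norm' ?_ hlim
  have e1 : ∀ᶠ R : ℝ in atTop, 2 ≤ Real.exp (β * R) :=
    (Real.tendsto_exp_atTop.comp (tendsto_id.const_mul_atTop h0)).eventually_ge_atTop 2
  filter_upwards [e1, eventually_gt_atTop v] with R hR hv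
  refine intervalIntegral.norm_integral_le_of_norm_le_const fun y _ => ?_
  rw [stieltjesContour_of_ne (ofReal_add_mul_I_ne hv.ne' y), norm_div]
  have hexp : Real.exp R - Real.exp v ≤ ‖Complex.exp (R + y * Complex.I) - Complex.exp v‖ := by
    have := norm_sub_norm_le (Complex.exp (R + y * Complex.I)) (Complex.exp v)
    simpa [Complex.norm_exp] using this
  refine div_le_div₀ (by positivity) ((norm_sub_le _ _).trans ?_)
    (sub_pos.2 (Real.exp_lt_exp.2 hv)) hexp
  gcongr
  exact norm_stieltjesAux_le hR

/-- Here e^w and `stieltjesAux β w` both tend to 0, so the integrand tends to a constant, integrated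
over an edge of length 2π. This edge produces the value of the Stieltjes transform. -/
theorem tendsto_left_edge {β : ℝ} (h0 : 0 < β) (h1 : β < 1) (v : ℝ) :
    Tendsto (fun R : ℝ => ∫ y in (-π)..π, stieltjesContour β v ((-R : ℝ) + y * Complex.I)) atTop
      (𝓝 (2 * π * (stieltjesAux β v / Real.exp v))) := by
  have hval : ∫ _ in (-π)..π, stieltjesAux β v / Real.exp v
      = 2 * π * (stieltjesAux β v / Real.exp v) := by
    rw [intervalIntegral.integral_const, Complex.real_smul]
    push_cast
    ring
  have t1 : Tendsto (fun R : ℝ => Real.exp (β * (-R))) atTop (𝓝 0) :=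
    Real.tendsto_exp_atBot.comp (tendsto_neg_atTop_atBot.const_mul_atBot h0)
  have t2 : Tendsto (fun R : ℝ => Real.exp (-R)) atTop (𝓝 0) :=
    Real.tendsto_exp_atBot.comp tendsto_neg_atTop_atBot
  have e1 : ∀ᶠ R : ℝ in atTop, Real.exp (β * (-R)) ≤ 1 / 2 := t1.eventually_le_const (by norm_num)
  have e2 : ∀ᶠ R : ℝ in atTop, Real.exp (-R) ≤ Real.exp v / 2 :=
    t2.eventually_le_const (by positivity)
  have e3 : ∀ᶠ R : ℝ in atTop, -R ≠ v :=
    (eventually_gt_atTop (-v)).mono fun R hR => by linarith [hR] |> ne_of_lt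
  rw [← hval]
  refine intervalIntegral.tendsto_integral_filter_of_dominated_convergence
    (fun _ => (1 + ‖stieltjesAux β v‖) / (Real.exp v / 2)) ?_ ?_ intervalIntegrable_const ?_
  · refine Eventually.of_forall fun R => ContinuousOn.aestronglyMeasurable (fun y hy => ?_)
      measurableSet_uIoc
    rw [uIoc_of_le (by linarith [pi_pos])] at hy
    refine ContinuousAt.continuousWithinAt ?_
    refine (continuousAt_stieltjesContour h0 h1 v ?_).comp (f := fun y : ℝ => _) (by fun_prop)
    simpa using abs_le.2 ⟨hy.1.le, hy.2⟩
  · filter_upwards [e1, e2, e3] with R h1 h2 h3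
    refine ae_of_all _ fun y _ => ?_
    rw [stieltjesContour_of_ne (ofReal_add_mul_I_ne h3 y), norm_div]
    have hexp : Real.exp v - Real.exp (-R)
        ≤ ‖Complex.exp ((-R : ℝ) + y * Complex.I) - Complex.exp v‖ := by
      have := norm_sub_norm_le (Complex.exp v) (Complex.exp ((-R : ℝ) + y * Complex.I))
      rw [norm_sub_rev]
      simpa [Complex.norm_exp] using this
    refine div_le_div₀ (by positivity) ((norm_sub_le _ _).trans ?_) (by positivity)
      (le_trans (by linarith) hexp)
    gcongr
    exact (norm_stieltjesAux_le' h1).trans (by linarith)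
  · refine ae_of_all _ fun y _ => ?_
    have hA : Tendsto (fun R : ℝ => stieltjesAux β ((-R : ℝ) + y * Complex.I)) atTop (𝓝 0) := by
      refine squeeze_zero_norm' (e1.mono fun R hR => norm_stieltjesAux_le' hR) ?_
      simpa using t1.const_mul 2
    have hE : Tendsto (fun R : ℝ => Complex.exp ((-R : ℝ) + y * Complex.I)) atTop (𝓝 0) := by
      refine squeeze_zero_norm (fun R => le_of_eq ?_) t2
      simp [Complex.norm_exp]
    have hlim := (hA.sub_const (stieltjesAux β v)).div (hE.sub_const (Complex.exp v))
      (by simp [Complex.exp_ne_zero])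
    have hv : (0 - stieltjesAux β v) / (0 - Complex.exp v) = stieltjesAux β v / Real.exp v := by
      rw [zero_sub, zero_sub, neg_div_neg_eq, Complex.ofReal_exp]
    rw [hv] at hlim
    refine hlim.congr' (e3.mono fun R hR => ?_)
    exact (stieltjesContour_of_ne (ofReal_add_mul_I_ne hR y)).symm

theorem integrable_mlKernel_div {β : ℝ} (h0 : 0 < β) (h1 : β < 1) {p : ℝ} (hp : 0 < p) :
    Integrable fun x => mlKernel β x / (Real.exp x + p) := by
  refine ((integrable_mlKernel h0 h1).div_const p).mono'
    ((continuous_mlKernel h0 h1).div (by fun_prop) fun x => by positivity).aestronglyMeasurable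
    (ae_of_all _ fun x => ?_)
  have := (mlKernel_pos h0 h1 x).le
  rw [Real.norm_of_nonneg (by positivity)]
  gcongr
  linarith [exp_pos x]

/-- The Stieltjes transform of the density is `p ^ (β - 1) / (1 + p ^ β)`. -/
theorem integral_mlKernel_div {β : ℝ} (h0 : 0 < β) (h1 : β < 1) {p : ℝ} (hp : 0 < p) :
    ∫ x, mlKernel β x / (Real.exp x + p) = p ^ (β - 1) / (1 + p ^ β) := by
  obtain ⟨v, rfl⟩ : ∃ v, Real.exp v = p := ⟨Real.log p, Real.exp_log hp⟩
  have t0 : Tendsto (fun R : ℝ => ((∫ x in (-R)..R, mlKernel β x / (Real.exp x + Real.exp v) : ℝ) : ℂ))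
      atTop (𝓝 ((∫ x, mlKernel β x / (Real.exp x + Real.exp v) : ℝ) : ℂ)) :=
    (Complex.continuous_ofReal.tendsto _).comp (intervalIntegral_tendsto_integral
      (integrable_mlKernel_div h0 h1 hp) tendsto_neg_atTop_atBot tendsto_id)
  -- Let R tend to infinity in the rectangle identity, whose left side is identically 0.
  have hlim := ((t0.const_mul (2 * π * Complex.I)).add
    ((tendsto_right_edge h0 v).const_mul Complex.I)).sub
    ((tendsto_left_edge h0 h1 v).const_mul Complex.I)
  simp_rw [stieltjes_rectangle h0 h1 v] at hlim
  have heq := tendsto_nhds_unique hlim tendsto_const_nhds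
  have hne : (2 * π * Complex.I : ℂ) ≠ 0 := Complex.two_pi_I_ne_zero
  have hfin : ((∫ x, mlKernel β x / (Real.exp x + Real.exp v) : ℝ) : ℂ)
      = stieltjesAux β v / Real.exp v := by
    apply mul_left_cancel₀ hne
    linear_combination heq
  have hst : stieltjesAux β v / Real.exp v
      = ((Real.exp (β * v) / (Real.exp (β * v) + 1) / Real.exp v : ℝ) : ℂ) := by
    simp [stieltjesAux]
  rw [hst] at hfin
  rw [Complex.ofReal_injective hfin, ← Real.exp_mul, ← Real.exp_mul, mul_comm v β,
    show v * (β - 1) = β * v - v by ring, Real.exp_sub, add_comm]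
  field_simp

/-! ### The Mittag-Leffler function `t ↦ E_β(-t ^ β)` -/

/-- `t ↦ E_β(-t ^ β)` as a Laplace transform. -/
def mlFun (β t : ℝ) : ℝ := ∫ x, Real.exp (-(Real.exp x * t)) * mlKernel β x

/-- Minus the derivative of `mlFun β`. -/
def mlRate (β t : ℝ) : ℝ := ∫ x, Real.exp x * Real.exp (-(Real.exp x * t)) * mlKernel β x

theorem mul_exp_neg_le_one (y : ℝ) : y * Real.exp (-y) ≤ 1 := by
  have h := Real.add_one_le_exp y
  have h2 := Real.exp_pos (-y)
  have h3 : Real.exp y * Real.exp (-y) = 1 := by rw [← Real.exp_add]; simp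
  nlinarith

theorem exp_mul_exp_neg_le {t : ℝ} (ht : 0 < t) (x : ℝ) :
    Real.exp x * Real.exp (-(Real.exp x * t)) ≤ t⁻¹ := by
  have := mul_exp_neg_le_one (Real.exp x * t)
  rw [le_inv_comm₀ (by positivity) ht, ← one_div, le_div_iff₀ (by positivity)]
  linarith

/-- The total mass is the limit, as p grows, of p times the Stieltjes transform, which is 1 - 1/(1 +
p^β). -/
theorem integral_mlKernel {β : ℝ} (h0 : 0 < β) (h1 : β < 1) : ∫ x, mlKernel β x = 1 := by
  have t1 : Tendsto (fun p : ℝ => ∫ x, p * (mlKernel β x / (Real.exp x + p))) atTop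
      (𝓝 (∫ x, mlKernel β x)) := by
    refine tendsto_integral_filter_of_dominated_convergence (mlKernel β) ?_ ?_
      (integrable_mlKernel h0 h1) (ae_of_all _ fun x => ?_)
    · filter_upwards [eventually_gt_atTop 0] with p hp
      exact ((integrable_mlKernel_div h0 h1 hp).const_mul p).aestronglyMeasurable
    · filter_upwards [eventually_gt_atTop 0] with p hp
      refine ae_of_all _ fun x => ?_
      have := (mlKernel_pos h0 h1 x).le
      have hx := exp_pos x
      rw [Real.norm_of_nonneg (by positivity), ← mul_div_assoc, div_le_iff₀ (by positivity)]
      nlinarith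
    · have : Tendsto (fun p : ℝ => mlKernel β x - Real.exp x * mlKernel β x / (Real.exp x + p)) atTop
          (𝓝 (mlKernel β x - 0)) :=
        tendsto_const_nhds.sub (tendsto_const_nhds.div_atTop
          (tendsto_atTop_add_const_left _ _ tendsto_id))
      rw [sub_zero] at this
      refine this.congr' ?_
      filter_upwards [eventually_gt_atTop 0] with p hp
      have hx := exp_pos x
      field_simp
      ring
  have t2 : Tendsto (fun p : ℝ => 1 - 1 / (1 + p ^ β)) atTop (𝓝 (1 - 0)) :=
    tendsto_const_nhds.sub (tendsto_const_nhds.div_atTop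
      (tendsto_atTop_add_const_left _ _ (tendsto_rpow_atTop h0)))
  rw [sub_zero] at t2
  refine tendsto_nhds_unique t1 (t2.congr' ?_)
  filter_upwards [eventually_gt_atTop 0] with p hp
  rw [integral_const_mul, integral_mlKernel_div h0 h1 hp, Real.rpow_sub_one hp.ne']
  have := Real.rpow_pos_of_pos hp β
  field_simp
  ring

theorem continuous_exp_kernel {β : ℝ} (h0 : 0 < β) (h1 : β < 1) (t : ℝ) :
    Continuous fun x => Real.exp (-(Real.exp x * t)) * mlKernel β x := by
  have := continuous_mlKernel h0 h1
  fun_prop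

theorem continuous_rate_kernel {β : ℝ} (h0 : 0 < β) (h1 : β < 1) (t : ℝ) :
    Continuous fun x => Real.exp x * Real.exp (-(Real.exp x * t)) * mlKernel β x := by
  have := continuous_mlKernel h0 h1
  fun_prop

theorem norm_exp_kernel_le {β : ℝ} (h0 : 0 < β) (h1 : β < 1) {t : ℝ} (ht : 0 ≤ t) (x : ℝ) :
    ‖Real.exp (-(Real.exp x * t)) * mlKernel β x‖ ≤ mlKernel β x := by
  have hk := (mlKernel_pos h0 h1 x).le
  rw [Real.norm_of_nonneg (by positivity)]
  refine mul_le_of_le_one_left hk (Real.exp_le_one_iff.2 ?_)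
  have := exp_pos x
  nlinarith [mul_nonneg this.le ht]

theorem norm_rate_kernel_le {β : ℝ} (h0 : 0 < β) (h1 : β < 1) {s t : ℝ} (hs : 0 < s) (hst : s ≤ t)
    (x : ℝ) :
    ‖Real.exp x * Real.exp (-(Real.exp x * t)) * mlKernel β x‖ ≤ s⁻¹ * mlKernel β x := by
  have hk := (mlKernel_pos h0 h1 x).le
  rw [Real.norm_of_nonneg (by positivity)]
  gcongr
  exact (exp_mul_exp_neg_le (hs.trans_le hst) x).trans (inv_anti₀ hs hst)

theorem integrable_exp_kernel {β : ℝ} (h0 : 0 < β) (h1 : β < 1) {t : ℝ} (ht : 0 ≤ t) :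
    Integrable fun x => Real.exp (-(Real.exp x * t)) * mlKernel β x :=
  (integrable_mlKernel h0 h1).mono' (continuous_exp_kernel h0 h1 t).aestronglyMeasurable
    (ae_of_all _ (norm_exp_kernel_le h0 h1 ht))

theorem integrable_rate_kernel {β : ℝ} (h0 : 0 < β) (h1 : β < 1) {t : ℝ} (ht : 0 < t) :
    Integrable fun x => Real.exp x * Real.exp (-(Real.exp x * t)) * mlKernel β x :=
  ((integrable_mlKernel h0 h1).const_mul t⁻¹).mono'
    (continuous_rate_kernel h0 h1 t).aestronglyMeasurable
    (ae_of_all _ (norm_rate_kernel_le h0 h1 ht le_rfl))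

theorem mlFun_nonneg {β : ℝ} (h0 : 0 < β) (h1 : β < 1) (t : ℝ) : 0 ≤ mlFun β t :=
  integral_nonneg fun x => mul_nonneg (exp_pos _).le (mlKernel_pos h0 h1 x).le

theorem mlRate_nonneg {β : ℝ} (h0 : 0 < β) (h1 : β < 1) (t : ℝ) : 0 ≤ mlRate β t :=
  integral_nonneg fun x => mul_nonneg (by positivity) (mlKernel_pos h0 h1 x).le

theorem mlFun_le_one {β : ℝ} (h0 : 0 < β) (h1 : β < 1) {t : ℝ} (ht : 0 ≤ t) : mlFun β t ≤ 1 := by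
  rw [← integral_mlKernel h0 h1]
  exact integral_mono (integrable_exp_kernel h0 h1 ht) (integrable_mlKernel h0 h1)
    fun x => (le_abs_self _).trans (norm_exp_kernel_le h0 h1 ht x)

theorem mlFun_zero {β : ℝ} (h0 : 0 < β) (h1 : β < 1) : mlFun β 0 = 1 := by
  simp [mlFun, integral_mlKernel h0 h1]

theorem mlRate_le_inv {β : ℝ} (h0 : 0 < β) (h1 : β < 1) {t : ℝ} (ht : 0 < t) :
    mlRate β t ≤ t⁻¹ := by
  have := integral_mono (integrable_rate_kernel h0 h1 ht)
    ((integrable_mlKernel h0 h1).const_mul t⁻¹)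
    fun x => (le_abs_self _).trans (norm_rate_kernel_le h0 h1 ht le_rfl x)
  rwa [integral_const_mul, integral_mlKernel h0 h1, mul_one] at this

theorem continuousOn_mlFun {β : ℝ} (h0 : 0 < β) (h1 : β < 1) :
    ContinuousOn (mlFun β) (Ici 0) := by
  refine continuousOn_of_dominated (bound := mlKernel β)
    (fun t _ => (continuous_exp_kernel h0 h1 t).aestronglyMeasurable)
    (fun t ht => ae_of_all _ (norm_exp_kernel_le h0 h1 ht)) (integrable_mlKernel h0 h1)
    (ae_of_all _ fun x => ?_)
  fun_prop

theorem hasDerivAt_mlFun {β : ℝ} (h0 : 0 < β) (h1 : β < 1) {t : ℝ} (ht : 0 < t) :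
    HasDerivAt (mlFun β) (-mlRate β t) t := by
  -- The rate kernel is dominated uniformly only away from time 0, hence the neighbourhood (t/2, ∞).
  have key := hasDerivAt_integral_of_dominated_loc_of_deriv_le (μ := volume)
    (F := fun t x => Real.exp (-(Real.exp x * t)) * mlKernel β x)
    (F' := fun t x => -(Real.exp x * Real.exp (-(Real.exp x * t)) * mlKernel β x))
    (bound := fun x => (t / 2)⁻¹ * mlKernel β x) (x₀ := t) (s := Ioi (t / 2))
    (Ioi_mem_nhds (by linarith))
    (Eventually.of_forall fun s => (continuous_exp_kernel h0 h1 s).aestronglyMeasurable)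
    (integrable_exp_kernel h0 h1 ht.le)
    (continuous_rate_kernel h0 h1 t).neg.aestronglyMeasurable
    (ae_of_all _ fun x s hs => by
      rw [norm_neg]
      exact norm_rate_kernel_le h0 h1 (by linarith) (le_of_lt hs) x)
    ((integrable_mlKernel h0 h1).const_mul _)
    (ae_of_all _ fun x s _ => by
      have h := (((hasDerivAt_id s).const_mul (Real.exp x)).neg.exp).mul_const (mlKernel β x)
      refine h.congr_deriv ?_
      simp only [id, Pi.neg_apply]
      ring)
  have h2 := key.2
  rw [integral_neg] at h2
  exact h2

theorem continuousOn_mlRate {β : ℝ} (h0 : 0 < β) (h1 : β < 1) :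
    ContinuousOn (mlRate β) (Ioi 0) := by
  intro t ht
  have ht' : 0 < t := ht
  refine ContinuousAt.continuousWithinAt ?_
  refine continuousAt_of_dominated (bound := fun x => (t / 2)⁻¹ * mlKernel β x)
    (Eventually.of_forall fun s => (continuous_rate_kernel h0 h1 s).aestronglyMeasurable)
    ?_ ((integrable_mlKernel h0 h1).const_mul _) (ae_of_all _ fun x => ?_)
  · filter_upwards [Ioi_mem_nhds (show t / 2 < t by linarith)] with s hs
    exact ae_of_all _ (norm_rate_kernel_le h0 h1 (by linarith) (le_of_lt hs))
  · fun_prop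

theorem sq_mul_exp_neg_le {y : ℝ} (hy : 0 ≤ y) : y ^ 2 * Real.exp (-y) ≤ 2 := by
  have h := Real.quadratic_le_exp_of_nonneg hy
  have h2 := Real.exp_pos (-y)
  have h3 : Real.exp y * Real.exp (-y) = 1 := by rw [← Real.exp_add]; simp
  nlinarith

/-- For x ≤ 0 the factor e^{sx} already decays. For x ≥ 0 the bound e^{2x} exp(-e^x) ≤ 2 leaves
e^{-sx} to spare, because s ≤ 1. -/
theorem exp_mul_exp_neg_exp_le {s : ℝ} (h1 : s ≤ 1) (x : ℝ) :
    Real.exp (s * x) * Real.exp (-Real.exp x) ≤ 2 * Real.exp (-(s * |x|)) := by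
  rcases le_total x 0 with hx | hx
  · rw [abs_of_nonpos hx, show -(s * -x) = s * x by ring]
    have h2 : Real.exp (-Real.exp x) ≤ 1 := Real.exp_le_one_iff.2 (neg_nonpos.2 (exp_pos x).le)
    have := Real.exp_pos (s * x)
    nlinarith
  · rw [abs_of_nonneg hx]
    have h2 := sq_mul_exp_neg_le (exp_pos x).le
    rw [← Real.exp_nat_mul] at h2
    have h3 : Real.exp (s * x) ≤ Real.exp ((2 : ℕ) * x) * Real.exp (-(s * x)) := by
      rw [← Real.exp_add]
      refine Real.exp_le_exp.2 ?_
      push_cast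
      nlinarith
    calc _ ≤ Real.exp ((2 : ℕ) * x) * Real.exp (-(s * x)) * Real.exp (-Real.exp x) := by gcongr
      _ = Real.exp ((2 : ℕ) * x) * Real.exp (-Real.exp x) * Real.exp (-(s * x)) := by ring
      _ ≤ _ := by gcongr

theorem integrable_exp_mul_exp_neg_exp {s : ℝ} (h0 : 0 < s) (h1 : s ≤ 1) :
    Integrable fun x => Real.exp (s * x) * Real.exp (-Real.exp x) :=
  ((integrable_exp_neg_mul_abs h0).const_mul 2).mono' (by fun_prop) (ae_of_all _ fun x => by
    rw [Real.norm_of_nonneg (by positivity)]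
    exact exp_mul_exp_neg_exp_le h1 x)

/-- A moment bound, obtained by translating the variable. -/
theorem integral_exp_mul_exp_neg_exp_mul {s t : ℝ} (h0 : 0 < s) (h1 : s ≤ 1) (ht : 0 < t) :
    Integrable (fun x => Real.exp (s * x) * Real.exp (-(Real.exp x * t))) ∧
    ∫ x, Real.exp (s * x) * Real.exp (-(Real.exp x * t))
      = t ^ (-s) * ∫ x, Real.exp (s * x) * Real.exp (-Real.exp x) := by
  have h : (fun x => Real.exp (s * x) * Real.exp (-(Real.exp x * t))) = fun x => t ^ (-s) *
      (fun y => Real.exp (s * y) * Real.exp (-Real.exp y)) (x + Real.log t) := by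
    funext x
    simp only
    rw [Real.exp_add, Real.exp_log ht, Real.rpow_def_of_pos ht, ← mul_assoc (Real.exp (Real.log t * -s)),
      ← Real.exp_add (Real.log t * -s)]
    congr 2
    ring
  rw [h, integral_const_mul, integral_add_right_eq_self
    (fun y => Real.exp (s * y) * Real.exp (-Real.exp y))]
  exact ⟨((integrable_exp_mul_exp_neg_exp h0 h1).comp_add_right _).const_mul _, rfl⟩

/-- A pure exponential turns the mixtures into exact powers of t: b = β gives the decay of `mlFun`,
b = -β the singularity of `mlRate`. -/
theorem mlKernel_le_exp_mul {β b : ℝ} (h0 : 0 < β) (h1 : β < 1) (hb : |b| ≤ β) (x : ℝ) :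
    mlKernel β x ≤ 2 / (1 + Real.cos (π * β)) * Real.exp (b * x) := by
  have hcb := neg_one_lt_cos_pi_mul h0 h1
  refine (mlKernel_le h0 le_rfl h1 x).trans ?_
  have : 0 ≤ 2 / (1 + Real.cos (π * β)) := by
    have : 0 < 1 + Real.cos (π * β) := by linarith
    positivity
  gcongr
  have h2 : |b * x| ≤ β * |x| := by
    rw [abs_mul]
    gcongr
  linarith [neg_abs_le (b * x)]

theorem exists_mlFun_le {β : ℝ} (h0 : 0 < β) (h1 : β < 1) :
    ∃ C, 0 ≤ C ∧ ∀ t, 0 < t → mlFun β t ≤ C * t ^ (-β) := by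
  set A := 2 / (1 + Real.cos (π * β)) with hA
  have hA0 : 0 ≤ A := by
    have := neg_one_lt_cos_pi_mul h0 h1
    have : 0 < 1 + Real.cos (π * β) := by linarith
    positivity
  refine ⟨A * ∫ x, Real.exp (β * x) * Real.exp (-Real.exp x),
    mul_nonneg hA0 (integral_nonneg fun x => by positivity), fun t ht => ?_⟩
  obtain ⟨hi, he⟩ := integral_exp_mul_exp_neg_exp_mul h0 h1.le ht
  have := integral_mono (integrable_exp_kernel h0 h1 ht.le) (hi.const_mul A) fun x => by
    have := mlKernel_le_exp_mul h0 h1 (abs_of_pos h0).le x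
    calc Real.exp (-(Real.exp x * t)) * mlKernel β x
        ≤ Real.exp (-(Real.exp x * t)) * (A * Real.exp (β * x)) := by gcongr
      _ = A * (Real.exp (β * x) * Real.exp (-(Real.exp x * t))) := by ring
  rw [integral_const_mul, he] at this
  refine this.trans (le_of_eq ?_)
  ring

/-- Replacing the density by a multiple of e^{-βx} leaves a moment of order 1 - β. The resulting
singularity at 0 is integrable, unlike that of the bound t⁻¹, and this makes the Caputo integral
converge. -/
theorem exists_mlRate_le {β : ℝ} (h0 : 0 < β) (h1 : β < 1) :
    ∃ C, 0 ≤ C ∧ ∀ t, 0 < t → mlRate β t ≤ C * t ^ (β - 1) := by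
  set A := 2 / (1 + Real.cos (π * β)) with hA
  have hA0 : 0 ≤ A := by
    have := neg_one_lt_cos_pi_mul h0 h1
    have : 0 < 1 + Real.cos (π * β) := by linarith
    positivity
  refine ⟨A * ∫ x, Real.exp ((1 - β) * x) * Real.exp (-Real.exp x),
    mul_nonneg hA0 (integral_nonneg fun x => by positivity), fun t ht => ?_⟩
  obtain ⟨hi, he⟩ := integral_exp_mul_exp_neg_exp_mul (s := 1 - β) (by linarith) (by linarith) ht
  have := integral_mono (integrable_rate_kernel h0 h1 ht) (hi.const_mul A) fun x => by
    have := mlKernel_le_exp_mul h0 h1 (b := -β) (by rw [abs_neg, abs_of_pos h0]) x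
    calc Real.exp x * Real.exp (-(Real.exp x * t)) * mlKernel β x
        ≤ Real.exp x * Real.exp (-(Real.exp x * t)) * (A * Real.exp (-β * x)) := by gcongr
      _ = A * (Real.exp x * Real.exp (-β * x) * Real.exp (-(Real.exp x * t))) := by ring
      _ = A * (Real.exp ((1 - β) * x) * Real.exp (-(Real.exp x * t))) := by
        rw [← Real.exp_add]
        congr 4
        ring
  rw [integral_const_mul, he, neg_sub] at this
  refine this.trans (le_of_eq ?_)
  ring

/-! ### Laplace transforms -/

/-- The Laplace transform of a nonnegative function on `(0, ∞)`. -/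
def laplace (g : ℝ → ENNReal) (p : ℝ) : ENNReal :=
  ∫⁻ t in Ioi 0, ENNReal.ofReal (Real.exp (-(p * t))) * g t

theorem laplace_antitone (g : ℝ → ENNReal) : Antitone (laplace g) := by
  intro p q hpq
  refine setLIntegral_mono' measurableSet_Ioi fun t ht => ?_
  gcongr
  exact le_of_lt ht

/-- The weight e^{-t} shifts the argument by one, so that finiteness of the Laplace transform on (0,
∞) becomes finiteness of the moment generating function on z < 1, a neighbourhood of 0. -/
theorem mgf_withDensity {g : ℝ → ENNReal} (hg : Measurable g) (z : ℝ) :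
    ∫⁻ t, ENNReal.ofReal (Real.exp (z * t)) ∂((volume.restrict (Ioi 0)).withDensity
      fun t => ENNReal.ofReal (Real.exp (-t)) * g t) = laplace g (1 - z) := by
  rw [lintegral_withDensity_eq_lintegral_mul _ (by fun_prop) (by fun_prop), laplace]
  refine lintegral_congr fun t => ?_
  rw [Pi.mul_apply, mul_right_comm, ← ENNReal.ofReal_mul (exp_pos _).le, ← Real.exp_add]
  congr 3
  ring

/-- A nonnegative function on `(0, ∞)` is determined by its Laplace transform if this is finite
exactly on `(0, ∞)`. -/
theorem ae_eq_of_laplace_eq {g₁ g₂ : ℝ → ENNReal} (h₁ : Measurable g₁) (h₂ : Measurable g₂)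
    (hfin : ∀ p, 0 < p → laplace g₁ p ≠ ⊤) (heq : ∀ p, 0 < p → laplace g₁ p = laplace g₂ p)
    (h0 : laplace g₁ 0 = ⊤) (h0' : laplace g₂ 0 = ⊤) : g₁ =ᵐ[volume.restrict (Ioi 0)] g₂ := by
  -- The moment generating functions must agree on the whole line. For p ≤ 0 both transforms are
  -- infinite, by monotonicity from p = 0.
  have heq' : ∀ p, laplace g₁ p = laplace g₂ p := by
    intro p
    rcases lt_or_ge 0 p with hp | hp
    · exact heq p hp
    · rw [top_unique (h0.ge.trans (laplace_antitone g₁ hp)),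
        top_unique (h0'.ge.trans (laplace_antitone g₂ hp))]
  set μ₁ := (volume.restrict (Ioi (0 : ℝ))).withDensity fun t => ENNReal.ofReal (Real.exp (-t)) * g₁ t
    with hμ₁
  set μ₂ := (volume.restrict (Ioi (0 : ℝ))).withDensity fun t => ENNReal.ofReal (Real.exp (-t)) * g₂ t
    with hμ₂
  have m₁ := mgf_withDensity h₁
  have m₂ := mgf_withDensity h₂
  rw [← hμ₁] at m₁
  rw [← hμ₂] at m₂
  have hu₁ : μ₁ univ = laplace g₁ 1 := by simpa using m₁ 0
  have hu₂ : μ₂ univ = laplace g₂ 1 := by simpa using m₂ 0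
  have : IsFiniteMeasure μ₁ := ⟨by rw [hu₁]; exact (hfin 1 one_pos).lt_top⟩
  have : IsFiniteMeasure μ₂ := ⟨by rw [hu₂, ← heq']; exact (hfin 1 one_pos).lt_top⟩
  have hmgf : ProbabilityTheory.mgf id μ₁ = ProbabilityTheory.mgf id μ₂ := by
    funext z
    unfold ProbabilityTheory.mgf
    rw [integral_eq_lintegral_of_nonneg_ae (ae_of_all _ fun x => (exp_pos _).le)
        (by fun_prop), integral_eq_lintegral_of_nonneg_ae (ae_of_all _ fun x => (exp_pos _).le)
        (by fun_prop)]
    simp only [id]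
    rw [m₁, m₂, heq']
  have h00 : μ₁ = 0 ↔ μ₂ = 0 := by
    rw [← Measure.measure_univ_eq_zero, ← Measure.measure_univ_eq_zero, hu₁, hu₂, heq']
  have hmem : (0 : ℝ) ∈ interior (ProbabilityTheory.integrableExpSet id μ₁) := by
    refine mem_interior.2 ⟨Iio 1, fun z hz => ?_, isOpen_Iio, by simp⟩
    refine ⟨by fun_prop, ?_⟩
    rw [hasFiniteIntegral_iff_ofReal (ae_of_all _ fun x => (exp_pos _).le)]
    simp only [id]
    rw [m₁]
    exact (hfin _ (by simpa using hz)).lt_top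
  -- Finiteness near 0 lets equality of the real moment generating functions continue to the
  -- imaginary axis, where it is equality of characteristic functions.
  have hμ : μ₁ = μ₂ := by
    refine Measure.ext_of_charFun (funext fun t => ?_)
    rw [← ProbabilityTheory.complexMGF_id_mul_I, ← ProbabilityTheory.complexMGF_id_mul_I]
    exact ProbabilityTheory.eqOn_complexMGF_of_mgf' hmgf h00 (by simpa using hmem)
  have hae := (withDensity_eq_iff (by fun_prop) (by fun_prop) (by
    have := hu₁ ▸ hfin 1 one_pos
    rwa [hμ₁, withDensity_apply _ MeasurableSet.univ, setLIntegral_univ] at this)).1 hμ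
  filter_upwards [hae] with t ht
  exact (ENNReal.mul_right_inj (by simp [exp_pos]) ENNReal.ofReal_ne_top).1 ht

theorem lintegral_exp_neg_mul {a : ℝ} (ha : 0 < a) :
    ∫⁻ t in Ioi 0, ENNReal.ofReal (Real.exp (-(a * t))) = ENNReal.ofReal a⁻¹ := by
  have hi := exp_neg_integrableOn_Ioi 0 ha
  simp only [neg_mul] at hi
  rw [← ofReal_integral_eq_lintegral_ofReal hi (ae_of_all _ fun t => (exp_pos _).le)]
  have := integral_exp_mul_Ioi (neg_lt_zero.2 ha) 0
  simp only [neg_mul] at this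
  rw [this]
  simp

/-- By Tonelli, since exp(-e^x t) has Laplace transform 1/(e^x + p). This links the Laplace
transform of a mixture to the Stieltjes transform of its density. -/
theorem laplace_mixture {φ : ℝ → ℝ} (hφ : Measurable φ) (hφ0 : ∀ x, 0 ≤ φ x) {p : ℝ} (hp : 0 < p) :
    laplace (fun t => ∫⁻ x, ENNReal.ofReal (Real.exp (-(Real.exp x * t)) * φ x)) p
      = ∫⁻ x, ENNReal.ofReal (φ x / (Real.exp x + p)) := by
  unfold laplace
  have : ∀ t : ℝ, ENNReal.ofReal (Real.exp (-(p * t))) *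
      ∫⁻ x, ENNReal.ofReal (Real.exp (-(Real.exp x * t)) * φ x)
      = ∫⁻ x, ENNReal.ofReal (φ x) * ENNReal.ofReal (Real.exp (-((Real.exp x + p) * t))) := by
    intro t
    rw [← lintegral_const_mul _ (by fun_prop)]
    refine lintegral_congr fun x => ?_
    rw [← ENNReal.ofReal_mul (exp_pos _).le, ← ENNReal.ofReal_mul (hφ0 x), add_mul, neg_add,
      Real.exp_add]
    congr 1
    ring
  simp_rw [this]
  rw [lintegral_lintegral_swap (by fun_prop)]
  refine lintegral_congr fun x => ?_
  have hpos : 0 < Real.exp x + p := by have := exp_pos x; linarith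
  rw [lintegral_const_mul _ (by fun_prop), lintegral_exp_neg_mul hpos,
    ← ENNReal.ofReal_mul (hφ0 x), div_eq_mul_inv]

theorem laplace_convolution {f g : ℝ → ENNReal} (hf : Measurable f) (hg : Measurable g) (p : ℝ) :
    laplace (fun t => ∫⁻ s in Ioo 0 t, f (t - s) * g s) p = laplace f p * laplace g p := by
  -- The factor e^{-pt} splits as e^{-ps} e^{-p(t-s)}, and the indicator encodes s < t, so that
  -- Tonelli and translation invariance apply.
  have h1 : ∀ t : ℝ, t ∈ Ioi (0 : ℝ) → ENNReal.ofReal (Real.exp (-(p * t))) *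
      ∫⁻ s in Ioo 0 t, f (t - s) * g s = ∫⁻ s in Ioi 0, (ENNReal.ofReal (Real.exp (-(p * s))) * g s) *
        (Ioi (0 : ℝ)).indicator (fun r => ENNReal.ofReal (Real.exp (-(p * r))) * f r) (t - s) := by
    intro t ht
    rw [← lintegral_const_mul _ (by fun_prop), ← lintegral_indicator measurableSet_Ioo,
      ← lintegral_indicator measurableSet_Ioi]
    refine lintegral_congr fun s => ?_
    by_cases hs : 0 < s <;> by_cases hst : s < t
    · rw [indicator_of_mem (by exact ⟨hs, hst⟩), indicator_of_mem (by exact hs),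
        indicator_of_mem (by simpa using hst), show -(p * t) = -(p * s) + -(p * (t - s)) by ring,
        Real.exp_add, ENNReal.ofReal_mul (exp_pos _).le]
      ring
    · rw [indicator_of_notMem (fun h => hst h.2), indicator_of_mem (by exact hs),
        indicator_of_notMem (by simpa using hst), mul_zero]
    · rw [indicator_of_notMem (fun h => hs h.1), indicator_of_notMem (by exact hs)]
    · rw [indicator_of_notMem (fun h => hs h.1), indicator_of_notMem (by exact hs)]
  have hm : Measurable ((Ioi (0 : ℝ)).indicator fun r => ENNReal.ofReal (Real.exp (-(p * r))) * f r) :=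
    Measurable.indicator (by fun_prop) measurableSet_Ioi
  unfold laplace
  rw [setLIntegral_congr_fun measurableSet_Ioi h1, lintegral_lintegral_swap (by fun_prop),
    mul_comm, ← lintegral_mul_const _ (by fun_prop)]
  refine setLIntegral_congr_fun measurableSet_Ioi fun s hs => ?_
  have hs' : 0 < s := hs
  rw [lintegral_const_mul _ (by fun_prop)]
  congr 1
  rw [← lintegral_indicator measurableSet_Ioi, ← lintegral_indicator measurableSet_Ioi (μ := volume)
    (fun t => ENNReal.ofReal (Real.exp (-(p * t))) * f t), ← lintegral_sub_right_eq_self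
    ((Ioi (0 : ℝ)).indicator fun t => ENNReal.ofReal (Real.exp (-(p * t))) * f t) s]
  refine lintegral_congr fun t => ?_
  by_cases ht : s < t
  · rw [indicator_of_mem (by exact hs'.trans ht)]
  · have : t - s ∉ Ioi (0 : ℝ) := by simpa using ht
    by_cases h0 : t ∈ Ioi (0 : ℝ)
    · rw [indicator_of_mem h0]
    · rw [indicator_of_notMem h0, indicator_of_notMem this]

/-! ### The fractional relaxation equation for the Mittag-Leffler function -/

/-- Cut at t/2: on each half only one factor is singular and the other is continuous. -/
theorem intervalIntegrable_beta {β t : ℝ} (h0 : 0 < β) (h1 : β < 1) (ht : 0 < t) :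
    IntervalIntegrable (fun s => (t - s) ^ (-β) * s ^ (β - 1)) volume 0 t := by
  have hl : IntervalIntegrable (fun s => (t - s) ^ (-β) * s ^ (β - 1)) volume 0 (t / 2) := by
    refine (intervalIntegral.intervalIntegrable_rpow' (by linarith)).continuousOn_mul
      fun s hs => ContinuousAt.continuousWithinAt ?_
    rw [uIcc_of_le (by linarith)] at hs
    exact (continuousAt_const.sub continuousAt_id).rpow_const (Or.inl (by simp; linarith [hs.2]))
  have hr : IntervalIntegrable (fun s => (t - s) ^ (-β) * s ^ (β - 1)) volume (t / 2) t := by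
    have h : IntervalIntegrable (fun s => (t - s) ^ (-β)) volume (t - t / 2) (t - 0) :=
      (intervalIntegral.intervalIntegrable_rpow' (a := t / 2) (b := 0)
        (by linarith : -1 < -β)).comp_sub_left t
    rw [sub_zero, sub_half] at h
    refine h.mul_continuousOn fun s hs => ContinuousAt.continuousWithinAt ?_
    rw [uIcc_of_le (by linarith)] at hs
    exact continuousAt_id.rpow_const (Or.inl (by simp; linarith [hs.1]))
  exact hl.trans hr

theorem intervalIntegrable_caputo_mlRate {β t : ℝ} (h0 : 0 < β) (h1 : β < 1) (ht : 0 < t) :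
    IntervalIntegrable (fun s => (t - s) ^ (-β) * mlRate β s) volume 0 t := by
  obtain ⟨C, hC, hle⟩ := exists_mlRate_le h0 h1
  have hb := (intervalIntegrable_beta h0 h1 ht).const_mul C
  rw [intervalIntegrable_iff_integrableOn_Ioo_of_le ht.le] at hb ⊢
  refine hb.mono' ?_ ?_
  · refine ContinuousOn.aestronglyMeasurable (fun s hs => ?_) measurableSet_Ioo
    refine ContinuousWithinAt.mul (ContinuousAt.continuousWithinAt ?_)
      ((continuousOn_mlRate h0 h1 s hs.1).mono fun _ h => h.1)
    exact (continuousAt_const.sub continuousAt_id).rpow_const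
      (Or.inl (by simp; linarith [hs.2]))
  · filter_upwards [ae_restrict_mem measurableSet_Ioo] with s hs
    have hp : 0 ≤ (t - s) ^ (-β) := Real.rpow_nonneg (by linarith [hs.2]) _
    rw [Real.norm_of_nonneg (mul_nonneg hp (mlRate_nonneg h0 h1 s))]
    calc (t - s) ^ (-β) * mlRate β s ≤ (t - s) ^ (-β) * (C * s ^ (β - 1)) := by
          gcongr
          exact hle s hs.1
      _ = _ := by ring

/-- Substituting s = tσ fixes the interval of integration, and near t a multiple of the Beta
integrand dominates. Continuity is needed to turn an almost everywhere identity into one at every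
time. -/
theorem continuousOn_caputo_mlRate {β : ℝ} (h0 : 0 < β) (h1 : β < 1) :
    ContinuousOn (fun t => ∫ s in (0 : ℝ)..t, (t - s) ^ (-β) * mlRate β s) (Ioi 0) := by
  obtain ⟨C, hC, hle⟩ := exists_mlRate_le h0 h1
  have hsub : EqOn (fun t => ∫ s in (0 : ℝ)..t, (t - s) ^ (-β) * mlRate β s)
      (fun t => t * ∫ σ in (0 : ℝ)..1, (t - t * σ) ^ (-β) * mlRate β (t * σ)) (Ioi 0) := by
    intro t _
    have := intervalIntegral.smul_integral_comp_mul_left (a := 0) (b := 1)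
      (fun s => (t - s) ^ (-β) * mlRate β s) t
    simp only [mul_zero, mul_one, smul_eq_mul] at this
    exact this.symm
  refine ContinuousOn.congr (continuousOn_id.mul fun t ht => ContinuousAt.continuousWithinAt ?_) hsub
  have ht' : 0 < t := ht
  refine intervalIntegral.continuousAt_of_dominated_interval
    (bound := fun σ => (t / 2) ^ (-β) * (C * (t / 2) ^ (β - 1)) * ((1 - σ) ^ (-β) * σ ^ (β - 1)))
    ?_ ?_ ((intervalIntegrable_beta h0 h1 one_pos).const_mul _) ?_
  · filter_upwards [Ioi_mem_nhds ht'] with u hu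
    have hu' : 0 < u := hu
    have h := (intervalIntegrable_caputo_mlRate h0 h1 hu').comp_mul_left (c := u)
    simp only [zero_div, div_self hu'.ne'] at h
    exact h.def'.aestronglyMeasurable
  · filter_upwards [Ioi_mem_nhds (show t / 2 < t by linarith)] with u hu
    have hu' : t / 2 < u := hu
    have hne : ∀ᵐ σ : ℝ, σ ≠ 1 := Measure.ae_ne volume 1
    filter_upwards [hne] with σ hσ1 hσ
    rw [uIoc_of_le zero_le_one] at hσ
    have hσ' : 0 < 1 - σ := sub_pos.2 (lt_of_le_of_ne hσ.2 hσ1)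
    have hu0 : 0 < u := by linarith
    rw [Real.norm_of_nonneg (mul_nonneg (Real.rpow_nonneg (by nlinarith) _) (mlRate_nonneg h0 h1 _)),
      show u - u * σ = u * (1 - σ) by ring, Real.mul_rpow hu0.le hσ'.le]
    have e1 : u ^ (-β) ≤ (t / 2) ^ (-β) :=
      Real.rpow_le_rpow_of_nonpos (by linarith) hu'.le (by linarith)
    have e2 : u ^ (β - 1) ≤ (t / 2) ^ (β - 1) :=
      Real.rpow_le_rpow_of_nonpos (by linarith) hu'.le (by linarith)
    have e3 : mlRate β (u * σ) ≤ C * ((t / 2) ^ (β - 1) * σ ^ (β - 1)) := by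
      refine (hle _ (mul_pos hu0 hσ.1)).trans ?_
      rw [Real.mul_rpow hu0.le hσ.1.le]
      have := Real.rpow_nonneg hσ.1.le (β - 1)
      gcongr
    have p1 := Real.rpow_nonneg hσ'.le (-β)
    have p2 := Real.rpow_nonneg hu0.le (-β)
    calc u ^ (-β) * (1 - σ) ^ (-β) * mlRate β (u * σ)
        ≤ (t / 2) ^ (-β) * (1 - σ) ^ (-β) * (C * ((t / 2) ^ (β - 1) * σ ^ (β - 1))) := by
          have := mlRate_nonneg h0 h1 (u * σ)
          gcongr
      _ = _ := by ring
  · have hne : ∀ᵐ σ : ℝ, σ ≠ 1 := Measure.ae_ne volume 1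
    filter_upwards [hne] with σ hσ1 hσ
    rw [uIoc_of_le zero_le_one] at hσ
    have hσ' : 0 < 1 - σ := sub_pos.2 (lt_of_le_of_ne hσ.2 hσ1)
    refine ContinuousAt.mul (ContinuousAt.rpow_const (by fun_prop) (Or.inl ?_)) ?_
    · rw [show t - t * σ = t * (1 - σ) by ring]
      positivity
    · exact ((continuousOn_mlRate h0 h1).continuousAt (Ioi_mem_nhds (mul_pos ht' hσ.1))).comp
        (f := fun u => u * σ) (by fun_prop)

/-- The mixture of exponentials with the given density. -/
def expMixture (φ : ℝ → ℝ) (t : ℝ) : ENNReal :=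
  ∫⁻ x, ENNReal.ofReal (Real.exp (-(Real.exp x * t)) * φ x)

theorem measurable_expMixture {φ : ℝ → ℝ} (hφ : Measurable φ) : Measurable (expMixture φ) :=
  Measurable.lintegral_prod_right (by fun_prop)

theorem expMixture_mlKernel {β t : ℝ} (h0 : 0 < β) (h1 : β < 1) (ht : 0 < t) :
    expMixture (mlKernel β) t = ENNReal.ofReal (mlFun β t) :=
  (ofReal_integral_eq_lintegral_ofReal (integrable_exp_kernel h0 h1 ht.le)
    (ae_of_all _ fun x => mul_nonneg (exp_pos _).le (mlKernel_pos h0 h1 x).le)).symm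

theorem expMixture_rate {β t : ℝ} (h0 : 0 < β) (h1 : β < 1) (ht : 0 < t) :
    expMixture (fun x => Real.exp x * mlKernel β x) t = ENNReal.ofReal (mlRate β t) := by
  rw [mlRate, ofReal_integral_eq_lintegral_ofReal (integrable_rate_kernel h0 h1 ht)
    (ae_of_all _ fun x => mul_nonneg (by positivity) (mlKernel_pos h0 h1 x).le)]
  refine lintegral_congr fun x => ?_
  congr 1
  ring

theorem laplace_mlFun {β p : ℝ} (h0 : 0 < β) (h1 : β < 1) (hp : 0 < p) :
    laplace (expMixture (mlKernel β)) p = ENNReal.ofReal (p ^ (β - 1) / (1 + p ^ β)) := by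
  refine (laplace_mixture (continuous_mlKernel h0 h1).measurable
    (fun x => (mlKernel_pos h0 h1 x).le) hp).trans ?_
  rw [← integral_mlKernel_div h0 h1 hp, ofReal_integral_eq_lintegral_ofReal
    (integrable_mlKernel_div h0 h1 hp)]
  exact ae_of_all _ fun x => div_nonneg (mlKernel_pos h0 h1 x).le (by have := exp_pos x; positivity)

/-- Since e^x/(e^x + p) = 1 - p/(e^x + p), this follows from the total mass and the Stieltjes
transform. -/
theorem laplace_mlRate {β p : ℝ} (h0 : 0 < β) (h1 : β < 1) (hp : 0 < p) :
    laplace (expMixture fun x => Real.exp x * mlKernel β x) p = ENNReal.ofReal (1 / (1 + p ^ β)) := by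
  have hk := continuous_mlKernel h0 h1
  refine (laplace_mixture (by fun_prop)
    (fun x => mul_nonneg (exp_pos x).le (mlKernel_pos h0 h1 x).le) hp).trans ?_
  have he : (fun x => Real.exp x * mlKernel β x / (Real.exp x + p))
      = fun x => mlKernel β x - p * (mlKernel β x / (Real.exp x + p)) := by
    funext x
    have := exp_pos x
    field_simp
    ring
  have hi := (integrable_mlKernel_div h0 h1 hp).const_mul p
  have hv : ∫ x, Real.exp x * mlKernel β x / (Real.exp x + p) = 1 / (1 + p ^ β) := by
    rw [he, integral_sub (integrable_mlKernel h0 h1) hi, integral_const_mul,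
      integral_mlKernel h0 h1, integral_mlKernel_div h0 h1 hp, Real.rpow_sub_one hp.ne']
    have := Real.rpow_pos_of_pos hp β
    field_simp
    ring
  rw [← hv, ofReal_integral_eq_lintegral_ofReal]
  · rw [he]
    exact (integrable_mlKernel h0 h1).sub hi
  · exact ae_of_all _ fun x => div_nonneg (mul_nonneg (exp_pos x).le (mlKernel_pos h0 h1 x).le)
      (by have := exp_pos x; positivity)

theorem laplace_rpow {β p : ℝ} (h1 : β < 1) (hp : 0 < p) :
    laplace (fun t => ENNReal.ofReal (t ^ (-β))) p
      = ENNReal.ofReal (Real.Gamma (1 - β) * p ^ (β - 1)) := by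
  have h := Real.integral_rpow_mul_exp_neg_mul_Ioi (a := 1 - β) (by linarith) hp
  -- A non-integrable function would have integral 0 by convention, but the Gamma formula gives a
  -- positive value.
  have hi : IntegrableOn (fun t : ℝ => t ^ (1 - β - 1) * Real.exp (-(p * t))) (Ioi 0) := by
    by_contra hc
    rw [integral_undef hc] at h
    exact (mul_pos (Real.rpow_pos_of_pos (by positivity) _)
      (Real.Gamma_pos_of_pos (show 0 < 1 - β by linarith))).ne h
  have hr : (1 / p) ^ (1 - β) = p ^ (β - 1) := by
    rw [one_div, Real.inv_rpow hp.le, ← Real.rpow_neg hp.le, neg_sub]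
  rw [hr, mul_comm] at h
  rw [← h, ofReal_integral_eq_lintegral_ofReal hi]
  · refine setLIntegral_congr_fun measurableSet_Ioi fun t ht => ?_
    have ht' : 0 < t := ht
    rw [← ENNReal.ofReal_mul (exp_pos _).le, show 1 - β - 1 = -β by ring, mul_comm]
  · filter_upwards [ae_restrict_mem measurableSet_Ioi] with t ht
    have ht' : 0 < t := ht
    exact mul_nonneg (Real.rpow_nonneg ht'.le _) (exp_pos _).le

/-- As p decreases to 0 the transform blows up like p^{β-1}, and the value at 0 dominates all of
them. -/
theorem laplace_zero_eq_top {β c : ℝ} (h0 : 0 < β) (h1 : β < 1) (hc : 0 < c) {g : ℝ → ENNReal}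
    (hg : ∀ p, 0 < p → laplace g p = ENNReal.ofReal (c * (p ^ (β - 1) / (1 + p ^ β)))) :
    laplace g 0 = ⊤ := by
  have ht : Tendsto (fun p : ℝ => c * (p ^ (β - 1) / (1 + p ^ β))) (𝓝[>] 0) atTop := by
    refine Tendsto.const_mul_atTop hc ?_
    have h := (tendsto_rpow_neg_nhdsGT_zero (show β - 1 < 0 by linarith)).atTop_mul_const
      (show (0 : ℝ) < 1 / 2 by norm_num)
    refine tendsto_atTop_mono' _ ?_ h
    filter_upwards [Ioo_mem_nhdsGT (zero_lt_one (α := ℝ))] with p hp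
    have := Real.rpow_le_one hp.1.le hp.2.le h0.le
    have h2 := Real.rpow_nonneg hp.1.le β
    rw [mul_one_div]
    have := Real.rpow_nonneg hp.1.le (β - 1)
    gcongr
    linarith
  refine top_unique (le_of_tendsto (ENNReal.tendsto_ofReal_atTop.comp ht) ?_)
  filter_upwards [self_mem_nhdsWithin] with p hp
  rw [Function.comp, ← hg p hp]
  exact laplace_antitone g (le_of_lt hp)

/-- The Caputo derivative of order `β` of `t ↦ E_β(-t ^ β)` is its negative. -/
theorem integral_caputo_mlRate {β t : ℝ} (h0 : 0 < β) (h1 : β < 1) (ht : 0 < t) :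
    ∫ s in (0 : ℝ)..t, (t - s) ^ (-β) * mlRate β s = Real.Gamma (1 - β) * mlFun β t := by
  have hΓ := Real.Gamma_pos_of_pos (show 0 < 1 - β by linarith)
  have hk := continuous_mlKernel h0 h1
  have mA := measurable_expMixture hk.measurable
  have mB := measurable_expMixture (φ := fun x => Real.exp x * mlKernel β x) (by fun_prop)
  set g₁ : ℝ → ENNReal := fun t => ∫⁻ s in Ioo 0 t, ENNReal.ofReal ((t - s) ^ (-β)) *
    expMixture (fun x => Real.exp x * mlKernel β x) s with hg₁
  set g₂ : ℝ → ENNReal := fun t => ENNReal.ofReal (Real.Gamma (1 - β)) * expMixture (mlKernel β) t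
    with hg₂
  -- The convolution becomes the product Γ(1-β) p^{β-1} · 1/(1 + p^β), which is Γ(1-β) times the
  -- transform of `mlFun`.
  have L₁ : ∀ p, 0 < p → laplace g₁ p =
      ENNReal.ofReal (Real.Gamma (1 - β) * (p ^ (β - 1) / (1 + p ^ β))) := by
    intro p hp
    have hpos : 0 ≤ p ^ (β - 1) := Real.rpow_nonneg hp.le _
    rw [hg₁, laplace_convolution (f := fun t => ENNReal.ofReal (t ^ (-β))) (by fun_prop) mB,
      laplace_rpow h1 hp, laplace_mlRate h0 h1 hp, ← ENNReal.ofReal_mul (by positivity)]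
    congr 1
    ring
  have L₂ : ∀ p, 0 < p → laplace g₂ p =
      ENNReal.ofReal (Real.Gamma (1 - β) * (p ^ (β - 1) / (1 + p ^ β))) := by
    intro p hp
    rw [ENNReal.ofReal_mul hΓ.le, ← laplace_mlFun h0 h1 hp, laplace, laplace,
      ← lintegral_const_mul _ (by fun_prop)]
    refine lintegral_congr fun s => ?_
    rw [hg₂]
    ring
  have m₁ : Measurable g₁ := by
    have : g₁ = fun t => ∫⁻ s, (Ioo 0 t).indicator (fun s => ENNReal.ofReal ((t - s) ^ (-β)) *
      expMixture (fun x => Real.exp x * mlKernel β x) s) s := by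
      funext t
      rw [lintegral_indicator measurableSet_Ioo]
    rw [this]
    refine Measurable.lintegral_prod_right ?_
    have hset : MeasurableSet {q : ℝ × ℝ | q.2 ∈ Ioo 0 q.1} :=
      (measurableSet_lt measurable_const measurable_snd).inter
        (measurableSet_lt measurable_snd measurable_fst)
    exact Measurable.indicator (s := {q : ℝ × ℝ | q.2 ∈ Ioo 0 q.1})
      (f := fun q : ℝ × ℝ => ENNReal.ofReal ((q.1 - q.2) ^ (-β)) *
        expMixture (fun x => Real.exp x * mlKernel β x) q.2) (by fun_prop) hset
  have hae := ae_eq_of_laplace_eq m₁ (by fun_prop)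
    (fun p hp => by rw [L₁ p hp]; exact ENNReal.ofReal_ne_top)
    (fun p hp => by rw [L₁ p hp, L₂ p hp]) (laplace_zero_eq_top h0 h1 hΓ L₁)
    (laplace_zero_eq_top h0 h1 hΓ L₂)
  have hpos : ∀ u : ℝ, 0 < u → 0 ≤ ∫ s in (0 : ℝ)..u, (u - s) ^ (-β) * mlRate β s := fun u hu =>
    intervalIntegral.integral_nonneg hu.le fun s hs =>
      mul_nonneg (Real.rpow_nonneg (by linarith [hs.2]) _) (mlRate_nonneg h0 h1 s)
  have hconv : ∀ u : ℝ, 0 < u →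
      g₁ u = ENNReal.ofReal (∫ s in (0 : ℝ)..u, (u - s) ^ (-β) * mlRate β s) := by
    intro u hu
    have hi := intervalIntegrable_caputo_mlRate h0 h1 hu
    rw [intervalIntegrable_iff_integrableOn_Ioo_of_le hu.le] at hi
    rw [intervalIntegral.integral_of_le hu.le, integral_Ioc_eq_integral_Ioo,
      ofReal_integral_eq_lintegral_ofReal hi]
    · refine setLIntegral_congr_fun measurableSet_Ioo fun s hs => ?_
      rw [expMixture_rate h0 h1 hs.1, ← ENNReal.ofReal_mul
        (Real.rpow_nonneg (by linarith [hs.2]) _)]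
    · filter_upwards [ae_restrict_mem measurableSet_Ioo] with s hs
      exact mul_nonneg (Real.rpow_nonneg (by linarith [hs.2]) _) (mlRate_nonneg h0 h1 s)
  have hreal : (fun u => ∫ s in (0 : ℝ)..u, (u - s) ^ (-β) * mlRate β s)
      =ᵐ[volume.restrict (Ioi 0)] fun u => Real.Gamma (1 - β) * mlFun β u := by
    filter_upwards [hae, ae_restrict_mem measurableSet_Ioi] with u hu hu0
    rw [hconv u hu0, hg₂] at hu
    simp only at hu
    rw [expMixture_mlKernel h0 h1 hu0, ← ENNReal.ofReal_mul hΓ.le,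
      ENNReal.ofReal_eq_ofReal_iff (hpos u hu0) (mul_nonneg hΓ.le (mlFun_nonneg h0 h1 u))] at hu
    exact hu
  -- Both sides are continuous on (0, ∞), so equality almost everywhere there is equality
  -- everywhere.
  exact Measure.eqOn_open_of_ae_eq hreal isOpen_Ioi (continuousOn_caputo_mlRate h0 h1)
    (continuousOn_const.mul ((continuousOn_mlFun h0 h1).mono Ioi_subset_Ici_self)) ht

/-- The fractional relaxation equation with rate `c ^ β`. -/
theorem caputo_mlFun_scaled {β c t : ℝ} (h0 : 0 < β) (h1 : β < 1) (hc : 0 < c) (ht : 0 < t) :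
    IntervalIntegrable (fun s => (t - s) ^ (-β) * (c * mlRate β (c * s))) volume 0 t ∧
    ∫ s in (0 : ℝ)..t, (t - s) ^ (-β) * (c * mlRate β (c * s))
      = Real.Gamma (1 - β) * (c ^ β * mlFun β (c * t)) := by
  have hct : 0 < c * t := mul_pos hc ht
  have hcong : EqOn (fun s => c ^ β * c * ((c * t - c * s) ^ (-β) * mlRate β (c * s)))
      (fun s => (t - s) ^ (-β) * (c * mlRate β (c * s))) (uIcc 0 t) := by
    intro s hs
    rw [uIcc_of_le ht.le] at hs
    have h : c ^ β * c ^ (-β) = 1 := by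
      rw [← Real.rpow_add hc]
      simp
    simp only
    rw [show c * t - c * s = c * (t - s) by ring, Real.mul_rpow hc.le (by linarith [hs.2])]
    linear_combination ((t - s) ^ (-β) * (c * mlRate β (c * s))) * h
  have hi := ((intervalIntegrable_caputo_mlRate h0 h1 hct).comp_mul_left (c := c)).const_mul
    (c ^ β * c)
  rw [zero_div, mul_div_cancel_left₀ _ hc.ne'] at hi
  refine ⟨hi.congr (fun s hs => hcong (uIoc_subset_uIcc hs)), ?_⟩
  rw [← intervalIntegral.integral_congr hcong, intervalIntegral.integral_const_mul, mul_assoc]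
  have := intervalIntegral.smul_integral_comp_mul_left (a := 0) (b := t)
    (fun s => (c * t - s) ^ (-β) * mlRate β s) c
  rw [smul_eq_mul, mul_zero] at this
  rw [this, integral_caputo_mlRate h0 h1 hct]
  ring

/-! ### The maximum principle and uniqueness for the scalar equation -/

theorem intervalIntegrable_deriv_of_caputo {β t : ℝ} (h0 : 0 < β) (ht : 0 < t) {w : ℝ → ℝ}
    (hi : IntervalIntegrable (fun s => (t - s) ^ (-β) * deriv w s) volume 0 t) :
    IntervalIntegrable (deriv w) volume 0 t := by
  have h : IntervalIntegrable (fun s => (t - s) ^ β * ((t - s) ^ (-β) * deriv w s)) volume 0 t := by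
    refine hi.continuousOn_mul (ContinuousOn.rpow_const (by fun_prop) fun s _ => Or.inr h0.le)
  rw [intervalIntegrable_iff_integrableOn_Ioo_of_le ht.le] at h ⊢
  refine h.congr_fun (fun s hs => ?_) measurableSet_Ioo
  have hs' : 0 < t - s := sub_pos.2 hs.2
  simp only
  rw [← mul_assoc, ← Real.rpow_add hs', add_neg_cancel, Real.rpow_zero, one_mul]

/-- At a point where the maximum over the past is attained, the Caputo derivative is bounded
below. -/
theorem caputo_lower_bound_of_isMax {β t : ℝ} (h0 : 0 < β) (ht : 0 < t) {w : ℝ → ℝ}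
    (hc : ContinuousOn w (Icc 0 t)) (hd : ∀ s ∈ Ioo 0 t, DifferentiableAt ℝ w s)
    (hi : IntervalIntegrable (fun s => (t - s) ^ (-β) * deriv w s) volume 0 t)
    (hmax : ∀ s ∈ Icc 0 t, w s ≤ w t) :
    t ^ (-β) * (w t - w 0) ≤ ∫ s in (0 : ℝ)..t, (t - s) ^ (-β) * deriv w s := by
  have hw := intervalIntegrable_deriv_of_caputo h0 ht hi
  set g := fun s => (t - s) ^ (-β) * deriv w s with hg
  have hiabs : IntervalIntegrable (fun s => |g s|) volume 0 t := hi.abs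
  -- The kernel is singular at t, so integrate by parts only up to r < t. The correction is the
  -- integral of |g| over [r, t], which vanishes as r tends to t.
  have key : ∀ r ∈ Ioo 0 t, t ^ (-β) * (w t - w 0) ≤
      (∫ s in (0 : ℝ)..r, g s) + ((∫ s in (0 : ℝ)..t, |g s|) - ∫ s in (0 : ℝ)..r, |g s|) := by
    intro r hr
    have hsub : uIcc 0 r ⊆ uIcc 0 t := uIcc_subset_uIcc_left
      (by rw [uIcc_of_le ht.le]; exact ⟨hr.1.le, hr.2.le⟩)
    have hsub' : uIcc r t ⊆ uIcc 0 t := uIcc_subset_uIcc_right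
      (by rw [uIcc_of_le ht.le]; exact ⟨hr.1.le, hr.2.le⟩)
    have hpow : ∀ s ∈ Icc 0 r, HasDerivAt (fun s => (t - s) ^ (-β)) (β * (t - s) ^ (-β - 1)) s := by
      intro s hs
      have := ((hasDerivAt_id s).const_sub t).rpow_const (p := -β)
        (Or.inl (by simp; linarith [hs.2, hr.2]))
      refine this.congr_deriv ?_
      simp
    -- The antiderivative w - w(t) is nonpositive by maximality, so the remaining integral has a
    -- favourable sign.
    have hparts := intervalIntegral.integral_mul_deriv_eq_deriv_mul_of_hasDerivAt
      (a := 0) (b := r) (u := fun s => (t - s) ^ (-β)) (u' := fun s => β * (t - s) ^ (-β - 1))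
      (v := fun s => w s - w t) (v' := deriv w)
      (by
        rw [uIcc_of_le hr.1.le]
        exact fun s hs => (hpow s hs).continuousAt.continuousWithinAt)
      (by
        rw [uIcc_of_le hr.1.le]
        exact (hc.mono (Icc_subset_Icc_right hr.2.le)).sub continuousOn_const)
      (by
        rw [min_eq_left hr.1.le, max_eq_right hr.1.le]
        exact fun s hs => hpow s ⟨hs.1.le, hs.2.le⟩)
      (by
        rw [min_eq_left hr.1.le, max_eq_right hr.1.le]
        exact fun s hs => ((hd s ⟨hs.1, hs.2.trans hr.2⟩).hasDerivAt).sub_const _)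
      (by
        refine ContinuousOn.intervalIntegrable fun s hs => ContinuousAt.continuousWithinAt ?_
        rw [uIcc_of_le hr.1.le] at hs
        exact continuousAt_const.mul ((continuousAt_const.sub continuousAt_id).rpow_const
          (Or.inl (by simp; linarith [hs.2, hr.2]))))
      (hw.mono_set hsub)
    have hneg : ∫ s in (0 : ℝ)..r, β * (t - s) ^ (-β - 1) * (w s - w t) ≤ 0 := by
      rw [← neg_nonneg, ← intervalIntegral.integral_neg]
      refine intervalIntegral.integral_nonneg hr.1.le fun s hs => neg_nonneg.2 ?_
      have h1 := Real.rpow_nonneg (show 0 ≤ t - s by linarith [hs.2, hr.2]) (-β - 1)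
      have h2 := hmax s ⟨hs.1, hs.2.trans hr.2.le⟩
      exact mul_nonpos_of_nonneg_of_nonpos (by positivity) (by linarith)
    have hftc : ∫ s in r..t, deriv w s = w t - w r :=
      intervalIntegral.integral_eq_sub_of_hasDerivAt_of_le hr.2.le
        (hc.mono (Icc_subset_Icc_left hr.1.le))
        (fun s hs => (hd s ⟨hr.1.trans hs.1, hs.2⟩).hasDerivAt) (hw.mono_set hsub')
    have hrt : 0 < t - r := sub_pos.2 hr.2
    -- The boundary term at r is w(t) - w(r) = ∫ w' over [r, t], weighted by the smallest value of
    -- the kernel there.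
    have habs : (t - r) ^ (-β) * (w t - w r) ≤ ∫ s in r..t, |g s| := by
      rw [← hftc, ← intervalIntegral.integral_const_mul]
      refine intervalIntegral.integral_mono_on_of_le_Ioo hr.2.le ((hw.mono_set hsub').const_mul _)
        (hiabs.mono_set hsub') fun s hs => ?_
      have h1 : (t - r) ^ (-β) ≤ (t - s) ^ (-β) :=
        Real.rpow_le_rpow_of_nonpos (sub_pos.2 hs.2) (by linarith [hs.1]) (by linarith)
      have h2 := Real.rpow_nonneg hrt.le (-β)
      rw [hg, abs_mul, abs_of_nonneg (h2.trans h1)]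
      calc (t - r) ^ (-β) * deriv w s ≤ (t - r) ^ (-β) * |deriv w s| := by
            gcongr
            exact le_abs_self _
        _ ≤ _ := by gcongr
    have hsplit := intervalIntegral.integral_add_adjacent_intervals
      (hiabs.mono_set hsub) (hiabs.mono_set hsub')
    simp only [sub_zero] at hparts
    rw [hg] at *
    simp only at *
    rw [hparts]
    nlinarith
  have hcont : ContinuousOn (fun r => (∫ s in (0 : ℝ)..r, g s) +
      ((∫ s in (0 : ℝ)..t, |g s|) - ∫ s in (0 : ℝ)..r, |g s|)) (uIcc 0 t) := by
    have h1 := intervalIntegral.continuousOn_primitive_interval' hi (left_mem_uIcc)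
    have h2 := intervalIntegral.continuousOn_primitive_interval' hiabs (left_mem_uIcc)
    exact h1.add (continuousOn_const.sub h2)
  have hlim := (hcont t right_mem_uIcc).mono_left (nhdsWithin_mono t (s := Ioo 0 t) (by
    rw [uIcc_of_le ht.le]
    exact Ioo_subset_Icc_self))
  have hne : (𝓝[Ioo 0 t] t).NeBot := right_nhdsWithin_Ioo_neBot ht
  have := ge_of_tendsto hlim (eventually_of_mem self_mem_nhdsWithin key)
  simpa using this

/-- At a positive maximum the Caputo integral would be positive, while the equation makes it
negative. -/
theorem caputo_nonpos {β μ T : ℝ} (h0 : 0 < β) (hμ : 0 < μ) (hT : 0 < T) {w : ℝ → ℝ}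
    (hc : ContinuousOn w (Icc 0 T)) (hd : ∀ s ∈ Ioo 0 T, DifferentiableAt ℝ w s)
    (hi : ∀ t ∈ Ioc 0 T, IntervalIntegrable (fun s => (t - s) ^ (-β) * deriv w s) volume 0 t)
    (he : ∀ t ∈ Ioc 0 T, ∫ s in (0 : ℝ)..t, (t - s) ^ (-β) * deriv w s = -μ * w t)
    (hw : w 0 = 0) : ∀ t ∈ Icc 0 T, w t ≤ 0 := by
  obtain ⟨t₀, ht₀, hmax⟩ := isCompact_Icc.exists_isMaxOn (nonempty_Icc.2 hT.le) hc
  suffices h : w t₀ ≤ 0 from fun t ht => (hmax ht).trans h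
  by_contra! hpos
  have ht : 0 < t₀ := lt_of_le_of_ne ht₀.1 fun h => by
    rw [← h, hw] at hpos
    exact lt_irrefl _ hpos
  have key := caputo_lower_bound_of_isMax h0 ht (hc.mono (Icc_subset_Icc_right ht₀.2))
    (fun s hs => hd s ⟨hs.1, hs.2.trans_le ht₀.2⟩) (hi t₀ ⟨ht, ht₀.2⟩)
    (fun s hs => hmax ⟨hs.1, hs.2.trans ht₀.2⟩)
  rw [he t₀ ⟨ht, ht₀.2⟩, hw, sub_zero] at key
  have := Real.rpow_pos_of_pos ht (-β)
  nlinarith [mul_pos this hpos, mul_pos hμ hpos]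

theorem caputo_eq_zero {β μ T : ℝ} (h0 : 0 < β) (hμ : 0 < μ) (hT : 0 < T) {w : ℝ → ℝ}
    (hc : ContinuousOn w (Icc 0 T)) (hd : ∀ s ∈ Ioo 0 T, DifferentiableAt ℝ w s)
    (hi : ∀ t ∈ Ioc 0 T, IntervalIntegrable (fun s => (t - s) ^ (-β) * deriv w s) volume 0 t)
    (he : ∀ t ∈ Ioc 0 T, ∫ s in (0 : ℝ)..t, (t - s) ^ (-β) * deriv w s = -μ * w t)
    (hw : w 0 = 0) : ∀ t ∈ Icc 0 T, w t = 0 := by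
  intro t ht
  refine le_antisymm (caputo_nonpos h0 hμ hT hc hd hi he hw t ht) ?_
  have h := caputo_nonpos (w := fun s => -w s) h0 hμ hT hc.neg (fun s hs => (hd s hs).neg)
    (fun t ht => by simpa [deriv.fun_neg, Pi.neg_def] using (hi t ht).neg)
    (fun t ht => by simp [deriv.fun_neg, he t ht]) (by simp [hw]) t ht
  linarith

/-! ### The sine basis of `L²(-1, 1)` -/

theorem continuous_eigenFun (n : ℕ) : Continuous (eigenFun n) := by
  unfold eigenFun
  fun_prop

theorem abs_eigenFun_le_one (n : ℕ) (x : ℝ) : |eigenFun n x| ≤ 1 := Real.abs_sin_le_one _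

theorem eigenFun_neg_one (n : ℕ) : eigenFun n (-1) = 0 := by simp [eigenFun]

theorem eigenFun_one (n : ℕ) : eigenFun n 1 = 0 := by
  have h := Real.sin_nat_mul_pi (n + 1)
  rw [eigenFun, ← h]
  push_cast
  congr 1
  ring

theorem integral_volD (g : ℝ → ℝ) : ∫ x, g x ∂volD = ∫ x in (-1 : ℝ)..1, g x := by
  rw [intervalIntegral.integral_of_le (by norm_num), integral_Ioc_eq_integral_Ioo]

theorem coeff_eq_integral (v : L2D) (n : ℕ) : coeff v n = ∫ x, eigenFun n x * v x ∂volD := by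
  rw [coeff, L2.inner_def]
  refine integral_congr_ae ?_
  filter_upwards [(memLp_eigenFun n).coeFn_toLp] with x hx
  rw [eigenVec, hx]
  simp [mul_comm]

theorem integral_cos_mul {a : ℝ} (ha : a ≠ 0) (hs : Real.sin (a * 2) = 0) :
    ∫ x in (-1 : ℝ)..1, Real.cos (a * (x + 1)) = 0 := by
  have hd : ∀ x ∈ uIcc (-1 : ℝ) 1,
      HasDerivAt (fun x => Real.sin (a * (x + 1)) / a) (Real.cos (a * (x + 1))) x := by
    intro x _
    have := ((((hasDerivAt_id x).add_const 1).const_mul a).sin).div_const a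
    refine this.congr_deriv ?_
    simp [ha]
  rw [intervalIntegral.integral_eq_sub_of_hasDerivAt hd
    (Continuous.intervalIntegrable (by fun_prop) _ _)]
  norm_num [hs]

/-- Product-to-sum formula: every cosine of nonzero frequency integrates to 0. The interval has
length 2, so the sines need no normalising factor. -/
theorem inner_eigenVec (m n : ℕ) :
    inner ℝ (eigenVec m) (eigenVec n) = if m = n then (1 : ℝ) else 0 := by
  have h1 : inner ℝ (eigenVec m) (eigenVec n) = ∫ x, eigenFun m x * eigenFun n x ∂volD := by
    change coeff (eigenVec n) m = _
    rw [coeff_eq_integral]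
    refine integral_congr_ae ?_
    filter_upwards [(memLp_eigenFun n).coeFn_toLp] with x hx
    rw [eigenVec, hx]
  have h2 : ∀ x, eigenFun m x * eigenFun n x =
      Real.cos (((m : ℝ) - n) * π / 2 * (x + 1)) / 2
        - Real.cos (((m : ℝ) + n + 2) * π / 2 * (x + 1)) / 2 := by
    intro x
    have e1 : ((m : ℝ) - n) * π / 2 * (x + 1) =
      ((m : ℝ) + 1) * π / 2 * (x + 1) - ((n : ℝ) + 1) * π / 2 * (x + 1) := by ring
    have e2 : ((m : ℝ) + n + 2) * π / 2 * (x + 1) =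
      ((m : ℝ) + 1) * π / 2 * (x + 1) + ((n : ℝ) + 1) * π / 2 * (x + 1) := by ring
    rw [e1, e2, Real.cos_sub, Real.cos_add, eigenFun, eigenFun]
    ring
  have hsum : ∫ x in (-1 : ℝ)..1, Real.cos (((m : ℝ) + n + 2) * π / 2 * (x + 1)) = 0 := by
    refine integral_cos_mul (by positivity) ?_
    have := Real.sin_nat_mul_pi (m + n + 2)
    rw [← this]
    push_cast
    congr 1
    ring
  rw [h1, integral_volD]
  simp_rw [h2]
  rw [intervalIntegral.integral_sub (Continuous.intervalIntegrable (by fun_prop) _ _)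
      (Continuous.intervalIntegrable (by fun_prop) _ _), intervalIntegral.integral_div,
    intervalIntegral.integral_div, hsum]
  split_ifs with h
  · subst h
    norm_num
  · rw [integral_cos_mul]
    · norm_num
    · have : (m : ℝ) - n ≠ 0 := sub_ne_zero.2 (by exact_mod_cast h)
      have := pi_ne_zero
      positivity
    · have := Real.sin_int_mul_pi ((m : ℤ) - n)
      rw [← this]
      push_cast
      congr 1
      ring

theorem orthonormal_eigenVec : Orthonormal ℝ eigenVec :=
  orthonormal_iff_ite.2 inner_eigenVec

theorem integrable_L2D (v : L2D) : Integrable v volD := (Lp.memLp v).integrable (by norm_num)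

/-- Since 2 sin(kθ) cos θ = sin((k+1)θ) + sin((k-1)θ), a cosine factor can be traded for
neighbouring frequencies; hence the induction on j for all k at once. -/
theorem integral_sin_mul_cos_pow_eq_zero {v : L2D} (hv : ∀ n, coeff v n = 0) (j : ℕ) :
    ∀ k : ℕ, ∫ x, Real.sin (k * (π / 2 * (x + 1))) * Real.cos (π / 2 * (x + 1)) ^ j * v x ∂volD
      = 0 := by
  have hint : ∀ k j : ℕ, Integrable (fun x =>
      Real.sin (k * (π / 2 * (x + 1))) * Real.cos (π / 2 * (x + 1)) ^ j * v x) volD := by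
    intro k j
    refine (integrable_L2D v).bdd_mul (c := 1) (Continuous.aestronglyMeasurable (by fun_prop))
      (ae_of_all _ fun x => ?_)
    rw [norm_mul, norm_pow, Real.norm_eq_abs, Real.norm_eq_abs]
    exact mul_le_one₀ (Real.abs_sin_le_one _) (by positivity)
      (pow_le_one₀ (abs_nonneg _) (Real.abs_cos_le_one _))
  induction j with
  | zero =>
    intro k
    rcases k with _ | k
    · simp
    · rw [← hv k, coeff_eq_integral]
      refine integral_congr_ae (ae_of_all _ fun x => ?_)
      simp only [pow_zero, mul_one, eigenFun]
      push_cast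
      congr 2
      ring
  | succ j ih =>
    intro k
    rcases k with _ | k
    · simp
    · have h : ∀ x, Real.sin (((k + 1 : ℕ) : ℝ) * (π / 2 * (x + 1))) *
          Real.cos (π / 2 * (x + 1)) ^ (j + 1) * v x =
          (Real.sin (((k + 2 : ℕ) : ℝ) * (π / 2 * (x + 1))) * Real.cos (π / 2 * (x + 1)) ^ j * v x) / 2
          + (Real.sin ((k : ℝ) * (π / 2 * (x + 1))) * Real.cos (π / 2 * (x + 1)) ^ j * v x) / 2 := by
        intro x
        have e1 : ((k + 2 : ℕ) : ℝ) * (π / 2 * (x + 1)) =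
          ((k + 1 : ℕ) : ℝ) * (π / 2 * (x + 1)) + π / 2 * (x + 1) := by push_cast; ring
        have e2 : (k : ℝ) * (π / 2 * (x + 1)) =
          ((k + 1 : ℕ) : ℝ) * (π / 2 * (x + 1)) - π / 2 * (x + 1) := by push_cast; ring
        rw [e1, e2, Real.sin_add, Real.sin_sub]
        ring
      simp_rw [h]
      rw [integral_add ((hint _ _).div_const 2) ((hint _ _).div_const 2), integral_div,
        integral_div, ih, ih]
      simp

theorem integral_sin_mul_eval_cos_eq_zero {v : L2D} (hv : ∀ n, coeff v n = 0)
    (P : Polynomial ℝ) :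
    ∫ x, Real.sin (π / 2 * (x + 1)) * P.eval (Real.cos (π / 2 * (x + 1))) * v x ∂volD = 0 := by
  have hint : ∀ Q : Polynomial ℝ, Integrable (fun x =>
      Real.sin (π / 2 * (x + 1)) * Q.eval (Real.cos (π / 2 * (x + 1))) * v x) volD := by
    intro Q
    have hQ : ContinuousOn (fun y => |Q.eval y|) (Icc (-1) 1) := by fun_prop
    obtain ⟨C, hC⟩ := isCompact_Icc.exists_bound_of_continuousOn hQ
    refine (integrable_L2D v).bdd_mul (c := C) (Continuous.aestronglyMeasurable (by fun_prop))
      (ae_of_all _ fun x => ?_)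
    have := hC _ ⟨Real.neg_one_le_cos (π / 2 * (x + 1)), Real.cos_le_one _⟩
    rw [Real.norm_eq_abs, abs_abs] at this
    rw [norm_mul, Real.norm_eq_abs, Real.norm_eq_abs]
    exact (mul_le_of_le_one_left (abs_nonneg _) (Real.abs_sin_le_one _)).trans this
  induction P using Polynomial.induction_on' with
  | add p q hp hq =>
    have h : ∀ x, Real.sin (π / 2 * (x + 1)) * (p + q).eval (Real.cos (π / 2 * (x + 1))) * v x =
        Real.sin (π / 2 * (x + 1)) * p.eval (Real.cos (π / 2 * (x + 1))) * v x +
        Real.sin (π / 2 * (x + 1)) * q.eval (Real.cos (π / 2 * (x + 1))) * v x := by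
      intro x
      rw [Polynomial.eval_add]
      ring
    simp_rw [h]
    rw [integral_add (hint p) (hint q), hp, hq, add_zero]
  | monomial n a =>
    have := integral_sin_mul_cos_pow_eq_zero hv n 1
    simp_rw [Nat.cast_one, one_mul] at this
    rw [← mul_zero a, ← this, ← integral_const_mul]
    refine integral_congr_ae (ae_of_all _ fun x => ?_)
    simp only [Polynomial.eval_monomial]
    ring

/-- On the support of χ the sine does not vanish, so the quotient of χ by it is continuous. As a
function of y = cos θ it is approximated by Weierstrass, and multiplying back by the sine does not
enlarge the error. -/
theorem exists_near_sin_mul_eval_cos {χ : ℝ → ℝ} (hχ : Continuous χ)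
    (hs : tsupport χ ⊆ Ioo (-1) 1) {ε : ℝ} (hε : 0 < ε) :
    ∃ P : Polynomial ℝ, ∀ x ∈ Ioo (-1 : ℝ) 1,
      |χ x - Real.sin (π / 2 * (x + 1)) * P.eval (Real.cos (π / 2 * (x + 1)))| ≤ ε := by
  have hθ : ∀ x ∈ Ioo (-1 : ℝ) 1, 0 < π / 2 * (x + 1) ∧ π / 2 * (x + 1) < π := by
    intro x hx
    constructor <;> nlinarith [pi_pos, hx.1, hx.2]
  have hsin : ∀ x ∈ Ioo (-1 : ℝ) 1, 0 < Real.sin (π / 2 * (x + 1)) := fun x hx =>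
    Real.sin_pos_of_pos_of_lt_pi (hθ x hx).1 (hθ x hx).2
  have hψ : Continuous fun x => χ x / Real.sin (π / 2 * (x + 1)) := by
    refine continuous_iff_continuousAt.2 fun x => ?_
    by_cases hx : x ∈ tsupport χ
    · exact hχ.continuousAt.div (by fun_prop) (hsin x (hs hx)).ne'
    · have h0 : χ =ᶠ[𝓝 x] 0 := notMem_tsupport_iff_eventuallyEq.1 hx
      refine (continuousAt_const (y := (0 : ℝ))).congr ?_
      filter_upwards [h0] with y hy
      simp [hy]
  obtain ⟨P, hP⟩ := exists_polynomial_near_of_continuousOn (-1) 1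
    (fun y => (fun x => χ x / Real.sin (π / 2 * (x + 1))) (2 / π * Real.arccos y - 1))
    (by
      refine Continuous.continuousOn ?_
      have := Real.continuous_arccos
      exact hψ.comp (by fun_prop)) ε hε
  refine ⟨P, fun x hx => ?_⟩
  have h := hP (Real.cos (π / 2 * (x + 1))) ⟨Real.neg_one_le_cos _, Real.cos_le_one _⟩
  have hx' : 2 / π * (π / 2 * (x + 1)) - 1 = x := by
    field_simp
    ring
  simp only at h
  rw [Real.arccos_cos (hθ x hx).1.le (hθ x hx).2.le, hx', abs_sub_comm] at h
  have hne := (hsin x hx).ne'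
  have : χ x - Real.sin (π / 2 * (x + 1)) * P.eval (Real.cos (π / 2 * (x + 1))) =
      Real.sin (π / 2 * (x + 1)) * (χ x / Real.sin (π / 2 * (x + 1))
        - P.eval (Real.cos (π / 2 * (x + 1)))) := by
    rw [mul_sub, mul_div_assoc', mul_div_cancel_left₀ _ hne]
  rw [this, abs_mul]
  exact (mul_le_of_le_one_left (abs_nonneg _) (Real.abs_sin_le_one _)).trans h.le

/-- Completeness of the sines: v is orthogonal to sin θ · P(cos θ) for every polynomial P, hence by
approximation to every smooth function with compact support in D. -/
theorem eq_zero_of_coeff_eq_zero {v : L2D} (hv : ∀ n, coeff v n = 0) : v = 0 := by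
  have hvi := integrable_L2D v
  have hz : ∀ᵐ x : ℝ, x ∈ Ioo (-1 : ℝ) 1 → v x = 0 := by
    refine isOpen_Ioo.ae_eq_zero_of_integral_contDiff_smul_eq_zero
      (IntegrableOn.locallyIntegrableOn hvi) fun χ hχ _ hs => ?_
    have hset : ∫ x, χ x • v x = ∫ x, χ x * v x ∂volD := by
      refine (setIntegral_eq_integral_of_forall_compl_eq_zero fun x hx => ?_).symm
      have : χ x = 0 := image_eq_zero_of_notMem_tsupport fun h => hx (hs h)
      simp [this]
    rw [hset]
    refine abs_nonpos_iff.1 (le_of_forall_pos_le_add fun δ hδ => ?_)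
    set M := ∫ x, |v x| ∂volD with hM
    have hM0 : 0 ≤ M := integral_nonneg fun x => abs_nonneg _
    -- The denominator M + 1 rather than M covers the case where the L¹ norm M is 0.
    obtain ⟨P, hP⟩ := exists_near_sin_mul_eval_cos hχ.continuous hs
      (ε := δ / (M + 1)) (by positivity)
    have hb : ∀ᵐ x ∂volD, ‖χ x - Real.sin (π / 2 * (x + 1)) *
        P.eval (Real.cos (π / 2 * (x + 1)))‖ ≤ δ / (M + 1) := by
      filter_upwards [ae_restrict_mem measurableSet_Ioo] with x hx using hP x hx
    have hcχ := hχ.continuous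
    have hi1 : Integrable (fun x => (χ x - Real.sin (π / 2 * (x + 1)) *
        P.eval (Real.cos (π / 2 * (x + 1)))) * v x) volD :=
      hvi.bdd_mul (Continuous.aestronglyMeasurable (by fun_prop)) hb
    have hi2 : Integrable (fun x => Real.sin (π / 2 * (x + 1)) *
        P.eval (Real.cos (π / 2 * (x + 1))) * v x) volD := by
      have hQ : ContinuousOn (fun x => Real.sin (π / 2 * (x + 1)) *
        P.eval (Real.cos (π / 2 * (x + 1)))) (Icc (-1) 1) := by fun_prop
      obtain ⟨C, hC⟩ := isCompact_Icc.exists_bound_of_continuousOn hQ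
      refine hvi.bdd_mul (c := C) (Continuous.aestronglyMeasurable (by fun_prop)) ?_
      filter_upwards [ae_restrict_mem measurableSet_Ioo] with x hx
      exact hC x ⟨hx.1.le, hx.2.le⟩
    have heq : ∫ x, χ x * v x ∂volD = ∫ x, (χ x - Real.sin (π / 2 * (x + 1)) *
        P.eval (Real.cos (π / 2 * (x + 1)))) * v x ∂volD := by
      rw [← add_zero (∫ x, (χ x - _) * v x ∂volD), ← integral_sin_mul_eval_cos_eq_zero hv P,
        ← integral_add hi1 hi2]
      refine integral_congr_ae (ae_of_all _ fun x => ?_)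
      simp only
      ring
    rw [heq, zero_add]
    calc |∫ x, (χ x - Real.sin (π / 2 * (x + 1)) *
          P.eval (Real.cos (π / 2 * (x + 1)))) * v x ∂volD|
        ≤ ∫ x, δ / (M + 1) * |v x| ∂volD := by
          rw [← Real.norm_eq_abs]
          refine norm_integral_le_of_norm_le (hvi.abs.const_mul _) ?_
          filter_upwards [hb] with x hx
          rw [norm_mul]
          exact mul_le_mul_of_nonneg_right hx (norm_nonneg _)
      _ = δ * (M / (M + 1)) := by
          rw [integral_const_mul, ← hM]
          ring
      _ ≤ δ := mul_le_of_le_one_right hδ.le ((div_le_one (by positivity)).2 (by linarith))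
  refine Lp.ext ?_
  filter_upwards [(ae_restrict_iff' measurableSet_Ioo).2 hz, Lp.coeFn_zero ℝ 2 volD] with x h1 h2
  rw [h1, h2, Pi.zero_apply]

/-- The eigenfunctions as a Hilbert basis of `L²(D)`. -/
def eigenBasis : HilbertBasis ℕ ℝ L2D :=
  HilbertBasis.mkOfOrthogonalEqBot orthonormal_eigenVec (by
    refine (Submodule.eq_bot_iff _).2 fun v hv => eq_zero_of_coeff_eq_zero fun n => ?_
    exact (Submodule.mem_orthogonal _ v).1 hv _ (Submodule.subset_span ⟨n, rfl⟩))

theorem eigenBasis_apply (n : ℕ) : eigenBasis n = eigenVec n :=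
  congrFun (HilbertBasis.coe_mkOfOrthogonalEqBot _ _) n

theorem hasSum_coeff (v : L2D) : HasSum (fun n => coeff v n • eigenVec n) v := by
  have := eigenBasis.hasSum_repr v
  simp only [HilbertBasis.repr_apply_apply, eigenBasis_apply] at this
  exact this

theorem ext_coeff {v w : L2D} (h : ∀ n, coeff v n = coeff w n) : v = w := by
  refine (hasSum_coeff v).unique ?_
  simp_rw [h]
  exact hasSum_coeff w

theorem coeff_of_hasSum {c : ℕ → ℝ} {v : L2D} (h : HasSum (fun n => c n • eigenVec n) v) (m : ℕ) :
    coeff v m = c m := by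
  have h1 := h.mapL (innerSL ℝ (eigenVec m))
  have h2 : ∀ n, innerSL ℝ (eigenVec m) (c n • eigenVec n) = if n = m then c m else 0 := by
    intro n
    rw [innerSL_apply_apply, inner_smul_right, inner_eigenVec]
    rcases eq_or_ne n m with rfl | hne
    · simp
    · simp [hne, hne.symm]
  simp_rw [h2] at h1
  exact h1.unique (hasSum_ite_eq m (c m))

theorem summable_smul_eigenVec {c : ℕ → ℝ} (h : Summable fun n => c n ^ 2) :
    Summable fun n => c n • eigenVec n := by
  have hm : Memℓp c 2 := memℓp_gen (by simpa using h)
  have := eigenBasis.hasSum_repr_symm ⟨c, hm⟩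
  simp only [eigenBasis_apply] at this
  exact this.summable

theorem norm_eigenVec (n : ℕ) : ‖eigenVec n‖ = 1 := orthonormal_eigenVec.1 n

/-! ### Absolutely convergent sine series -/

theorem summable_mul_eigenFun {c : ℕ → ℝ} (h : Summable fun n => |c n|) (x : ℝ) :
    Summable fun n => c n * eigenFun n x :=
  h.of_norm_bounded fun n => by
    rw [norm_mul]
    exact mul_le_of_le_one_right (abs_nonneg _) (abs_eigenFun_le_one n x)

theorem continuous_tsum_eigenFun {c : ℕ → ℝ} (h : Summable fun n => |c n|) :
    Continuous fun x => ∑' n, c n * eigenFun n x :=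
  continuous_tsum (fun n => continuous_const.mul (continuous_eigenFun n)) h fun n x => by
    rw [norm_mul]
    exact mul_le_of_le_one_right (abs_nonneg _) (abs_eigenFun_le_one n x)

/-- The eigenfunctions as bounded continuous functions. -/
def eigenBCF (n : ℕ) : BoundedContinuousFunction ℝ ℝ :=
  BoundedContinuousFunction.ofNormedAddCommGroup (eigenFun n) (continuous_eigenFun n) 1
    (abs_eigenFun_le_one n)

/-- The series is summed in the bounded continuous functions, where evaluation and the map to L² are
both continuous and commute with the sum. -/
theorem coeFn_tsum_eigenVec {c : ℕ → ℝ} (h : Summable fun n => |c n|) :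
    ⇑(∑' n, c n • eigenVec n) =ᵐ[volD] fun x => ∑' n, c n * eigenFun n x := by
  have hs : Summable fun n => c n • eigenBCF n := by
    refine h.of_norm_bounded fun n => ?_
    rw [norm_smul]
    exact mul_le_of_le_one_right (abs_nonneg _)
      (BoundedContinuousFunction.norm_ofNormedAddCommGroup_le _ zero_le_one _)
  have hvec : ∀ n, BoundedContinuousFunction.toLp 2 volD ℝ (eigenBCF n) = eigenVec n := by
    intro n
    refine Lp.ext ?_
    filter_upwards [BoundedContinuousFunction.coeFn_toLp volD (p := 2) (𝕜 := ℝ) (eigenBCF n),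
      (memLp_eigenFun n).coeFn_toLp] with x h1 h2
    rw [h1, eigenVec, h2]
    rfl
  have hsum : ∑' n, c n • eigenVec n =
      BoundedContinuousFunction.toLp 2 volD ℝ (∑' n, c n • eigenBCF n) := by
    rw [ContinuousLinearMap.map_tsum _ hs]
    simp_rw [map_smul, hvec]
  rw [hsum]
  filter_upwards [BoundedContinuousFunction.coeFn_toLp volD (p := 2) (𝕜 := ℝ)
    (∑' n, c n • eigenBCF n)] with x hx
  rw [hx]
  have := ContinuousLinearMap.map_tsum (BoundedContinuousFunction.evalCLM ℝ x) hs
  simpa [eigenBCF] using this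

/-! ### Dependence of the Mittag-Leffler function on the parameters -/

/-- The derivative of `mlKernel β x` with respect to `β`. -/
def mlKernelDeriv (β x : ℝ) : ℝ :=
  Real.cos (π * β) / (2 * (Real.cosh (β * x) + Real.cos (π * β))) -
    Real.sin (π * β) / π * (2 * (Real.sinh (β * x) * x - Real.sin (π * β) * π)) /
      (2 * (Real.cosh (β * x) + Real.cos (π * β))) ^ 2

theorem hasDerivAt_mlKernel {β : ℝ} (h0 : 0 < β) (h1 : β < 1) (x : ℝ) :
    HasDerivAt (fun b => mlKernel b x) (mlKernelDeriv β x) β := by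
  have hd := (mlKernel_denom_pos h0 h1 x).ne'
  have e1 : HasDerivAt (fun b : ℝ => π * b) π β := by
    simpa using (hasDerivAt_id β).const_mul π
  have e2 : HasDerivAt (fun b : ℝ => b * x) x β := by
    simpa using (hasDerivAt_id β).mul_const x
  have h := (e1.sin.div_const π).div (((e2.cosh.add e1.cos)).const_mul 2) hd
  refine h.congr_deriv ?_
  have hπ := pi_ne_zero
  simp only [Pi.add_apply, mlKernelDeriv]
  generalize 2 * (Real.cosh (β * x) + Real.cos (π * β)) = d at *
  field_simp
  ring

/-- Differentiating cosh(βx) in β costs a factor |x| and a growth e^{β|x|}, which is less than the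
squared denominator provides. -/
theorem abs_mlKernelDeriv_le {β b : ℝ} (h0 : 0 < β) (hb : β ≤ b) (h1 : b < 1) (x : ℝ) :
    |mlKernelDeriv β x| ≤ ((1 + Real.cos (π * b)) / 2)⁻¹ ^ 2 * ((4 + |x|) * Real.exp (-(β * |x|))) := by
  have hcb := neg_one_lt_cos_pi_mul (h0.trans_le hb) h1
  set c := (1 + Real.cos (π * b)) / 2 with hc
  have hc0 : 0 < c := by rw [hc]; linarith
  have hc1 : c ≤ 1 := by rw [hc]; linarith [Real.cos_le_one (π * b)]
  have hD := mlKernel_denom_lower h0 hb h1 x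
  rw [← hc] at hD
  rw [mlKernelDeriv]
  set D := 2 * (Real.cosh (β * x) + Real.cos (π * β)) with hDdef
  set E := Real.exp (β * |x|) with hE
  have hE0 : 0 < E := exp_pos _
  have hE1 : 1 ≤ E := Real.one_le_exp (by positivity)
  have hD0 : 0 < D := (mul_pos hc0 hE0).trans_le hD
  have hEinv : Real.exp (-(β * |x|)) = E⁻¹ := Real.exp_neg _
  have hsinh : |Real.sinh (β * x)| ≤ E := by
    rw [Real.abs_sinh, abs_mul, abs_of_pos h0, Real.sinh_eq]
    have := Real.exp_pos (-(β * |x|))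
    rw [← hE]
    linarith
  have hinv : D⁻¹ ≤ c⁻¹ * E⁻¹ := by
    rw [← mul_inv]
    exact inv_anti₀ (by positivity) hD
  have hcinv : 1 ≤ c⁻¹ := (one_le_inv₀ hc0).2 hc1
  have hEi : E⁻¹ ≤ 1 := inv_le_one_of_one_le₀ hE1
  have t1 : |Real.cos (π * β) / D| ≤ c⁻¹ ^ 2 * E⁻¹ := by
    rw [abs_div, abs_of_pos hD0, div_eq_mul_inv]
    calc |Real.cos (π * β)| * D⁻¹ ≤ 1 * (c⁻¹ * E⁻¹) := by
          gcongr
          exact Real.abs_cos_le_one _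
      _ ≤ c⁻¹ * (c⁻¹ * E⁻¹) := by gcongr
      _ = _ := by ring
  have t2 : |Real.sin (π * β) / π * (2 * (Real.sinh (β * x) * x - Real.sin (π * β) * π)) / D ^ 2|
      ≤ c⁻¹ ^ 2 * ((|x| + 2) * E⁻¹) := by
    have hs : |Real.sin (π * β)| ≤ 1 := Real.abs_sin_le_one _
    have hN : |Real.sin (π * β) / π * (2 * (Real.sinh (β * x) * x - Real.sin (π * β) * π))|
        ≤ E * (|x| + 2) := by
      have hπ := pi_pos
      have h3 : |Real.sinh (β * x) * x - Real.sin (π * β) * π| ≤ E * |x| + π := by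
        refine (abs_sub _ _).trans ?_
        rw [abs_mul, abs_mul, abs_of_pos hπ]
        gcongr
        exact mul_le_of_le_one_left hπ.le hs
      rw [abs_mul, abs_div, abs_of_pos hπ, abs_mul, abs_two]
      calc |Real.sin (π * β)| / π * (2 * |Real.sinh (β * x) * x - Real.sin (π * β) * π|)
          ≤ 1 / π * (2 * (E * |x| + π)) := by gcongr
        _ = (2 / π) * (E * |x|) + 2 := by field_simp
        _ ≤ 1 * (E * |x|) + 2 * E := by
          gcongr
          · rw [div_le_one hπ]
            linarith [pi_gt_three]
          · linarith
        _ = _ := by ring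
    rw [abs_div, abs_of_pos (pow_pos hD0 2), div_eq_mul_inv, ← inv_pow]
    calc _ ≤ E * (|x| + 2) * (c⁻¹ * E⁻¹) ^ 2 := by gcongr
      _ = _ := by field_simp
  rw [hEinv]
  calc _ ≤ c⁻¹ ^ 2 * E⁻¹ + c⁻¹ ^ 2 * ((|x| + 2) * E⁻¹) := (abs_sub _ _).trans (add_le_add t1 t2)
    _ ≤ _ := by
      have : 0 ≤ c⁻¹ ^ 2 * E⁻¹ := by positivity
      nlinarith

theorem exp_mul_abs_mul_exp_neg_exp_le (ξ : ℝ) :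
    Real.exp ξ * |ξ| * Real.exp (-Real.exp ξ) ≤ 2 := by
  have hp := exp_pos ξ
  rcases le_total 0 ξ with h | h
  · rw [abs_of_nonneg h]
    have h1 : ξ ≤ Real.exp ξ := by linarith [Real.add_one_le_exp ξ]
    calc Real.exp ξ * ξ * Real.exp (-Real.exp ξ)
        ≤ Real.exp ξ * Real.exp ξ * Real.exp (-Real.exp ξ) := by gcongr
      _ = Real.exp ξ ^ 2 * Real.exp (-Real.exp ξ) := by ring
      _ ≤ 2 := sq_mul_exp_neg_le hp.le
  · rw [abs_of_nonpos h]
    have h1 := mul_exp_neg_le_one (-ξ)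
    rw [neg_neg] at h1
    have h2 : Real.exp (-Real.exp ξ) ≤ 1 := Real.exp_le_one_iff.2 (neg_nonpos.2 hp.le)
    have h3 : 0 ≤ Real.exp ξ * -ξ := mul_nonneg hp.le (by linarith)
    nlinarith

/-- In the logarithmic variable a rescaling of time is a translation by L/β. -/
theorem mlFun_exp_mul (β L t : ℝ) : mlFun β (Real.exp (L / β) * t) =
    ∫ x, Real.exp (-(Real.exp (x + L / β) * t)) * mlKernel β x := by
  unfold mlFun
  simp_rw [Real.exp_add, mul_assoc]

theorem integrable_shifted_kernel {β t : ℝ} (h0 : 0 < β) (h1 : β < 1) (L : ℝ) (ht : 0 < t) :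
    Integrable fun x => Real.exp (-(Real.exp (x + L / β) * t)) * mlKernel β x := by
  have := integrable_exp_kernel h0 h1 (t := Real.exp (L / β) * t) (by positivity)
  simpa only [Real.exp_add, mul_assoc] using this

theorem abs_mul_exp_neg_le {a : ℝ} (ha : 0 < a) (x : ℝ) :
    |x| * Real.exp (-(a * |x|)) ≤ 2 / a * Real.exp (-(a / 2 * |x|)) := by
  have h := mul_exp_neg_le_one (a / 2 * |x|)
  have h2 : Real.exp (-(a * |x|)) = Real.exp (-(a / 2 * |x|)) * Real.exp (-(a / 2 * |x|)) := by
    rw [← Real.exp_add]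
    congr 1
    ring
  rw [h2]
  have hp := exp_pos (-(a / 2 * |x|))
  calc |x| * (Real.exp (-(a / 2 * |x|)) * Real.exp (-(a / 2 * |x|)))
      = 2 / a * (a / 2 * |x| * Real.exp (-(a / 2 * |x|))) * Real.exp (-(a / 2 * |x|)) := by
        field_simp
    _ ≤ 2 / a * 1 * Real.exp (-(a / 2 * |x|)) := by gcongr
    _ = _ := by ring

/-- The derivative in the order, at a fixed logarithm `L` of the rate, is bounded uniformly in
`L`. -/
theorem abs_kernel_sub_le {β₀ β₁ : ℝ} (hβ₀ : 0 < β₀) (hβ₁ : β₁ < 1) :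
    ∃ C, 0 ≤ C ∧ ∀ β ∈ Icc β₀ β₁, ∀ β' ∈ Icc β₀ β₁, ∀ L t x : ℝ, 0 < t →
      |Real.exp (-(Real.exp (x + L / β) * t)) * mlKernel β x
        - Real.exp (-(Real.exp (x + L / β') * t)) * mlKernel β' x|
      ≤ C * (1 + |Real.log t|) * Real.exp (-(β₀ / 2 * |x|)) * |β - β'| := by
  set c := (1 + Real.cos (π * β₁)) / 2 with hc
  set A := 1 / c with hA
  by_cases hne : β₀ ≤ β₁
  swap
  · exact ⟨0, le_rfl, fun β hβ => absurd (hβ.1.trans hβ.2) hne⟩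
  have hcb := neg_one_lt_cos_pi_mul (hβ₀.trans_le hne) hβ₁
  have hc0 : 0 < c := by rw [hc]; linarith
  have hA0 : 0 < A := by positivity
  refine ⟨A / β₀ * (2 + 2 / β₀ + 1) + c⁻¹ ^ 2 * (4 + 2 / β₀), by positivity,
    fun β hβ β' hβ' L t x ht => ?_⟩
  have hder : ∀ b ∈ Icc β₀ β₁, HasDerivWithinAt
      (fun b => Real.exp (-(Real.exp (x + L / b) * t)) * mlKernel b x)
      (Real.exp (-(Real.exp (x + L / b) * t)) * (Real.exp (x + L / b) * t * (L / b ^ 2)) * mlKernel b x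
        + Real.exp (-(Real.exp (x + L / b) * t)) * mlKernelDeriv b x) (Icc β₀ β₁) b := by
    intro b hb
    have hb0 : 0 < b := hβ₀.trans_le hb.1
    have e1 : HasDerivAt (fun b : ℝ => x + L / b) (-(L / b ^ 2)) b := by
      have := ((hasDerivAt_inv hb0.ne').const_mul L).const_add x
      refine (this.congr_deriv (by ring)).congr_of_eventuallyEq (Eventually.of_forall fun y => ?_)
      simp only [div_eq_mul_inv]
    have e2 := ((e1.exp.mul_const t).fun_neg).exp.mul
      (hasDerivAt_mlKernel hb0 (hb.2.trans_lt hβ₁) x)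
    refine HasDerivAt.hasDerivWithinAt (e2.congr_deriv ?_)
    ring
  have hbound : ∀ b ∈ Icc β₀ β₁,
      ‖Real.exp (-(Real.exp (x + L / b) * t)) * (Real.exp (x + L / b) * t * (L / b ^ 2)) * mlKernel b x
        + Real.exp (-(Real.exp (x + L / b) * t)) * mlKernelDeriv b x‖ ≤
      (A / β₀ * (2 + 2 / β₀ + 1) + c⁻¹ ^ 2 * (4 + 2 / β₀)) * (1 + |Real.log t|)
        * Real.exp (-(β₀ / 2 * |x|)) := by
    intro b hb
    have hb0 : 0 < b := hβ₀.trans_le hb.1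
    -- The b-derivative contains L/b², which is unbounded in L. Expressed through the logarithm ξ of
    -- the exponent it is (ξ - x - log t)/b: the part ξ is controlled by e^ξ exp(-e^ξ), the part x
    -- by the density, and log t remains in the bound.
    set ξ := x + L / b + Real.log t with hξ
    have hexp : Real.exp (x + L / b) * t = Real.exp ξ := by
      rw [hξ, Real.exp_add _ (Real.log t), Real.exp_log ht]
    have hL : L / b ^ 2 = (ξ - x - Real.log t) / b := by
      rw [hξ]
      field_simp
      ring
    have hdec : Real.exp (-(b * |x|)) ≤ Real.exp (-(β₀ * |x|)) :=
      Real.exp_le_exp.2 (neg_le_neg (mul_le_mul_of_nonneg_right hb.1 (abs_nonneg x)))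
    have hk : mlKernel b x ≤ A * Real.exp (-(β₀ * |x|)) := by
      refine (mlKernel_le hb0 hb.2 hβ₁ x).trans ?_
      have : 2 / (1 + Real.cos (π * β₁)) = A := by
        rw [hA, hc]
        field_simp
      rw [this]
      gcongr
    have hk0 := (mlKernel_pos hb0 (hb.2.trans_lt hβ₁) x).le
    have hkd : |mlKernelDeriv b x| ≤ c⁻¹ ^ 2 * ((4 + |x|) * Real.exp (-(β₀ * |x|))) := by
      refine (abs_mlKernelDeriv_le hb0 hb.2 hβ₁ x).trans ?_
      gcongr
    have hξ1 := exp_mul_abs_mul_exp_neg_exp_le ξ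
    have hξ2 : Real.exp ξ * Real.exp (-Real.exp ξ) ≤ 1 := mul_exp_neg_le_one _
    have hξ3 : Real.exp (-Real.exp ξ) ≤ 1 := Real.exp_le_one_iff.2 (neg_nonpos.2 (exp_pos _).le)
    have hmain : |Real.exp (-Real.exp ξ) * (Real.exp ξ * ((ξ - x - Real.log t) / b))|
        ≤ (2 + |x| + |Real.log t|) / β₀ := by
      have e1 := exp_pos ξ
      have e2 := exp_pos (-Real.exp ξ)
      rw [abs_mul, abs_mul, abs_div, abs_of_pos e1, abs_of_pos e2, abs_of_pos hb0,
        ← mul_div_assoc, ← mul_div_assoc]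
      have h3 : |ξ - x - Real.log t| ≤ |ξ| + |x| + |Real.log t| :=
        (abs_sub _ _).trans (by gcongr; exact abs_sub _ _)
      have hX := abs_nonneg x
      have hT := abs_nonneg (Real.log t)
      refine div_le_div₀ (by positivity) ?_ hβ₀ hb.1
      calc Real.exp (-Real.exp ξ) * (Real.exp ξ * |ξ - x - Real.log t|)
          ≤ Real.exp (-Real.exp ξ) * (Real.exp ξ * (|ξ| + |x| + |Real.log t|)) := by gcongr
        _ = Real.exp ξ * |ξ| * Real.exp (-Real.exp ξ)
            + Real.exp ξ * Real.exp (-Real.exp ξ) * (|x| + |Real.log t|) := by ring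
        _ ≤ 2 + 1 * (|x| + |Real.log t|) := by gcongr
        _ = _ := by ring
    rw [hexp, hL]
    have hx1 := abs_mul_exp_neg_le hβ₀ x
    have hx2 : Real.exp (-(β₀ * |x|)) ≤ Real.exp (-(β₀ / 2 * |x|)) :=
      Real.exp_le_exp.2 (neg_le_neg (mul_le_mul_of_nonneg_right (by linarith) (abs_nonneg x)))
    set e := Real.exp (-(β₀ * |x|)) with he
    set e' := Real.exp (-(β₀ / 2 * |x|)) with he'
    have he0 : 0 < e := exp_pos _
    have he0' : 0 < e' := exp_pos _
    set ℓ := |Real.log t| with hℓ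
    have hℓ0 : 0 ≤ ℓ := abs_nonneg _
    have s1 : (2 + |x| + ℓ) * e ≤ (2 + 2 / β₀ + 1) * (1 + ℓ) * e' := by
      have : 0 ≤ 2 / β₀ := by positivity
      calc (2 + |x| + ℓ) * e = (2 + ℓ) * e + |x| * e := by ring
        _ ≤ (2 + ℓ) * e' + 2 / β₀ * e' := by gcongr
        _ = (2 + ℓ + 2 / β₀) * e' := by ring
        _ ≤ _ := by
          gcongr
          nlinarith [mul_nonneg this hℓ0]
    have s2 : (4 + |x|) * e ≤ (4 + 2 / β₀) * (1 + ℓ) * e' := by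
      have : 0 ≤ 2 / β₀ := by positivity
      calc (4 + |x|) * e = 4 * e + |x| * e := by ring
        _ ≤ 4 * e' + 2 / β₀ * e' := by gcongr
        _ = (4 + 2 / β₀) * 1 * e' := by ring
        _ ≤ _ := by
          gcongr
          linarith
    calc _ ≤ |Real.exp (-Real.exp ξ) * (Real.exp ξ * ((ξ - x - Real.log t) / b))| * |mlKernel b x|
          + |Real.exp (-Real.exp ξ)| * |mlKernelDeriv b x| := by
          rw [← abs_mul, ← abs_mul]
          exact abs_add_le _ _
      _ ≤ (2 + |x| + ℓ) / β₀ * (A * e) + 1 * (c⁻¹ ^ 2 * ((4 + |x|) * e)) := by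
          rw [abs_of_nonneg hk0, abs_of_pos (exp_pos (-Real.exp ξ))]
          gcongr
      _ = A / β₀ * ((2 + |x| + ℓ) * e) + c⁻¹ ^ 2 * ((4 + |x|) * e) := by ring
      _ ≤ A / β₀ * ((2 + 2 / β₀ + 1) * (1 + ℓ) * e') + c⁻¹ ^ 2 * ((4 + 2 / β₀) * (1 + ℓ) * e') := by
          gcongr
      _ = _ := by ring
  have := (convex_Icc β₀ β₁).norm_image_sub_le_of_norm_hasDerivWithin_le hder hbound hβ' hβ
  simpa only [Real.norm_eq_abs] using this

theorem exists_abs_mlFun_sub_order_le {β₀ β₁ : ℝ} (hβ₀ : 0 < β₀) (hβ₁ : β₁ < 1) :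
    ∃ C, 0 ≤ C ∧ ∀ β ∈ Icc β₀ β₁, ∀ β' ∈ Icc β₀ β₁, ∀ L t : ℝ, 0 < t →
      |mlFun β (Real.exp (L / β) * t) - mlFun β' (Real.exp (L / β') * t)|
      ≤ C * (1 + |Real.log t|) * |β - β'| := by
  obtain ⟨C, hC, h⟩ := abs_kernel_sub_le hβ₀ hβ₁
  set I := ∫ x : ℝ, Real.exp (-(β₀ / 2 * |x|)) with hI
  have hI0 : 0 ≤ I := integral_nonneg fun x => (exp_pos _).le
  refine ⟨C * I, by positivity, fun β hβ β' hβ' L t ht => ?_⟩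
  rw [mlFun_exp_mul, mlFun_exp_mul, ← integral_sub
    (integrable_shifted_kernel (hβ₀.trans_le hβ.1) (hβ.2.trans_lt hβ₁) L ht)
    (integrable_shifted_kernel (hβ₀.trans_le hβ'.1) (hβ'.2.trans_lt hβ₁) L ht)]
  have hint := ((integrable_exp_neg_mul_abs (half_pos hβ₀)).const_mul
    (C * (1 + |Real.log t|))).mul_const |β - β'|
  refine (norm_integral_le_of_norm_le hint (ae_of_all _ fun x =>
    (Real.norm_eq_abs _).trans_le (h β hβ β' hβ' L t x ht))).trans ?_
  rw [integral_mul_const, integral_const_mul, ← hI]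
  exact le_of_eq (by ring)

/-- With y = e^ξ: y^{1+δ} e^{-y} ≤ (y + y²) e^{-y} ≤ 1 + 2. -/
theorem exp_mul_exp_mul_exp_neg_exp_le {δ : ℝ} (h0 : 0 ≤ δ) (h1 : δ ≤ 1) (ξ : ℝ) :
    Real.exp ξ * Real.exp (-Real.exp ξ) ≤ 3 * Real.exp (-(δ * ξ)) := by
  have hp := exp_pos ξ
  have h2 : Real.exp (δ * ξ) ≤ 1 + Real.exp ξ := by
    rcases le_total 0 ξ with h | h
    · have : Real.exp (δ * ξ) ≤ Real.exp ξ := Real.exp_le_exp.2 (by nlinarith)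
      linarith
    · have : Real.exp (δ * ξ) ≤ 1 := Real.exp_le_one_iff.2 (mul_nonpos_of_nonneg_of_nonpos h0 h)
      linarith
  have h3 := mul_exp_neg_le_one (Real.exp ξ)
  have h4 := sq_mul_exp_neg_le hp.le
  rw [Real.exp_neg (δ * ξ), ← div_eq_mul_inv, le_div_iff₀ (exp_pos _)]
  have h5 := mul_pos hp (exp_pos (-Real.exp ξ))
  nlinarith

/-- Dependence on the logarithm `L` of the rate, which is large if `L ≥ m`. -/
theorem exists_abs_mlFun_sub_rate_le {β₀ β₁ : ℝ} (hβ₀ : 0 < β₀) (hβ₁ : β₁ < 1) :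
    ∃ C, 0 ≤ C ∧ ∀ β ∈ Icc β₀ β₁, ∀ m L L' t : ℝ, 0 < t → 0 ≤ m → m ≤ L → m ≤ L' →
      |mlFun β (Real.exp (L / β) * t) - mlFun β (Real.exp (L' / β) * t)|
      ≤ C * t ^ (-(β₀ / 4)) * Real.exp (-(β₀ / 4 * m)) * |L - L'| := by
  by_cases hne : β₀ ≤ β₁
  swap
  · exact ⟨0, le_rfl, fun β hβ => absurd (hβ.1.trans hβ.2) hne⟩
  have hcb := neg_one_lt_cos_pi_mul (hβ₀.trans_le hne) hβ₁
  set A := 2 / (1 + Real.cos (π * β₁)) with hA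
  have hA0 : 0 < A := div_pos two_pos (by linarith)
  set I := ∫ x : ℝ, Real.exp (-(β₀ / 2 * |x|)) with hI
  have hI0 : 0 ≤ I := integral_nonneg fun x => (exp_pos _).le
  refine ⟨3 / β₀ * A * I, by positivity, fun β hβ m L L' t ht hm hL hL' => ?_⟩
  have hβ0 : 0 < β := hβ₀.trans_le hβ.1
  have hβ1 : β < 1 := hβ.2.trans_lt hβ₁
  set K := t ^ (-(β₀ / 4)) * Real.exp (-(β₀ / 4 * m)) with hK
  have hK0 : 0 ≤ K := by positivity
  have hpt : ∀ x, ‖Real.exp (-(Real.exp (x + L / β) * t)) * mlKernel β x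
        - Real.exp (-(Real.exp (x + L' / β) * t)) * mlKernel β x‖
      ≤ 3 / β₀ * A * K * |L - L'| * Real.exp (-(β₀ / 2 * |x|)) := by
    intro x
    have hder : ∀ l ∈ Ici m, HasDerivWithinAt (fun l => Real.exp (-(Real.exp (x + l / β) * t)))
        (Real.exp (-(Real.exp (x + l / β) * t)) * -(Real.exp (x + l / β) * t / β)) (Ici m) l := by
      intro l _
      have e1 := (((hasDerivAt_id l).div_const β).const_add x).exp
      have e2 := ((e1.mul_const t).fun_neg).exp
      refine HasDerivAt.hasDerivWithinAt (e2.congr_deriv ?_)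
      simp only [id]
      ring
    have hbound : ∀ l ∈ Ici m,
        ‖Real.exp (-(Real.exp (x + l / β) * t)) * -(Real.exp (x + l / β) * t / β)‖
        ≤ 3 / β₀ * K * Real.exp (-(β₀ / 4 * x)) := by
      intro l hl
      have hl' : m ≤ l := hl
      have hexp : Real.exp (x + l / β) * t = Real.exp (x + l / β + Real.log t) := by
        rw [Real.exp_add _ (Real.log t), Real.exp_log ht]
      -- The exponent β₀/4 is small enough for e^{-β₀x/4} to be absorbed by the density and for
      -- t^{-β₀/4} to be square integrable, yet it still yields decay in m.
      have h3 := exp_mul_exp_mul_exp_neg_exp_le (δ := β₀ / 4) (by linarith) (by linarith)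
        (x + l / β + Real.log t)
      have hml : m ≤ l / β := by
        rw [le_div_iff₀ hβ0]
        nlinarith
      have h4 : Real.exp (-(β₀ / 4 * (x + l / β + Real.log t))) ≤ K * Real.exp (-(β₀ / 4 * x)) := by
        rw [hK, Real.rpow_def_of_pos ht, ← Real.exp_add, ← Real.exp_add]
        refine Real.exp_le_exp.2 ?_
        nlinarith
      rw [hexp, mul_neg, norm_neg, Real.norm_of_nonneg (by positivity)]
      calc Real.exp (-Real.exp (x + l / β + Real.log t)) * (Real.exp (x + l / β + Real.log t) / β)
          = Real.exp (x + l / β + Real.log t) * Real.exp (-Real.exp (x + l / β + Real.log t)) / β := by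
            ring
        _ ≤ 3 * (K * Real.exp (-(β₀ / 4 * x))) / β₀ := by
            refine div_le_div₀ (by positivity) (h3.trans (by gcongr)) hβ₀ hβ.1
        _ = _ := by ring
    have hmv := (convex_Ici m).norm_image_sub_le_of_norm_hasDerivWithin_le hder hbound
      (show L' ∈ Ici m from hL') (show L ∈ Ici m from hL)
    have hk : mlKernel β x ≤ A * Real.exp (-(β₀ * |x|)) := by
      refine (mlKernel_le hβ0 hβ.2 hβ₁ x).trans ?_
      gcongr
      exact hβ.1
    have hx : Real.exp (-(β₀ / 4 * x)) * Real.exp (-(β₀ * |x|)) ≤ Real.exp (-(β₀ / 2 * |x|)) := by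
      rw [← Real.exp_add]
      refine Real.exp_le_exp.2 ?_
      nlinarith [neg_abs_le x, abs_nonneg x]
    rw [← sub_mul, norm_mul, Real.norm_of_nonneg (mlKernel_pos hβ0 hβ1 x).le]
    rw [Real.norm_eq_abs (L - L')] at hmv
    calc _ ≤ 3 / β₀ * K * Real.exp (-(β₀ / 4 * x)) * |L - L'| * (A * Real.exp (-(β₀ * |x|))) := by
          have := (mlKernel_pos hβ0 hβ1 x).le
          gcongr
      _ = 3 / β₀ * A * K * |L - L'| * (Real.exp (-(β₀ / 4 * x)) * Real.exp (-(β₀ * |x|))) := by ring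
      _ ≤ _ := by gcongr
  rw [mlFun_exp_mul, mlFun_exp_mul, ← integral_sub (integrable_shifted_kernel hβ0 hβ1 L ht)
    (integrable_shifted_kernel hβ0 hβ1 L' ht)]
  have hint := (integrable_exp_neg_mul_abs (half_pos hβ₀)).const_mul (3 / β₀ * A * K * |L - L'|)
  refine (norm_integral_le_of_norm_le hint (ae_of_all _ hpt)).trans ?_
  rw [integral_const_mul, ← hI, hK]
  exact le_of_eq (by ring)

/-! ### The rates of the modes -/

theorem one_lt_lapEigenvalue (n : ℕ) : 1 < lapEigenvalue n := by
  unfold lapEigenvalue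
  have h : 1 < ((n : ℝ) + 1) * π / 2 := by
    have := pi_gt_three
    have : (0 : ℝ) ≤ n := Nat.cast_nonneg n
    nlinarith
  nlinarith

theorem log_lapEigenvalue_pos (n : ℕ) : 0 < Real.log (lapEigenvalue n) :=
  Real.log_pos (one_lt_lapEigenvalue n)

theorem fracEigenvalue_pos (α γ : ℝ) (n : ℕ) : 0 < fracEigenvalue α γ n := by
  have := zero_lt_one.trans (one_lt_lapEigenvalue n)
  exact add_pos (Real.rpow_pos_of_pos this _) (Real.rpow_pos_of_pos this _)

theorem le_log_fracEigenvalue {a α : ℝ} (h : a ≤ α) (γ : ℝ) (n : ℕ) :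
    a / 2 * Real.log (lapEigenvalue n) ≤ Real.log (fracEigenvalue α γ n) := by
  have h1 := zero_lt_one.trans (one_lt_lapEigenvalue n)
  have h2 := Real.rpow_pos_of_pos h1 (γ / 2)
  have h3 := (log_lapEigenvalue_pos n).le
  calc a / 2 * Real.log (lapEigenvalue n) ≤ α / 2 * Real.log (lapEigenvalue n) := by gcongr
    _ = Real.log (lapEigenvalue n ^ (α / 2)) := (Real.log_rpow h1 _).symm
    _ ≤ _ := Real.log_le_log (Real.rpow_pos_of_pos h1 _) (le_add_of_nonneg_right h2.le)

/-- As the Laplace eigenvalue λ exceeds 1, raising both exponents by at most D/2 multiplies the sum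
by at most λ^{D/2}. -/
theorem log_fracEigenvalue_le_add {α α' γ γ' D : ℝ} (hα : α ≤ α' + D) (hγ : γ ≤ γ' + D) (n : ℕ) :
    Real.log (fracEigenvalue α γ n) ≤
      Real.log (fracEigenvalue α' γ' n) + D / 2 * Real.log (lapEigenvalue n) := by
  have h1 := one_lt_lapEigenvalue n
  have h0 := zero_lt_one.trans h1
  have hD := Real.rpow_pos_of_pos h0 (D / 2)
  rw [← Real.log_rpow h0, ← Real.log_mul (fracEigenvalue_pos α' γ' n).ne' hD.ne']
  refine Real.log_le_log (fracEigenvalue_pos _ _ _) ?_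
  rw [fracEigenvalue, fracEigenvalue, add_mul, ← Real.rpow_add h0, ← Real.rpow_add h0]
  refine add_le_add ?_ ?_ <;> exact Real.rpow_le_rpow_of_exponent_le h1.le (by linarith)

theorem abs_log_fracEigenvalue_sub_le {α α' γ γ' D : ℝ} (hα : |α - α'| ≤ D) (hγ : |γ - γ'| ≤ D)
    (n : ℕ) : |Real.log (fracEigenvalue α γ n) - Real.log (fracEigenvalue α' γ' n)|
      ≤ D / 2 * Real.log (lapEigenvalue n) := by
  rw [abs_le] at hα hγ
  have h1 := log_fracEigenvalue_le_add (α := α) (α' := α') (γ := γ) (γ' := γ') (D := D)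
    (by linarith) (by linarith) n
  have h2 := log_fracEigenvalue_le_add (α := α') (α' := α) (γ := γ') (γ' := γ) (D := D)
    (by linarith) (by linarith) n
  exact abs_le.2 ⟨by linarith, by linarith⟩

/-- The time scale of a mode: its `β`-th power is the eigenvalue. -/
def modeRate (β α γ : ℝ) (n : ℕ) : ℝ := Real.exp (Real.log (fracEigenvalue α γ n) / β)

theorem modeRate_pos (β α γ : ℝ) (n : ℕ) : 0 < modeRate β α γ n := exp_pos _

theorem modeRate_rpow {β : ℝ} (h0 : 0 < β) (α γ : ℝ) (n : ℕ) :
    modeRate β α γ n ^ β = fracEigenvalue α γ n := by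
  rw [modeRate, ← Real.exp_mul, div_mul_cancel₀ _ h0.ne', Real.exp_log (fracEigenvalue_pos _ _ _)]

/-- The time factor of a mode. -/
def mode (β α γ : ℝ) (n : ℕ) (t : ℝ) : ℝ := mlFun β (modeRate β α γ n * t)

theorem one_add_abs_log_le {T δ : ℝ} (hT : 0 < T) (hδ : 0 < δ) :
    ∃ C, 0 ≤ C ∧ ∀ t ∈ Ioc 0 T, 1 + |Real.log t| ≤ C * t ^ (-δ) := by
  refine ⟨(1 + T) * T ^ δ + 1 / δ, by positivity, fun t ht => ?_⟩
  have h1 : 1 ≤ T ^ δ * t ^ (-δ) := by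
    rw [Real.rpow_neg ht.1.le, ← div_eq_mul_inv, one_le_div (Real.rpow_pos_of_pos ht.1 _)]
    exact Real.rpow_le_rpow ht.1.le ht.2 hδ.le
  have h2 : Real.log t ≤ T := (Real.log_le_self ht.1.le).trans ht.2
  have h3 : -Real.log t ≤ t ^ (-δ) / δ := by
    have := Real.log_le_rpow_div (inv_nonneg.2 ht.1.le) hδ
    rwa [Real.log_inv, Real.inv_rpow ht.1.le, ← Real.rpow_neg ht.1.le] at this
  have h4 : 0 ≤ t ^ (-δ) / δ := by
    have := ht.1.le
    positivity
  have h5 : |Real.log t| ≤ T + t ^ (-δ) / δ := abs_le.2 ⟨by linarith, by linarith⟩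
  calc 1 + |Real.log t| ≤ (1 + T) * 1 + t ^ (-δ) / δ := by linarith
    _ ≤ (1 + T) * (T ^ δ * t ^ (-δ)) + t ^ (-δ) / δ := by gcongr
    _ = _ := by ring

/-- The modes depend on the parameters in a Lipschitz way, uniformly in the mode. -/
theorem exists_abs_mode_sub_le {T β₀ β₁ α₀ : ℝ} (hT : 0 < T) (hβ₀ : 0 < β₀) (hβ₁ : β₁ < 1)
    (hα₀ : 0 < α₀) (α₁ γ₀ γ₁ : ℝ) :
    ∃ C, 0 ≤ C ∧ ∀ p ∈ paramBox β₀ β₁ α₀ α₁ γ₀ γ₁, ∀ q ∈ paramBox β₀ β₁ α₀ α₁ γ₀ γ₁, ∀ n : ℕ,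
      ∀ t ∈ Ioc 0 T, |mode p.1 p.2.1 p.2.2 n t - mode q.1 q.2.1 q.2.2 n t|
        ≤ C * t ^ (-(β₀ / 4)) * dist p q := by
  obtain ⟨C₁, hC₁, h₁⟩ := exists_abs_mlFun_sub_order_le hβ₀ hβ₁
  obtain ⟨C₂, hC₂, h₂⟩ := exists_abs_mlFun_sub_rate_le hβ₀ hβ₁
  obtain ⟨C₃, hC₃, h₃⟩ := one_add_abs_log_le hT (show 0 < β₀ / 4 by linarith)
  refine ⟨C₁ * C₃ + C₂ * (4 / (β₀ * α₀)), by positivity, ?_⟩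
  rintro ⟨β, α, γ⟩ ⟨hβ, hα, hγ⟩ ⟨β', α', γ'⟩ ⟨hβ', hα', hγ'⟩ n t ht
  simp only at hβ hα hγ hβ' hα' hγ' ⊢
  set D := dist (β, α, γ) (β', α', γ') with hD
  have hD0 : 0 ≤ D := dist_nonneg
  have hD1 : |β - β'| ≤ D := by
    rw [hD, Prod.dist_eq, ← Real.dist_eq]
    exact le_max_left _ _
  have hD2 : |α - α'| ≤ D := by
    rw [hD, Prod.dist_eq, Prod.dist_eq, ← Real.dist_eq]
    exact (le_max_left _ _).trans (le_max_right _ _)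
  have hD3 : |γ - γ'| ≤ D := by
    rw [hD, Prod.dist_eq, Prod.dist_eq, ← Real.dist_eq]
    exact (le_max_right _ _).trans (le_max_right _ _)
  set L := Real.log (fracEigenvalue α γ n) with hL
  set L' := Real.log (fracEigenvalue α' γ' n) with hL'
  set ℓ := Real.log (lapEigenvalue n) with hℓ
  have hℓ0 : 0 < ℓ := log_lapEigenvalue_pos n
  -- Two moves: first the order from β to β' at fixed L, then L to L' at the fixed order β'.
  have e1 := h₁ β hβ β' hβ' L t ht.1
  have e2 := h₂ β' hβ' (α₀ / 2 * ℓ) L L' t ht.1 (by positivity)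
    (le_log_fracEigenvalue hα.1 γ n) (le_log_fracEigenvalue hα'.1 γ' n)
  have e3 := h₃ t ht
  have e4 := abs_log_fracEigenvalue_sub_le hD2 hD3 n
  -- The loss ℓ from the log-eigenvalues is absorbed by the decay with m = α₀ℓ/2, which makes the
  -- constant independent of the mode. This uses α₀ > 0.
  have e5 : ℓ * Real.exp (-(β₀ / 4 * (α₀ / 2 * ℓ))) ≤ 8 / (β₀ * α₀) := by
    have := mul_exp_neg_le_one (β₀ / 4 * (α₀ / 2 * ℓ))
    rw [le_div_iff₀ (by positivity)]
    linarith
  have hw : 0 ≤ t ^ (-(β₀ / 4)) := Real.rpow_nonneg ht.1.le _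
  have f1 : |mlFun β (Real.exp (L / β) * t) - mlFun β' (Real.exp (L / β') * t)|
      ≤ C₁ * C₃ * t ^ (-(β₀ / 4)) * D := by
    refine e1.trans ?_
    calc C₁ * (1 + |Real.log t|) * |β - β'| ≤ C₁ * (C₃ * t ^ (-(β₀ / 4))) * D := by gcongr
      _ = _ := by ring
  have f2 : |mlFun β' (Real.exp (L / β') * t) - mlFun β' (Real.exp (L' / β') * t)|
      ≤ C₂ * (4 / (β₀ * α₀)) * t ^ (-(β₀ / 4)) * D := by
    refine e2.trans ?_
    calc C₂ * t ^ (-(β₀ / 4)) * Real.exp (-(β₀ / 4 * (α₀ / 2 * ℓ))) * |L - L'|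
        ≤ C₂ * t ^ (-(β₀ / 4)) * Real.exp (-(β₀ / 4 * (α₀ / 2 * ℓ))) * (D / 2 * ℓ) := by gcongr
      _ = C₂ * t ^ (-(β₀ / 4)) * (D / 2) * (ℓ * Real.exp (-(β₀ / 4 * (α₀ / 2 * ℓ)))) := by ring
      _ ≤ C₂ * t ^ (-(β₀ / 4)) * (D / 2) * (8 / (β₀ * α₀)) := by gcongr
      _ = _ := by ring
  calc |mode β α γ n t - mode β' α' γ' n t|
      ≤ |mlFun β (Real.exp (L / β) * t) - mlFun β' (Real.exp (L / β') * t)|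
        + |mlFun β' (Real.exp (L / β') * t) - mlFun β' (Real.exp (L' / β') * t)| :=
        abs_sub_le _ _ _
    _ ≤ _ := add_le_add f1 f2
    _ = _ := by ring

theorem abs_mode_le_one {β t : ℝ} (h0 : 0 < β) (h1 : β < 1) (α γ : ℝ) (n : ℕ) (ht : 0 ≤ t) :
    |mode β α γ n t| ≤ 1 := by
  rw [mode, abs_of_nonneg (mlFun_nonneg h0 h1 _)]
  exact mlFun_le_one h0 h1 (mul_nonneg (modeRate_pos _ _ _ _).le ht)

theorem mode_zero {β : ℝ} (h0 : 0 < β) (h1 : β < 1) (α γ : ℝ) (n : ℕ) : mode β α γ n 0 = 1 := by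
  rw [mode, mul_zero, mlFun_zero h0 h1]

theorem continuousOn_mode {β : ℝ} (h0 : 0 < β) (h1 : β < 1) (α γ : ℝ) (n : ℕ) :
    ContinuousOn (mode β α γ n) (Ici 0) :=
  (continuousOn_mlFun h0 h1).comp (by fun_prop) fun _ ht =>
    mul_nonneg (modeRate_pos _ _ _ _).le ht

/-- Minus the time derivative of a mode. -/
def modeDecay (β α γ : ℝ) (n : ℕ) (t : ℝ) : ℝ :=
  modeRate β α γ n * mlRate β (modeRate β α γ n * t)

theorem modeDecay_nonneg {β : ℝ} (h0 : 0 < β) (h1 : β < 1) (α γ : ℝ) (n : ℕ) (t : ℝ) :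
    0 ≤ modeDecay β α γ n t :=
  mul_nonneg (modeRate_pos _ _ _ _).le (mlRate_nonneg h0 h1 _)

/-- By scaling the rate cancels, so the bound does not depend on n and allows differentiating the
series term by term. -/
theorem modeDecay_le {β t : ℝ} (h0 : 0 < β) (h1 : β < 1) (α γ : ℝ) (n : ℕ) (ht : 0 < t) :
    modeDecay β α γ n t ≤ t⁻¹ := by
  have hc := modeRate_pos β α γ n
  calc modeDecay β α γ n t ≤ modeRate β α γ n * (modeRate β α γ n * t)⁻¹ := by
        unfold modeDecay
        gcongr
        exact mlRate_le_inv h0 h1 (mul_pos hc ht)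
    _ = _ := by field_simp

theorem hasDerivAt_mode {β t : ℝ} (h0 : 0 < β) (h1 : β < 1) (α γ : ℝ) (n : ℕ) (ht : 0 < t) :
    HasDerivAt (mode β α γ n) (-modeDecay β α γ n t) t := by
  have hc := modeRate_pos β α γ n
  have h := (hasDerivAt_mlFun h0 h1 (mul_pos hc ht)).comp t
    ((hasDerivAt_id t).const_mul (modeRate β α γ n))
  refine h.congr_deriv ?_
  rw [modeDecay]
  ring

theorem continuousOn_modeDecay {β : ℝ} (h0 : 0 < β) (h1 : β < 1) (α γ : ℝ) (n : ℕ) :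
    ContinuousOn (modeDecay β α γ n) (Ioi 0) :=
  continuousOn_const.mul ((continuousOn_mlRate h0 h1).comp (by fun_prop) fun _ ht =>
    mul_pos (modeRate_pos _ _ _ _) ht)

theorem caputo_mode {β t : ℝ} (h0 : 0 < β) (h1 : β < 1) (α γ : ℝ) (n : ℕ) (ht : 0 < t) :
    IntervalIntegrable (fun s => (t - s) ^ (-β) * modeDecay β α γ n s) volume 0 t ∧
    ∫ s in (0 : ℝ)..t, (t - s) ^ (-β) * modeDecay β α γ n s
      = Real.Gamma (1 - β) * (fracEigenvalue α γ n * mode β α γ n t) := by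
  have := caputo_mlFun_scaled h0 h1 (modeRate_pos β α γ n) ht
  rwa [modeRate_rpow h0] at this

/-- The decay of order β of `mlFun` cancels the eigenvalue, the β-th power of the mode rate. This
smoothing puts the curve in the domain of the operator for t > 0. -/
theorem exists_fracEigenvalue_mul_mode_le {β : ℝ} (h0 : 0 < β) (h1 : β < 1) (α γ : ℝ) :
    ∃ C, 0 ≤ C ∧ ∀ n t, 0 < t → fracEigenvalue α γ n * mode β α γ n t ≤ C * t ^ (-β) := by
  obtain ⟨C, hC, h⟩ := exists_mlFun_le h0 h1
  refine ⟨C, hC, fun n t ht => ?_⟩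
  have hc := modeRate_pos β α γ n
  have hμ := fracEigenvalue_pos α γ n
  have := h _ (mul_pos hc ht)
  rw [Real.mul_rpow hc.le ht.le, Real.rpow_neg hc.le, modeRate_rpow h0] at this
  calc fracEigenvalue α γ n * mode β α γ n t
      ≤ fracEigenvalue α γ n * (C * ((fracEigenvalue α γ n)⁻¹ * t ^ (-β))) := by
        gcongr
        exact this
    _ = _ := by field_simp

/-! ### The solution -/

theorem integrable_tsum_of_summable_integral_norm {ι X E : Type*} [Countable ι] [MeasurableSpace X]
    {μ : Measure X} [NormedAddCommGroup E] {F : ι → X → E} (hF : ∀ i, Integrable (F i) μ)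
    (hs : Summable fun i => ∫ a, ‖F i a‖ ∂μ)
    (hm : AEStronglyMeasurable (fun a => ∑' i, F i a) μ) : Integrable (fun a => ∑' i, F i a) μ := by
  refine ⟨hm, ?_⟩
  calc ∫⁻ a, ‖∑' i, F i a‖ₑ ∂μ ≤ ∫⁻ a, ∑' i, ‖F i a‖ₑ ∂μ :=
        lintegral_mono fun a => enorm_tsum_le_tsum_enorm
    _ = ∑' i, ∫⁻ a, ‖F i a‖ₑ ∂μ := lintegral_tsum fun i => (hF i).1.enorm
    _ = ∑' i, ENNReal.ofReal (∫ a, ‖F i a‖ ∂μ) := by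
        congr 1
        funext i
        rw [ofReal_integral_norm_eq_lintegral_enorm (hF i)]
    _ < ⊤ := hs.tsum_ofReal_lt_top

theorem norm_smul_eigenVec (c : ℝ) (n : ℕ) : ‖c • eigenVec n‖ = |c| := by
  rw [norm_smul, norm_eigenVec, mul_one, Real.norm_eq_abs]

theorem continuousOn_tsum_smul_eigenVec {c : ℕ → ℝ → ℝ} (hc : ∀ n, ContinuousOn (c n) (Ioi 0))
    (hb : ∀ a : ℝ, 0 < a → ∃ u : ℕ → ℝ, Summable u ∧ ∀ n t, a < t → |c n t| ≤ u n) :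
    ContinuousOn (fun t => ∑' n, c n t • eigenVec n) (Ioi 0) := by
  intro t ht
  have ht' : 0 < t := ht
  obtain ⟨u, hu, hle⟩ := hb (t / 2) (half_pos ht')
  have h : ContinuousOn (fun t => ∑' n, c n t • eigenVec n) (Ioi (t / 2)) := by
    refine continuousOn_tsum (fun n => ?_) hu fun n s hs => ?_
    · exact ((hc n).mono (Ioi_subset_Ioi (half_pos ht').le)).smul continuousOn_const
    · rw [norm_smul_eigenVec]
      exact hle n s hs
  exact (h.continuousAt (Ioi_mem_nhds (half_lt_self ht'))).continuousWithinAt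

/-- The curve `t ↦ ∑ ⟨f, ψₙ⟩ E_β(-μₙ t ^ β) ψₙ`. -/
def solCurve (β α γ : ℝ) (f : L2D) (t : ℝ) : L2D :=
  ∑' n, (coeff f n * mode β α γ n t) • eigenVec n

/-- The time derivative of `solCurve`. -/
def solVelocity (β α γ : ℝ) (f : L2D) (t : ℝ) : L2D :=
  ∑' n, (coeff f n * -modeDecay β α γ n t) • eigenVec n

/-- The values of `solCurve`. -/
def solFun (β α γ : ℝ) (f : L2D) (t x : ℝ) : ℝ :=
  ∑' n, coeff f n * mode β α γ n t * eigenFun n x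

section

variable {β α γ : ℝ} {f : L2D}

theorem abs_coeff_mul_mode_le (h0 : 0 < β) (h1 : β < 1) (n : ℕ) {t : ℝ} (ht : 0 ≤ t) :
    |coeff f n * mode β α γ n t| ≤ |coeff f n| := by
  rw [abs_mul]
  exact mul_le_of_le_one_right (abs_nonneg _) (abs_mode_le_one h0 h1 α γ n ht)

theorem summable_coeff_mul_mode (h0 : 0 < β) (h1 : β < 1) (hf : Summable fun n => |coeff f n|)
    {t : ℝ} (ht : 0 ≤ t) : Summable fun n => |coeff f n * mode β α γ n t| :=
  hf.of_nonneg_of_le (fun _ => abs_nonneg _) fun n => abs_coeff_mul_mode_le h0 h1 n ht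

theorem summable_smul_eigenVec_of_abs {c : ℕ → ℝ} (h : Summable fun n => |c n|) :
    Summable fun n => c n • eigenVec n :=
  h.of_norm_bounded fun _ => (norm_smul_eigenVec _ _).le

theorem coeff_solCurve (h0 : 0 < β) (h1 : β < 1) (hf : Summable fun n => |coeff f n|)
    {t : ℝ} (ht : 0 ≤ t) (n : ℕ) : coeff (solCurve β α γ f t) n = coeff f n * mode β α γ n t :=
  coeff_of_hasSum (summable_smul_eigenVec_of_abs (summable_coeff_mul_mode h0 h1 hf ht)).hasSum n

theorem solCurve_zero (h0 : 0 < β) (h1 : β < 1) : solCurve β α γ f 0 = f := by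
  unfold solCurve
  simp_rw [mode_zero h0 h1, mul_one]
  exact (hasSum_coeff f).tsum_eq

theorem continuousOn_solCurve (h0 : 0 < β) (h1 : β < 1) (hf : Summable fun n => |coeff f n|) :
    ContinuousOn (solCurve β α γ f) (Ici 0) := by
  refine continuousOn_tsum (fun n => ?_) hf fun n t ht => ?_
  · exact (continuousOn_const.mul (continuousOn_mode h0 h1 α γ n)).smul continuousOn_const
  · rw [norm_smul_eigenVec]
    exact abs_coeff_mul_mode_le h0 h1 n ht

theorem summable_sq_coeff (v : L2D) : Summable fun n => coeff v n ^ 2 := by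
  have := orthonormal_eigenVec.inner_products_summable v
  simpa [coeff] using this

theorem memHdot_solCurve (h0 : 0 < β) (h1 : β < 1) (hf : Summable fun n => |coeff f n|)
    {t : ℝ} (ht : 0 < t) : MemHdot α γ (solCurve β α γ f t) := by
  obtain ⟨C, hC, h⟩ := exists_fracEigenvalue_mul_mode_le h0 h1 α γ
  refine ((summable_sq_coeff f).mul_left ((C * t ^ (-β)) ^ 2)).of_nonneg_of_le
    (fun n => by positivity) fun n => ?_
  rw [coeff_solCurve h0 h1 hf ht.le]
  have hp : 0 ≤ fracEigenvalue α γ n * mode β α γ n t :=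
    mul_nonneg (fracEigenvalue_pos _ _ _).le (mlFun_nonneg h0 h1 _)
  calc _ = (fracEigenvalue α γ n * mode β α γ n t) ^ 2 * coeff f n ^ 2 := by ring
    _ ≤ _ := mul_le_mul_of_nonneg_right (pow_le_pow_left₀ hp (h n t ht) 2) (sq_nonneg _)

theorem abs_frac_mul_coeff_mode_le {C : ℝ} (h0 : 0 < β) (h1 : β < 1)
    (h : ∀ n t, 0 < t → fracEigenvalue α γ n * mode β α γ n t ≤ C * t ^ (-β)) (n : ℕ)
    {t : ℝ} (ht : 0 < t) :
    |fracEigenvalue α γ n * (coeff f n * mode β α γ n t)| ≤ C * t ^ (-β) * |coeff f n| := by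
  have hp : 0 ≤ fracEigenvalue α γ n * mode β α γ n t :=
    mul_nonneg (fracEigenvalue_pos _ _ _).le (mlFun_nonneg h0 h1 _)
  rw [show fracEigenvalue α γ n * (coeff f n * mode β α γ n t)
    = fracEigenvalue α γ n * mode β α γ n t * coeff f n by ring, abs_mul, abs_of_nonneg hp]
  exact mul_le_mul_of_nonneg_right (h n t ht) (abs_nonneg _)

theorem fracOp_solCurve (h0 : 0 < β) (h1 : β < 1) (hf : Summable fun n => |coeff f n|)
    {t : ℝ} (ht : 0 ≤ t) : fracOp α γ (solCurve β α γ f t) =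
      -∑' n, (fracEigenvalue α γ n * (coeff f n * mode β α γ n t)) • eigenVec n := by
  unfold fracOp
  simp_rw [coeff_solCurve h0 h1 hf ht]

theorem continuousOn_fracOp_solCurve (h0 : 0 < β) (h1 : β < 1)
    (hf : Summable fun n => |coeff f n|) :
    ContinuousOn (fun t => fracOp α γ (solCurve β α γ f t)) (Ioi 0) := by
  obtain ⟨C, hC, h⟩ := exists_fracEigenvalue_mul_mode_le h0 h1 α γ
  refine ContinuousOn.congr (ContinuousOn.neg (continuousOn_tsum_smul_eigenVec
    (c := fun n t => fracEigenvalue α γ n * (coeff f n * mode β α γ n t)) (fun n => ?_)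
    fun a ha => ⟨fun n => C * a ^ (-β) * |coeff f n|, hf.mul_left _, fun n t ht => ?_⟩))
    fun t ht => fracOp_solCurve h0 h1 hf (le_of_lt ht)
  · exact continuousOn_const.mul (continuousOn_const.mul
      ((continuousOn_mode h0 h1 α γ n).mono Ioi_subset_Ici_self))
  · refine (abs_frac_mul_coeff_mode_le h0 h1 h n (ha.trans ht)).trans ?_
    have : t ^ (-β) ≤ a ^ (-β) := Real.rpow_le_rpow_of_nonpos ha ht.le (by linarith)
    exact mul_le_mul_of_nonneg_right (mul_le_mul_of_nonneg_left this hC) (abs_nonneg _)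

theorem abs_coeff_mul_modeDecay_le (h0 : 0 < β) (h1 : β < 1) (n : ℕ) {a t : ℝ} (ha : 0 < a)
    (ht : a < t) : |coeff f n * -modeDecay β α γ n t| ≤ |coeff f n| * a⁻¹ := by
  rw [abs_mul, abs_neg, abs_of_nonneg (modeDecay_nonneg h0 h1 α γ n t)]
  gcongr
  exact (modeDecay_le h0 h1 α γ n (ha.trans ht)).trans (inv_anti₀ ha ht.le)

theorem continuousOn_solVelocity (h0 : 0 < β) (h1 : β < 1) (hf : Summable fun n => |coeff f n|) :
    ContinuousOn (solVelocity β α γ f) (Ioi 0) :=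
  continuousOn_tsum_smul_eigenVec
    (fun n => continuousOn_const.mul (continuousOn_modeDecay h0 h1 α γ n).neg)
    fun a ha => ⟨fun n => |coeff f n| * a⁻¹, hf.mul_right _, fun n _ ht =>
      abs_coeff_mul_modeDecay_le h0 h1 n ha ht⟩

theorem hasDerivAt_solCurve (h0 : 0 < β) (h1 : β < 1) (hf : Summable fun n => |coeff f n|)
    {t : ℝ} (ht : 0 < t) : HasDerivAt (solCurve β α γ f) (solVelocity β α γ f t) t := by
  refine hasDerivAt_tsum_of_isPreconnected (t := Ioi (t / 2)) (y₀ := t)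
    (g := fun n t => (coeff f n * mode β α γ n t) • eigenVec n)
    (g' := fun n t => (coeff f n * -modeDecay β α γ n t) • eigenVec n)
    (hf.mul_right (t / 2)⁻¹) isOpen_Ioi isPreconnected_Ioi (fun n s hs => ?_) (fun n s hs => ?_)
    (half_lt_self ht) (summable_smul_eigenVec_of_abs (summable_coeff_mul_mode h0 h1 hf ht.le))
    (half_lt_self ht)
  · exact ((hasDerivAt_mode h0 h1 α γ n ((half_pos ht).trans hs)).const_mul _).smul_const _
  · rw [norm_smul_eigenVec]
    exact abs_coeff_mul_modeDecay_le h0 h1 n (half_pos ht) hs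

theorem caputo_solCurve (h0 : 0 < β) (h1 : β < 1) (hf : Summable fun n => |coeff f n|)
    {t : ℝ} (ht : 0 < t) :
    IntervalIntegrable (fun s => (t - s) ^ (-β) • deriv (solCurve β α γ f) s) volume 0 t ∧
    caputo β (solCurve β α γ f) t = fracOp α γ (solCurve β α γ f t) := by
  have hΓ := Real.Gamma_pos_of_pos (show 0 < 1 - β by linarith)
  obtain ⟨C, hC, h⟩ := exists_fracEigenvalue_mul_mode_le h0 h1 α γ
  -- The minus sign goes to the coefficient, so the scalar factor is nonnegative on (0, t) and the
  -- integral of the norm is again a Caputo integral of a mode, known in closed form. The sum of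
  -- these is finite by smoothing, which justifies exchanging sum and integral.
  set F : ℕ → ℝ → L2D := fun n s =>
    ((t - s) ^ (-β) * modeDecay β α γ n s) • (-coeff f n) • eigenVec n with hF
  have hcap := fun n => caputo_mode h0 h1 α γ n ht
  have hi : ∀ n, Integrable (F n) (volume.restrict (Ioo 0 t)) := by
    intro n
    have := (hcap n).1
    rw [intervalIntegrable_iff_integrableOn_Ioo_of_le ht.le] at this
    exact Integrable.smul_const this _
  have hv : ∀ n, ∫ s in Ioo 0 t, (t - s) ^ (-β) * modeDecay β α γ n s
      = Real.Gamma (1 - β) * (fracEigenvalue α γ n * mode β α γ n t) := by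
    intro n
    rw [← (hcap n).2, intervalIntegral.integral_of_le ht.le, integral_Ioc_eq_integral_Ioo]
  have hnorm : ∀ n, ∫ s in Ioo 0 t, ‖F n s‖
      = Real.Gamma (1 - β) * |fracEigenvalue α γ n * (coeff f n * mode β α γ n t)| := by
    intro n
    have : ∀ s ∈ Ioo 0 t, ‖F n s‖ = ((t - s) ^ (-β) * modeDecay β α γ n s) * |coeff f n| := by
      intro s hs
      rw [hF, norm_smul, norm_smul_eigenVec, abs_neg, Real.norm_of_nonneg
        (mul_nonneg (Real.rpow_nonneg (by linarith [hs.2]) _) (modeDecay_nonneg h0 h1 α γ n s))]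
    rw [setIntegral_congr_fun measurableSet_Ioo this, integral_mul_const, hv, abs_mul, abs_mul,
      abs_of_pos (fracEigenvalue_pos α γ n), mode, abs_of_nonneg (mlFun_nonneg h0 h1 _)]
    ring
  have hsum : Summable fun n => ∫ s in Ioo 0 t, ‖F n s‖ := by
    simp_rw [hnorm]
    exact Summable.mul_left _ ((hf.mul_left (C * t ^ (-β))).of_nonneg_of_le
      (fun _ => abs_nonneg _) fun n => abs_frac_mul_coeff_mode_le h0 h1 h n ht)
  have hderiv : EqOn (fun s => ∑' n, F n s) (fun s => (t - s) ^ (-β) • deriv (solCurve β α γ f) s)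
      (Ioo 0 t) := by
    intro s hs
    simp only
    rw [(hasDerivAt_solCurve h0 h1 hf hs.1).deriv, solVelocity, ← Summable.tsum_const_smul]
    · refine tsum_congr fun n => ?_
      simp only [hF, smul_smul]
      congr 1
      ring
    · refine summable_smul_eigenVec_of_abs ((hf.mul_right (s / 2)⁻¹).of_nonneg_of_le
        (fun _ => abs_nonneg _) fun n =>
          abs_coeff_mul_modeDecay_le h0 h1 n (half_pos hs.1) (half_lt_self hs.1))
  have hmeas : AEStronglyMeasurable (fun s => ∑' n, F n s) (volume.restrict (Ioo 0 t)) := by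
    have hc : ContinuousOn (fun s => (t - s) ^ (-β) • solVelocity β α γ f s) (Ioo 0 t) := by
      refine ContinuousOn.smul (ContinuousOn.rpow_const (by fun_prop) fun s hs => Or.inl ?_)
        ((continuousOn_solVelocity h0 h1 hf).mono Ioo_subset_Ioi_self)
      exact (sub_pos.2 hs.2).ne'
    refine (hc.aestronglyMeasurable measurableSet_Ioo).congr ?_
    filter_upwards [ae_restrict_mem measurableSet_Ioo] with s hs
    rw [← (hasDerivAt_solCurve h0 h1 hf hs.1).deriv]
    exact (hderiv hs).symm
  have hint := integrable_tsum_of_summable_integral_norm hi hsum hmeas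
  have hval := hasSum_integral_of_summable_integral_norm hi hsum
  refine ⟨?_, ?_⟩
  · rw [intervalIntegrable_iff_integrableOn_Ioo_of_le ht.le]
    exact IntegrableOn.congr_fun hint hderiv measurableSet_Ioo
  · rw [caputo, intervalIntegral.integral_of_le ht.le, integral_Ioc_eq_integral_Ioo,
      ← setIntegral_congr_fun measurableSet_Ioo hderiv, ← hval.tsum_eq,
      ← hval.summable.tsum_const_smul, fracOp_solCurve h0 h1 hf ht.le, ← tsum_neg]
    refine tsum_congr fun n => ?_
    simp only [hF]
    rw [integral_smul_const, hv, smul_smul, smul_smul, ← neg_smul]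
    congr 1
    field_simp

theorem isSolutionCurve_solCurve (h0 : 0 < β) (h1 : β < 1) (hf : Summable fun n => |coeff f n|)
    (T : ℝ) : IsSolutionCurve T β α γ f (solCurve β α γ f) where
  initial := solCurve_zero h0 h1
  continuousOn := (continuousOn_solCurve h0 h1 hf).mono Icc_subset_Ici_self
  memHdot _ ht := memHdot_solCurve h0 h1 hf ht.1
  continuousOn_fracOp := (continuousOn_fracOp_solCurve h0 h1 hf).mono Ioc_subset_Ioi_self
  hasCaputo :=
    { differentiableAt := fun _ hs => (hasDerivAt_solCurve h0 h1 hf hs.1).differentiableAt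
      intervalIntegrable := fun _ ht => (caputo_solCurve h0 h1 hf ht.1).1 }
  equation _ ht := (caputo_solCurve h0 h1 hf ht.1).2

theorem coeFn_solCurve (h0 : 0 < β) (h1 : β < 1) (hf : Summable fun n => |coeff f n|)
    {t : ℝ} (ht : 0 ≤ t) : ⇑(solCurve β α γ f t) =ᵐ[volD] solFun β α γ f t :=
  coeFn_tsum_eigenVec (summable_coeff_mul_mode h0 h1 hf ht)

theorem abs_coeff_mul_mode_mul_eigenFun_le (h0 : 0 < β) (h1 : β < 1) (n : ℕ) {t : ℝ} (ht : 0 ≤ t)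
    (x : ℝ) : |coeff f n * mode β α γ n t * eigenFun n x| ≤ |coeff f n| := by
  rw [abs_mul]
  exact (mul_le_of_le_one_right (abs_nonneg _) (abs_eigenFun_le_one n x)).trans
    (abs_coeff_mul_mode_le h0 h1 n ht)

theorem continuousOn_solFun_time (h0 : 0 < β) (h1 : β < 1) (hf : Summable fun n => |coeff f n|)
    (x : ℝ) : ContinuousOn (fun t => solFun β α γ f t x) (Ici 0) :=
  continuousOn_tsum
    (fun n => (continuousOn_const.mul (continuousOn_mode h0 h1 α γ n)).mul continuousOn_const) hf
    fun n _ ht => abs_coeff_mul_mode_mul_eigenFun_le h0 h1 n ht x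

theorem isWeakSolution_solFun (h0 : 0 < β) (h1 : β < 1) (hf : Summable fun n => |coeff f n|)
    (T : ℝ) : IsWeakSolution T β α γ f (solFun β α γ f) where
  continuousOn _ ht :=
    (continuous_tsum_eigenFun (summable_coeff_mul_mode h0 h1 hf ht.1.le)).continuousOn
  boundary _ _ := by simp [solFun, eigenFun_neg_one, eigenFun_one]
  initial := by
    have h := coeFn_solCurve (α := α) (γ := γ) h0 h1 hf le_rfl
    rw [solCurve_zero h0 h1] at h
    filter_upwards [h] with x hx
    rw [hx]
    exact ((continuousOn_solFun_time h0 h1 hf x) 0 self_mem_Ici).mono_left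
      (nhdsWithin_mono _ Ioi_subset_Ici_self)
  curve := ⟨solCurve β α γ f, fun _ ht => coeFn_solCurve h0 h1 hf ht.1.le,
    isSolutionCurve_solCurve h0 h1 hf T⟩

/-! ### Uniqueness -/

theorem coeff_fracOp {v : L2D} (hv : MemHdot α γ v) (n : ℕ) :
    coeff (fracOp α γ v) n = -(fracEigenvalue α γ n * coeff v n) := by
  have hs := summable_smul_eigenVec (c := fun n => fracEigenvalue α γ n * coeff v n) (by
    simp_rw [mul_pow]
    exact hv)
  have := coeff_of_hasSum hs.hasSum n
  rw [fracOp, coeff, inner_neg_right]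
  exact congrArg Neg.neg this

/-- Taking a coefficient is a continuous linear functional, so it commutes with the derivative and
the Caputo integral. The difference from the expected mode then solves a scalar equation with zero
initial value. -/
theorem coeff_of_isSolutionCurve {T : ℝ} (hT : 0 < T) (h0 : 0 < β) (h1 : β < 1) {U : ℝ → L2D}
    (hU : IsSolutionCurve T β α γ f U) (n : ℕ) :
    ∀ t ∈ Icc 0 T, coeff (U t) n = coeff f n * mode β α γ n t := by
  have hΓ := Real.Gamma_pos_of_pos (show 0 < 1 - β by linarith)
  have hcoe : ∀ v, innerSL ℝ (eigenVec n) v = coeff v n := fun v => rfl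
  set w : ℝ → ℝ := fun t => coeff (U t) n - coeff f n * mode β α γ n t with hw
  have hderiv : ∀ s ∈ Ioo 0 T,
      HasDerivAt w (coeff (deriv U s) n + coeff f n * modeDecay β α γ n s) s := by
    intro s hs
    have e1 := (innerSL ℝ (eigenVec n)).hasFDerivAt.comp_hasDerivAt s
      (hU.hasCaputo.differentiableAt s hs).hasDerivAt
    have e2 := (hasDerivAt_mode h0 h1 α γ n hs.1).const_mul (coeff f n)
    refine (e1.sub e2).congr_deriv ?_
    rw [hcoe]
    ring
  -- The scalar uniqueness result uses the integral without its normalisation, so Γ(1-β) joins the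
  -- eigenvalue in the rate.
  have hcap : ∀ t ∈ Ioc 0 T,
      IntervalIntegrable (fun s => (t - s) ^ (-β) * deriv w s) volume 0 t ∧
      ∫ s in (0 : ℝ)..t, (t - s) ^ (-β) * deriv w s
        = -(Real.Gamma (1 - β) * fracEigenvalue α γ n) * w t := by
    intro t ht
    have hi := hU.hasCaputo.intervalIntegrable t ht
    obtain ⟨hm, hmv⟩ := caputo_mode h0 h1 α γ n ht.1
    have hiL : IntervalIntegrable
        (fun s => innerSL ℝ (eigenVec n) ((t - s) ^ (-β) • deriv U s)) volume 0 t :=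
      ⟨(innerSL ℝ (eigenVec n)).integrable_comp hi.1, (innerSL ℝ (eigenVec n)).integrable_comp hi.2⟩
    have hcong : EqOn (fun s => innerSL ℝ (eigenVec n) ((t - s) ^ (-β) • deriv U s)
        + coeff f n * ((t - s) ^ (-β) * modeDecay β α γ n s))
        (fun s => (t - s) ^ (-β) * deriv w s) (Ioo 0 t) := by
      intro s hs
      simp only
      rw [(hderiv s ⟨hs.1, hs.2.trans_le ht.2⟩).deriv, map_smul, hcoe, smul_eq_mul]
      ring
    have hadd := hiL.add (hm.const_mul (coeff f n))
    refine ⟨?_, ?_⟩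
    · rw [intervalIntegrable_iff_integrableOn_Ioo_of_le ht.1.le] at hadd ⊢
      exact hadd.congr_fun hcong measurableSet_Ioo
    · have heq := hU.equation t ht
      have hI : ∫ s in (0 : ℝ)..t, (t - s) ^ (-β) • deriv U s
          = Real.Gamma (1 - β) • fracOp α γ (U t) := by
        rw [← heq, caputo, smul_smul, mul_inv_cancel₀ hΓ.ne', one_smul]
      have hv : ∫ s in (0 : ℝ)..t, (t - s) ^ (-β) * deriv w s =
          ∫ s in (0 : ℝ)..t, (innerSL ℝ (eigenVec n) ((t - s) ^ (-β) • deriv U s)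
            + coeff f n * ((t - s) ^ (-β) * modeDecay β α γ n s)) := by
        rw [intervalIntegral.integral_of_le ht.1.le, intervalIntegral.integral_of_le ht.1.le,
          integral_Ioc_eq_integral_Ioo, integral_Ioc_eq_integral_Ioo]
        exact (setIntegral_congr_fun measurableSet_Ioo hcong).symm
      rw [hv, intervalIntegral.integral_add hiL (hm.const_mul _),
        ContinuousLinearMap.intervalIntegral_comp_comm _ hi, hI, map_smul, hcoe,
        coeff_fracOp (hU.memHdot t ht), intervalIntegral.integral_const_mul, hmv, smul_eq_mul, hw]
      ring
  have hz := caputo_eq_zero h0 (mul_pos hΓ (fracEigenvalue_pos α γ n)) hT (w := w)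
    (((innerSL ℝ (eigenVec n)).continuous.comp_continuousOn hU.continuousOn).sub
      (continuousOn_const.mul ((continuousOn_mode h0 h1 α γ n).mono Icc_subset_Ici_self)))
    (fun s hs => (hderiv s hs).differentiableAt) (fun t ht => (hcap t ht).1)
    (fun t ht => (hcap t ht).2) (by rw [hw]; simp [hU.initial, mode_zero h0 h1])
  exact fun t ht => sub_eq_zero.1 (hz t ht)

theorem eq_solFun_of_isWeakSolution {T : ℝ} (hT : 0 < T) (h0 : 0 < β) (h1 : β < 1)
    (hf : Summable fun n => |coeff f n|) {u : ℝ → ℝ → ℝ} (hu : IsWeakSolution T β α γ f u) :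
    ∀ t ∈ Ioc 0 T, ∀ x ∈ Icc (-1 : ℝ) 1, u t x = solFun β α γ f t x := by
  obtain ⟨U, hUu, hU⟩ := hu.curve
  intro t ht
  have hUt : U t = solCurve β α γ f t := ext_coeff fun n => by
    rw [coeff_of_isSolutionCurve hT h0 h1 hU n t ⟨ht.1.le, ht.2⟩, coeff_solCurve h0 h1 hf ht.1.le]
  have hae : u t =ᵐ[volD] solFun β α γ f t :=
    (hUu t ht).symm.trans (hUt ▸ coeFn_solCurve h0 h1 hf ht.1.le)
  -- Equality in L² becomes equality at every point, including x = 0, by continuity on the closed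
  -- interval.
  refine Measure.eqOn_Icc_of_ae_eq volume (by norm_num) ?_ (hu.continuousOn t ht)
    ((isWeakSolution_solFun h0 h1 hf T).continuousOn t ht)
  rwa [← restrict_Ioo_eq_restrict_Icc]

/-! ### The trace -/

theorem memLp_trace (h0 : 0 < β) (h1 : β < 1) (hf : Summable fun n => |coeff f n|) (T x : ℝ) :
    MemLp (fun t => solFun β α γ f t x) 2 (volume.restrict (Ioc 0 T)) := by
  refine MemLp.of_bound (C := ∑' n, |coeff f n|) ?_ ?_
  · exact ((continuousOn_solFun_time h0 h1 hf x).mono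
      (Ioc_subset_Ioi_self.trans Ioi_subset_Ici_self)).aestronglyMeasurable measurableSet_Ioc
  · filter_upwards [ae_restrict_mem measurableSet_Ioc] with t ht
    exact tsum_of_norm_bounded hf.hasSum fun n =>
      abs_coeff_mul_mode_mul_eigenFun_le h0 h1 n ht.1.le x

end

theorem memLp_rpow_neg {T δ : ℝ} (hδ : δ < 1 / 2) :
    MemLp (fun t : ℝ => t ^ (-δ)) 2 (volume.restrict (Ioc 0 T)) := by
  rw [memLp_two_iff_integrable_sq (by fun_prop)]
  have h := (intervalIntegral.intervalIntegrable_rpow' (a := 0) (b := T)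
    (show -1 < -(2 * δ) by linarith)).1
  refine IntegrableOn.congr_fun h (fun t ht => ?_) measurableSet_Ioc
  rw [← Real.rpow_natCast, ← Real.rpow_mul ht.1.le]
  congr 1
  push_cast
  ring

/-- The trace depends on the parameters in a Lipschitz way, pointwise in time. -/
theorem exists_abs_solFun_sub_le {T β₀ β₁ α₀ : ℝ} (hT : 0 < T) (hβ₀ : 0 < β₀) (hβ₁ : β₁ < 1)
    (hα₀ : 0 < α₀) (α₁ γ₀ γ₁ : ℝ) {f : L2D} (hf : Summable fun n => |coeff f n|) :
    ∃ C, 0 ≤ C ∧ ∀ p ∈ paramBox β₀ β₁ α₀ α₁ γ₀ γ₁, ∀ q ∈ paramBox β₀ β₁ α₀ α₁ γ₀ γ₁,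
      ∀ t ∈ Ioc 0 T, ∀ x, |solFun p.1 p.2.1 p.2.2 f t x - solFun q.1 q.2.1 q.2.2 f t x|
        ≤ C * dist p q * t ^ (-(β₀ / 4)) := by
  obtain ⟨C, hC, h⟩ := exists_abs_mode_sub_le hT hβ₀ hβ₁ hα₀ α₁ γ₀ γ₁
  have hS : 0 ≤ ∑' n, |coeff f n| := tsum_nonneg fun n => abs_nonneg _
  refine ⟨C * ∑' n, |coeff f n|, mul_nonneg hC hS, fun p hp q hq t ht x => ?_⟩
  have hsum : ∀ r ∈ paramBox β₀ β₁ α₀ α₁ γ₀ γ₁,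
      Summable fun n => coeff f n * mode r.1 r.2.1 r.2.2 n t * eigenFun n x := fun r hr =>
    summable_mul_eigenFun (summable_coeff_mul_mode (hβ₀.trans_le hr.1.1) (hr.1.2.trans_lt hβ₁)
      hf ht.1.le) x
  rw [solFun, solFun, ← (hsum p hp).tsum_sub (hsum q hq)]
  have hb := hf.hasSum.mul_left (C * t ^ (-(β₀ / 4)) * dist p q)
  have hring : C * t ^ (-(β₀ / 4)) * dist p q * ∑' n, |coeff f n|
      = (C * ∑' n, |coeff f n|) * dist p q * t ^ (-(β₀ / 4)) := by ring
  rw [← hring, ← Real.norm_eq_abs]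
  refine tsum_of_norm_bounded hb fun n => ?_
  rw [← sub_mul, ← mul_sub, norm_mul, norm_mul]
  calc ‖coeff f n‖ * ‖mode p.1 p.2.1 p.2.2 n t - mode q.1 q.2.1 q.2.2 n t‖ * ‖eigenFun n x‖
      ≤ ‖coeff f n‖ * (C * t ^ (-(β₀ / 4)) * dist p q) * 1 := by
        have h1 := h p hp q hq n t ht
        have h2 := (abs_nonneg _).trans h1
        gcongr
        · exact h1
        · exact abs_eigenFun_le_one n x
    _ = _ := by
      rw [Real.norm_eq_abs]
      ring

end DoubleFrac

end

/-! ### Well-posedness and the Lipschitz bound for the trace -/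

theorem mainTheorem2 (T : ℝ) (hT : 0 < T)
    (β₀ β₁ α₀ α₁ γ₀ γ₁ : ℝ) (hβ₀ : 0 < β₀) (hβ₁ : β₁ < 1)
    (hα₀ : 0 < α₀) (hα₁ : α₁ < 2) (hγ₀ : 0 < γ₀) (hγ₁ : γ₁ < 2)
    (f : DoubleFrac.L2D)
    (hf : ∀ p ∈ DoubleFrac.paramBox β₀ β₁ α₀ α₁ γ₀ γ₁, DoubleFrac.MemHdot p.2.1 p.2.2 f)
    (hf_sum : Summable fun n => |DoubleFrac.coeff f n|) :
    -- for every parameter there is exactly one weak solution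
    (∀ p ∈ DoubleFrac.paramBox β₀ β₁ α₀ α₁ γ₀ γ₁,
      ∃ u : ℝ → ℝ → ℝ, DoubleFrac.IsWeakSolution T p.1 p.2.1 p.2.2 f u ∧
        ∀ v : ℝ → ℝ → ℝ, DoubleFrac.IsWeakSolution T p.1 p.2.1 p.2.2 f v →
          ∀ t ∈ Ioc 0 T, ∀ x ∈ Icc (-1 : ℝ) 1, v t x = u t x) ∧
    -- and the map from the parameters to the trace at `0` is Lipschitz into `L²(0, T]`
    ∃ K : NNReal, ∀ u : ℝ × ℝ × ℝ → ℝ → ℝ → ℝ,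
      (∀ p ∈ DoubleFrac.paramBox β₀ β₁ α₀ α₁ γ₀ γ₁,
        DoubleFrac.IsWeakSolution T p.1 p.2.1 p.2.2 f (u p)) →
      ∃ h : ∀ p : DoubleFrac.paramBox β₀ β₁ α₀ α₁ γ₀ γ₁,
          MemLp (fun t => u p t 0) 2 (volume.restrict (Ioc 0 T)),
        LipschitzWith K fun p : DoubleFrac.paramBox β₀ β₁ α₀ α₁ γ₀ γ₁ =>
          (h p).toLp (fun t => u p t 0) := by
  have hβ : ∀ p ∈ DoubleFrac.paramBox β₀ β₁ α₀ α₁ γ₀ γ₁, 0 < p.1 ∧ p.1 < 1 := fun p hp =>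
    ⟨hβ₀.trans_le hp.1.1, hp.1.2.trans_lt hβ₁⟩
  refine ⟨fun p hp => ⟨DoubleFrac.solFun p.1 p.2.1 p.2.2 f,
    DoubleFrac.isWeakSolution_solFun (hβ p hp).1 (hβ p hp).2 hf_sum T, fun v hv =>
      DoubleFrac.eq_solFun_of_isWeakSolution hT (hβ p hp).1 (hβ p hp).2 hf_sum hv⟩, ?_⟩
  obtain ⟨C, hC, h⟩ := DoubleFrac.exists_abs_solFun_sub_le hT hβ₀ hβ₁ hα₀ α₁ γ₀ γ₁ hf_sum
  -- For an empty box there is nothing to estimate. Otherwise β₀ ≤ β₁ < 1, so β₀/4 < 1/2 and the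
  -- weight t^{-β₀/4} lies in L²(0, T].
  by_cases hne : β₀ ≤ β₁
  swap
  · exact ⟨0, fun u _ => ⟨fun p => absurd (p.2.1.1.trans p.2.1.2) hne,
      fun p => absurd (p.2.1.1.trans p.2.1.2) hne⟩⟩
  have hW := DoubleFrac.memLp_rpow_neg (T := T) (δ := β₀ / 4) (by linarith)
  refine ⟨(C * ‖hW.toLp _‖).toNNReal, fun u hu => ?_⟩
  -- Uniqueness identifies the trace of an arbitrary family of weak solutions with that of the
  -- series, so one K serves all families.
  have heq : ∀ p : DoubleFrac.paramBox β₀ β₁ α₀ α₁ γ₀ γ₁, ∀ t ∈ Ioc 0 T,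
      u p t 0 = DoubleFrac.solFun p.1.1 p.1.2.1 p.1.2.2 f t 0 := fun p t ht =>
    DoubleFrac.eq_solFun_of_isWeakSolution hT (hβ p p.2).1 (hβ p p.2).2 hf_sum (hu p p.2) t ht 0
      (by norm_num)
  have hmem : ∀ p : DoubleFrac.paramBox β₀ β₁ α₀ α₁ γ₀ γ₁,
      MemLp (fun t => u p t 0) 2 (volume.restrict (Ioc 0 T)) := fun p => by
    refine (DoubleFrac.memLp_trace (α := p.1.2.1) (γ := p.1.2.2) (hβ p p.2).1
      (hβ p p.2).2 hf_sum T 0).ae_eq ?_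
    filter_upwards [ae_restrict_mem measurableSet_Ioc] with t ht using (heq p t ht).symm
  refine ⟨hmem, LipschitzWith.of_dist_le_mul fun p q => ?_⟩
  rw [dist_eq_norm, Real.coe_toNNReal _ (by positivity), Subtype.dist_eq]
  have key : ‖(hmem p).toLp (fun t => u p t 0) - (hmem q).toLp (fun t => u q t 0)‖
      ≤ C * dist p.1 q.1 * ‖hW.toLp _‖ := by
    refine Lp.norm_le_mul_norm_of_ae_le_mul ?_
    filter_upwards [ae_restrict_mem measurableSet_Ioc, hW.coeFn_toLp, (hmem p).coeFn_toLp,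
      (hmem q).coeFn_toLp, Lp.coeFn_sub ((hmem p).toLp _) ((hmem q).toLp _)] with t ht e1 e2 e3 e4
    rw [e4, Pi.sub_apply, e1, e2, e3, heq p t ht, heq q t ht, Real.norm_eq_abs,
      Real.norm_of_nonneg (Real.rpow_nonneg ht.1.le _)]
    exact h p p.2 q q.2 t ht 0
  exact key.trans (le_of_eq (by ring))
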